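/- Let $\mathcal O$ be a complete discrete valuation ring of characteristic $0$ with maximal ideal $2\mathcal O$ and algebraically closed residue field $k$ (for example the ring of integers of the $2$-adic completion of the maximal unramified extension of $\mathbb Q_2$), let $K$ be its field of fractions, and let $\nu_2$ be the valuation of $K$ with $\nu_2(2)=1$. Fix $n\ge 3$, put $\kappa=2^{n-2}$ and let $c\in\{0,1\}\subseteq k$. For $i\ge 2$ let $\zeta_i\in\overline K$ be a primitive $2^i$-th root of unity and put $K_i=K(\zeta_i+\zeta_i^{-1})$. Let $\mathcal D(2B)^{\kappa,c}=kQ/I$, where $Q$ is the quiver with vertices $0,1$ and arrows $\alpha:0\to 0$, $\beta:0\to 1$, $\gamma:1\to 0$, $\eta:1\to 1$, paths are composed from left to right, and $$I=\langle \beta\eta,\ \eta\gamma,\ \gamma\beta,\ \alpha^2-c\,\alpha\beta\gamma,\ \alpha\beta\gamma-\beta\gamma\alpha,\ \gamma\alpha\beta-\eta^\kappa\rangle .$$ An $\mathcal O$-order is an $\mathcal O$-algebra that is free and finitely generated as an $\mathcal O$-module. A lift of $\mathcal D(2B)^{\kappa,c}$ is an $\mathcal O$-order $\Gamma$ together with an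 isomorphism of $k$-algebras $k\otimes_{\mathcal O}\Gamma\cong\mathcal D(2B)^{\kappa,c}$. If $K\otimes\Gamma$ is semisimple, the decomposition matrix of $\Gamma$ has as its entry at a central primitive idempotent $\varepsilon$ of $K\otimes\Gamma$ and a projective indecomposable right $\Gamma$-module $P$ the multiplicity in $K\otimes P$ of the simple $K\otimes\Gamma$-module belonging to $\varepsilon$. A lift $\Gamma$ satisfies the rational conditions if (i) $K\otimes\Gamma$ is Morita equivalent to $K\oplus K\oplus K\oplus K\oplus\bigoplus_{r=0}^{n-3}K_{r+2}$; (ii) $\Gamma$ has exactly two projective indecomposable modules up to isomorphism and, for a suitable numbering of these and a suitable identification of the center $Z(K\otimes\Gamma)$ with $K\oplus K\oplus K\oplus K\oplus\bigoplus_{r=0}^{n-3}K_{r+2}$, its decomposition matrix has the rows $(1,0),(1,0),(1,1),(1,1)$ at the first four summands and the row $(0,1)$ at each summand $K_{r+2}$; (iii) under the same identification there is an element $u=(u_1,u_1,u_2,u_2,u_3,\ldots,u_3)$ with $u_1,u_2,u_3\in K$, $\nu_2(u_1)=\nu_2(u_2)=-n$ and $\nu_2(u_3)=-n+1$, such that $\Gamma=\{a\in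 K\otimes\Gamma \mid T_u(a,\Gamma)\subseteq\mathcal O\}$, where $T_u(a,b)=\sum_i \operatorname{tr}_{F_i/K}\operatorname{trred}(\varepsilon_i u a b)$, the sum running over the Wedderburn components of $K\otimes\Gamma$, with centers $F_i$ and central primitive idempotents $\varepsilon_i$. For lifts $\Gamma,\Gamma'$ satisfying the rational conditions, write $Z(\Gamma)=Z(\Gamma')$ if there is an isomorphism of $\mathcal O$-algebras $g:Z(\Gamma)\to Z(\Gamma')$ such that, up to one fixed permutation of columns, for every central primitive idempotent $\varepsilon$ of $K\otimes\Gamma$ the row of the decomposition matrix of $\Gamma$ at $\varepsilon$ equals the row of the decomposition matrix of $\Gamma'$ at $(\mathrm{id}_K\otimes g)(\varepsilon)$. **Theorem.** If $\Gamma,\Gamma'$ are lifts of $\mathcal D(2B)^{\kappa,c}$ that satisfy the rational conditions and $Z(\Gamma)=Z(\Gamma')$, then $\Gamma\cong\Gamma'$ as $\mathcal O$-algebras. Moreover, if a lift of $\mathcal D(2B)^{\kappa,c}$ satisfying the rational conditions exists, then $c=0$. -/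

import Mathlib

open scoped TensorProduct
open IsLocalRing (ResidueField maximalIdeal)

universe u v w

noncomputable section

/-! ### The algebra `𝒟(2B)^{κ,c}`: the path algebra of a quiver with two vertices modulo relations -/

/-- The arrows of the quiver `Q` with vertices `0, 1`: a loop `α` at `0`, an arrow `β` from `0`
to `1`, an arrow `γ` from `1` to `0`, and a loop `η` at `1`. -/
inductive DTwoBArrow : Type
  | α | β | γ | η

/-- The vertex in which an arrow starts. -/
def DTwoBArrow.source : DTwoBArrow → Fin 2
  | .α => 0
  | .β => 0
  | .γ => 1
  | .η => 1

/-- The vertex in which an arrow ends. -/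
def DTwoBArrow.target : DTwoBArrow → Fin 2
  | .α => 0
  | .β => 1
  | .γ => 0
  | .η => 1

/-- The trivial path at the vertex `i`, as an element of the free algebra. -/
def dTwoBVertex (k : Type u) [Field k] (i : Fin 2) : FreeAlgebra k (Fin 2 ⊕ DTwoBArrow) :=
  FreeAlgebra.ι k (Sum.inl i)

/-- An arrow, as an element of the free algebra. -/
def dTwoBArrow (k : Type u) [Field k] (a : DTwoBArrow) : FreeAlgebra k (Fin 2 ⊕ DTwoBArrow) :=
  FreeAlgebra.ι k (Sum.inr a)

/-- The first four constructors present the path algebra `kQ` (products of paths are read from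
left to right, so that `α * β` is the path "first `α`, then `β`"); the other six
generate the ideal
`⟨βη, ηγ, γβ, α² - c·αβγ, αβγ - βγα, γαβ - η^κ⟩` of `kQ`. -/
inductive DTwoBRel (k : Type u) [Field k] (κ : ℕ) (c : k) :
    FreeAlgebra k (Fin 2 ⊕ DTwoBArrow) → FreeAlgebra k (Fin 2 ⊕ DTwoBArrow) → Prop
  | vertex_mul (i j : Fin 2) : DTwoBRel k κ c
      (dTwoBVertex k i * dTwoBVertex k j) (if i = j then dTwoBVertex k i else 0)
  | vertex_sum : DTwoBRel k κ c (dTwoBVertex k 0 + dTwoBVertex k 1) 1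
  | source_mul (a : DTwoBArrow) : DTwoBRel k κ c
      (dTwoBVertex k a.source * dTwoBArrow k a) (dTwoBArrow k a)
  | mul_target (a : DTwoBArrow) : DTwoBRel k κ c
      (dTwoBArrow k a * dTwoBVertex k a.target) (dTwoBArrow k a)
  | β_η : DTwoBRel k κ c (dTwoBArrow k .β * dTwoBArrow k .η) 0
  | η_γ : DTwoBRel k κ c (dTwoBArrow k .η * dTwoBArrow k .γ) 0
  | γ_β : DTwoBRel k κ c (dTwoBArrow k .γ * dTwoBArrow k .β) 0
  | α_sq : DTwoBRel k κ c (dTwoBArrow k .α ^ 2)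
      (c • (dTwoBArrow k .α * dTwoBArrow k .β * dTwoBArrow k .γ))
  | αβγ : DTwoBRel k κ c (dTwoBArrow k .α * dTwoBArrow k .β * dTwoBArrow k .γ)
      (dTwoBArrow k .β * dTwoBArrow k .γ * dTwoBArrow k .α)
  | γαβ : DTwoBRel k κ c (dTwoBArrow k .γ * dTwoBArrow k .α * dTwoBArrow k .β)
      (dTwoBArrow k .η ^ κ)

/-- The `k`-algebra `𝒟(2B)^{κ,c} = kQ / I`. -/
abbrev DTwoB (k : Type u) [Field k] (κ : ℕ) (c : k) : Type u := RingQuot (DTwoBRel k κ c)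

/-! ### Orders and lifts -/

/-- A lift of the algebra `B` over the residue field `k` of `O`: an `O`-order `Γ` (an `O`-algebra
that is free and finitely generated as an `O`-module) with an isomorphism `k ⊗ Γ ≃ B`. -/
structure OrderLift (O : Type u) [CommRing O] [IsLocalRing O]
    (B : Type v) [Ring B] [Algebra (ResidueField O) B] where
  /-- The underlying type of the order. -/
  carrier : Type w
  [ring : Ring carrier]
  [algebra : Algebra O carrier]
  [finite : Module.Finite O carrier]
  [free : Module.Free O carrier]
  /-- The identification of the reduction. -/
  reduction : (ResidueField O ⊗[O] carrier) ≃ₐ[ResidueField O] B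

attribute [instance] OrderLift.ring OrderLift.algebra OrderLift.finite OrderLift.free

/-! ### Decomposition numbers -/

/-- An indecomposable module. -/
def IsIndecomposableModule (R : Type u) (M : Type v) [Ring R] [AddCommGroup M] [Module R M] :
    Prop :=
  Nontrivial M ∧ ∀ N₁ N₂ : Submodule R M, IsCompl N₁ N₂ → N₁ = ⊥ ∨ N₂ = ⊥

/-- The right ideal `x A` of `A`, a right `A`-module. -/
abbrev principalRightIdeal {A : Type u} [Ring A] (x : A) : Submodule Aᵐᵒᵖ A :=
  Submodule.span Aᵐᵒᵖ {x}

/-- The `e j` are idempotents of `Γ` such that the right modules `e j Γ` represent every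
isomorphism class of finitely generated projective indecomposable right `Γ`-modules exactly once. -/
structure IsProjIndecSystem {Γ : Type w} [Ring Γ] {m : ℕ} (e : Fin m → Γ) : Prop where
  idempotent : ∀ j, IsIdempotentElem (e j)
  indecomposable : ∀ j, IsIndecomposableModule Γᵐᵒᵖ (principalRightIdeal (e j))
  pairwise_not_iso : ∀ i j, i ≠ j →
    IsEmpty (principalRightIdeal (e i) ≃ₗ[Γᵐᵒᵖ] principalRightIdeal (e j))
  complete : ∀ (P : Type w) [AddCommGroup P] [Module Γᵐᵒᵖ P],
    Module.Finite Γᵐᵒᵖ P → Module.Projective Γᵐᵒᵖ P → IsIndecomposableModule Γᵐᵒᵖ P →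
    ∃ j, Nonempty (P ≃ₗ[Γᵐᵒᵖ] principalRightIdeal (e j))

/-- The decomposition number of an order `Γ` with semisimple `A = K ⊗ Γ` at the projective
module `P = e Γ` and the Wedderburn component of `A` with central primitive idempotent `ε`: the
multiplicity in `K ⊗ P = (1 ⊗ e) A` of the simple right module belonging to `ε`, which is the length
of `ε (1 ⊗ e) A`. -/
def decompositionNumber {O : Type u} (K : Type v) {Γ : Type w} [CommRing O] [Field K] [Algebra O K]
    [Ring Γ] [Algebra O Γ] (ε : K ⊗[O] Γ) (e : Γ) : ℕ∞ :=
  Module.length (K ⊗[O] Γ)ᵐᵒᵖ (principalRightIdeal (ε * ((1 : K) ⊗ₜ[O] e)))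

/-! ### The rational conditions -/

/-- For `ζ` a primitive `2 ^ i`-th root of unity this is the field `K_i = K(ζ + ζ⁻¹)`. -/
def realCyclotomic {K : Type v} [Field K] (ζ : AlgebraicClosure K) :
    IntermediateField K (AlgebraicClosure K) :=
  IntermediateField.adjoin K {ζ + ζ⁻¹}

/-- The rows of the decomposition matrix: four rows `Sum.inl 0, …, Sum.inl 3`, and a row
`Sum.inr r` for each `r = 0, …, n - 3`. -/
abbrev DTwoBRow (n : ℕ) : Type := Fin 4 ⊕ Fin (n - 2)

/-- The field belonging to a row: `K` in the first four rows, and `K_{r+2}` in the row of `r`. -/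
def rowField {K : Type v} [Field K] (ζ : ℕ → AlgebraicClosure K) (n : ℕ) :
    DTwoBRow n → IntermediateField K (AlgebraicClosure K)
  | Sum.inl _ => ⊥
  | Sum.inr r => realCyclotomic (ζ (r + 2))

/-- The prescribed decomposition matrix. -/
def rowDecomposition (n : ℕ) : DTwoBRow n → Fin 2 → ℕ
  | Sum.inl i => ![![1, 0], ![1, 0], ![1, 1], ![1, 1]] i
  | Sum.inr _ => ![0, 1]

/-- The element `(u₁, u₁, u₂, u₂, u₃, …, u₃)`. -/
def rowSymmetrizing {K : Type v} (n : ℕ) (u₁ u₂ u₃ : K) : DTwoBRow n → K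
  | Sum.inl i => ![u₁, u₁, u₂, u₂] i
  | Sum.inr _ => u₃

/-- The bilinear form `T_u(a, b) = ∑ i, tr_{F i / K} (trred (ε i * u * a * b))` on an algebra `A`
with a given Wedderburn decomposition into matrix rings over fields `F i`; the reduced
trace of a matrix ring over a field is the matrix trace. -/
def wedderburnForm {K : Type u} {A : Type v} {ι : Type} [Field K] [Ring A] [Algebra K A] [Fintype ι]
    {L : Type w} [Field L] [Algebra K L] (F : ι → IntermediateField K L) (d : ι → ℕ)
    (Ψ : A ≃ₐ[K] (∀ i, Matrix (Fin (d i)) (Fin (d i)) (F i))) (x : ∀ i, F i) :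
    LinearMap.BilinForm K A :=
  (LinearMap.mul K A).compr₂
    (∑ i, Algebra.trace K (F i) ∘ₗ LinearMap.mulLeft K (x i) ∘ₗ
      Matrix.traceLinearMap (Fin (d i)) K (F i) ∘ₗ LinearMap.proj i ∘ₗ Ψ.toLinearMap)

/-- The lattice `Γ`, embedded into `K ⊗ Γ`. -/
def orderLattice {O : Type u} (K : Type v) (Γ : Type w) [CommRing O] [Field K] [Algebra O K]
    [Ring Γ] [Algebra O Γ] : Submodule O (K ⊗[O] Γ) :=
  LinearMap.range (TensorProduct.mk O K Γ 1)

/-- `x` has `2`-valuation `m`, where `2` generates the maximal ideal of `O`. -/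
def HasTwoValuation (O : Type u) {K : Type v} [CommRing O] [Field K] [Algebra O K] (x : K) (m : ℤ) :
    Prop :=
  ∃ a : Oˣ, x = algebraMap O K a * 2 ^ m

/-- The rational conditions on an order `Γ`. The Wedderburn decomposition `Ψ` of `K ⊗ Γ` fixes
which component belongs to which row; the idempotents `e 0, e 1` label the columns. -/
def SatisfiesRationalConditions (O : Type u) {K : Type v} [CommRing O] [Field K] [Algebra O K]
    (ζ : ℕ → AlgebraicClosure K) (n : ℕ) (Γ : Type w) [Ring Γ] [Algebra O Γ] : Prop :=
  IsMoritaEquivalent K (K ⊗[O] Γ) (∀ i, rowField ζ n i) ∧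
  ∃ (d : DTwoBRow n → ℕ)
    (Ψ : (K ⊗[O] Γ) ≃ₐ[K] (∀ i, Matrix (Fin (d i)) (Fin (d i)) (rowField ζ n i))),
    (∀ i, 0 < d i) ∧
    (∃ e : Fin 2 → Γ, IsProjIndecSystem e ∧
      ∀ i j, decompositionNumber K (Ψ.symm (Pi.single i 1)) (e j) = rowDecomposition n i j) ∧
    (∃ u₁ u₂ u₃ : K, HasTwoValuation O u₁ (-n) ∧ HasTwoValuation O u₂ (-n) ∧
      HasTwoValuation O u₃ (-n + 1) ∧
      (wedderburnForm (rowField ζ n) d Ψ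
        (fun i => algebraMap K _ (rowSymmetrizing n u₁ u₂ u₃ i))).dualSubmodule
          (orderLattice (O := O) K Γ) = orderLattice (O := O) K Γ)

/-! ### Equality of centers -/

/-- A primitive idempotent of a commutative ring. -/
def IsPrimitiveIdempotent {R : Type u} [CommRing R] (e : R) : Prop :=
  IsIdempotentElem e ∧ e ≠ 0 ∧
    ∀ f g : R, IsIdempotentElem f → IsIdempotentElem g → f * g = 0 → f + g = e → f = 0 ∨ g = 0

/-- The canonical map `K ⊗ Z(Γ) → K ⊗ Γ`, which identifies `K ⊗ Z(Γ)` with `Z(K ⊗ Γ)`. -/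
def centerEmbedding {O : Type u} (K : Type v) (Γ : Type w) [CommRing O] [Field K] [Algebra O K]
    [Ring Γ] [Algebra O Γ] : (K ⊗[O] Subalgebra.center O Γ) →ₐ[K] (K ⊗[O] Γ) :=
  Algebra.TensorProduct.map (AlgHom.id K K) (Subalgebra.center O Γ).val

/-- Two orders have *equal* centers: there is an isomorphism `g : Z(Γ) ≃ Z(Γ')` such that, up to a
fixed permutation of the columns, the row of the decomposition matrix of `Γ` at each central
primitive idempotent `ε` of `K ⊗ Γ` equals the row of the decomposition matrix of `Γ'` at
`(id ⊗ g) ε`. The permutation is absorbed into the numbering of the projective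
indecomposable modules. -/
def HaveEqualCenters (O : Type u) (K : Type v) [CommRing O] [Field K] [Algebra O K]
    (Γ Γ' : Type w) [Ring Γ] [Algebra O Γ] [Ring Γ'] [Algebra O Γ'] : Prop :=
  ∃ (g : Subalgebra.center O Γ ≃ₐ[O] Subalgebra.center O Γ')
    (m : ℕ) (e : Fin m → Γ) (e' : Fin m → Γ'), IsProjIndecSystem e ∧ IsProjIndecSystem e' ∧
    ∀ ε : K ⊗[O] Subalgebra.center O Γ, IsPrimitiveIdempotent ε → ∀ j,
      decompositionNumber K (centerEmbedding K Γ ε) (e j) =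
        decompositionNumber K (centerEmbedding K Γ'
          (Algebra.TensorProduct.map (AlgHom.id K K) (g : _ →ₐ[O] _) ε)) (e' j)

end

/-! The order is reconstructed from its center inside explicit coordinates. Lifting vertices and
arrows (`OrderLift.nonempty_liftedQuiver`) gives orthogonal idempotents f₀, f₁ of Γ and generators
of its four Peirce corners. By the decomposition matrix, K ⊗ Γ becomes K² × M₂(K)² × ∏ K_{r+2} with
f₀ = (1, 1; E₁₁, E₁₁; 0) and f₁ = (0, 0; E₂₂, E₂₂; 1) (`exists_coordinates`). Comparing ranks of
corners excludes the other assignment of vertices to columns. After a diagonal conjugation β = (E₁₂,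
E₁₂), while α, γ, η have coordinates (p₀, p₁; a₀, a₁), (b₀, b₁) and (h₀, h₁; π).

Self-duality under T_u controls these numbers. In f₀Γf₁ it shows that T_u(αβγ) is a unit. In f₁Γf₁
it produces a polynomial in η that vanishes on all field components; as η is nilpotent modulo 2, the
value of this polynomial at h₀ is divisible by 2^(n-2), and the valuation of u₂ then forces a₁ - a₀
to be twice a unit (`not_two_dvd_difference`). The lifted relation for α² converts this into the
evenness of c and into congruences between the p's and the a's (`dvd_of_generator_congruences`).
Consequently, after permuting components, the corners f₀Γf₀, f₀Γf₁ and f₁Γf₀ are fixed lattices that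
depend only on n (`IsStandardEmbedding`).

The last corner is Z(Γ)f₁ (`IsStandardEmbedding.exists_center_mul_f₁`). An isomorphism of centers
that respects decomposition numbers respects the annihilators of f₀ and f₁ in the centers, hence is
the identity on the M₂ coordinates up to their order, and the standard form is symmetric under that
reordering. The pairs in Γ × Γ' that match in coordinates then form the graph of an isomorphism
(`IsStandardEmbedding.nonempty_algEquiv`). -/

noncomputable section

section

/-! ### Adic limits and lifting of idempotents -/

section Adic

variable {O : Type u} [CommRing O] {Γ : Type w} [Ring Γ] [Algebra O Γ]
  [Module.Free O Γ]

theorem mem_span_singleton_pow_smul_top_iff (a : O) (n : ℕ) (x : O) :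
    x ∈ (Ideal.span {a} ^ n • ⊤ : Submodule O O) ↔ ∃ y, x = a ^ n * y := by
  rw [Ideal.span_singleton_pow, smul_eq_mul, Ideal.mul_top, Ideal.mem_span_singleton]
  rfl

theorem eq_zero_of_forall_pow_smul {a : O} [IsAdicComplete (Ideal.span {a}) O] (x : Γ)
    (h : ∀ n : ℕ, ∃ y : Γ, x = a ^ n • y) : x = 0 := by
  let b := Module.Free.chooseBasis O Γ
  apply b.repr.injective
  ext i
  rw [map_zero, Finsupp.zero_apply]
  apply IsHausdorff.haus (I := Ideal.span {a}) inferInstance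
  intro n
  obtain ⟨y, rfl⟩ := h n
  rw [SModEq.zero, mem_span_singleton_pow_smul_top_iff]
  exact ⟨b.repr y i, by simp⟩

theorem exists_adic_limit [Module.Finite O Γ] {a : O} [IsAdicComplete (Ideal.span {a}) O] (x : ℕ → Γ)
    (h : ∀ n, ∃ y, x (n + 1) - x n = a ^ n • y) : ∃ l, ∀ n, ∃ y, l - x n = a ^ n • y := by
  let b := Module.Free.chooseBasis O Γ
  have key : ∀ i, ∃ l : O, ∀ n, ∃ y, l - b.repr (x n) i = a ^ n * y := by
    intro i
    have hstep : ∀ m k, ∃ y, b.repr (x (m + k)) i - b.repr (x m) i = a ^ m * y := by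
      intro m k
      induction k with
      | zero => exact ⟨0, by simp⟩
      | succ k ih =>
        obtain ⟨y, hy⟩ := ih
        obtain ⟨z, hz⟩ := h (m + k)
        have hz' : b.repr (x (m + (k + 1))) i - b.repr (x (m + k)) i
            = a ^ (m + k) * b.repr z i := by
          have := congrArg (fun t => b.repr t i) hz
          simpa [add_assoc] using this
        exact ⟨y + a ^ k * b.repr z i, by rw [pow_add] at hz'; linear_combination hy + hz'⟩
    obtain ⟨l, hl⟩ := IsPrecomplete.prec (I := Ideal.span {a}) (M := O) inferInstance
      (f := fun n => b.repr (x n) i) (by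
        intro m n hmn
        obtain ⟨k, rfl⟩ := Nat.exists_eq_add_of_le hmn
        rw [SModEq.comm, SModEq.sub_mem, mem_span_singleton_pow_smul_top_iff]
        exact hstep m k)
    refine ⟨l, fun n => ?_⟩
    have := hl n
    rwa [SModEq.comm, SModEq.sub_mem, mem_span_singleton_pow_smul_top_iff] at this
  choose l hl using key
  refine ⟨b.equivFun.symm l, fun n => ?_⟩
  choose y hy using fun i => hl i n
  refine ⟨b.equivFun.symm y, ?_⟩
  apply b.equivFun.injective
  ext i
  have : b.equivFun (x n) i = b.repr (x n) i := by simp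
  simp only [map_sub, map_smul, LinearEquiv.apply_symm_apply, Pi.sub_apply, Pi.smul_apply, this,
    hy, smul_eq_mul]

/-- Newton iteration e ↦ 3e² - 2e³: the new defect e² - e is a multiple of the square of the old
one. Gaining a single factor a per step already suffices for convergence, so only that is recorded.
Noncommutativity is harmless because everything happens among powers of one element. -/
theorem exists_isIdempotentElem_sub_eq_smul [Module.Finite O Γ] {a : O} [IsAdicComplete (Ideal.span {a}) O] (x : Γ)
    (hx : ∃ y, x * x - x = a • y) : ∃ e : Γ, IsIdempotentElem e ∧ ∃ y, e - x = a • y := by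
  let F : Γ → Γ := fun e => 3 * e ^ 2 - 2 * e ^ 3
  have hF : ∀ e, F e * F e - F e = (e * e - e) * (e * e - e) * (4 * e ^ 2 - 4 * e - 3) := by
    intro e; simp only [F]; noncomm_ring
  have hF' : ∀ e, F e - e = (e * e - e) * (1 - 2 * e) := by
    intro e; simp only [F]; noncomm_ring
  let s : ℕ → Γ := fun n => F^[n] x
  have hs : ∀ n, s (n + 1) = F (s n) := fun n => Function.iterate_succ_apply' F n x
  have hidem : ∀ n, ∃ y, s n * s n - s n = a ^ (n + 1) • y := by
    intro n
    induction n with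
    | zero => simpa [s] using hx
    | succ n ih =>
      obtain ⟨y, hy⟩ := ih
      refine ⟨a ^ n • (y * y * (4 * s n ^ 2 - 4 * s n - 3)), ?_⟩
      rw [hs, hF, hy]
      simp only [smul_mul_assoc, mul_smul_comm, smul_smul]
      congr 1; ring
  have hdiff : ∀ n, ∃ y, s (n + 1) - s n = a ^ (n + 1) • y := by
    intro n
    obtain ⟨y, hy⟩ := hidem n
    exact ⟨y * (1 - 2 * s n), by rw [hs, hF', hy, smul_mul_assoc]⟩
  obtain ⟨l, hl⟩ := exists_adic_limit (a := a) s fun n => by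
    obtain ⟨y, hy⟩ := hdiff n
    exact ⟨a • y, by rw [hy, smul_smul, pow_succ]⟩
  refine ⟨l, ?_, ?_⟩
  · rw [IsIdempotentElem, ← sub_eq_zero]
    apply eq_zero_of_forall_pow_smul (a := a)
    intro n
    obtain ⟨y, hy⟩ := hl n
    obtain ⟨z, hz⟩ := hidem n
    refine ⟨y * l + s n * y + a • z - y, ?_⟩
    have : l * l - l = (l - s n) * l + s n * (l - s n) + (s n * s n - s n) - (l - s n) := by
      noncomm_ring
    rw [this, hy, hz]
    simp only [smul_mul_assoc, mul_smul_comm, smul_add, smul_sub, smul_smul, pow_succ]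
  · obtain ⟨y, hy⟩ := hl 1
    obtain ⟨z, hz⟩ := hdiff 0
    refine ⟨y + z, ?_⟩
    have : l - x = (l - s 1) + (s (0 + 1) - s 0) := by simp [s]
    rw [this, hy, hz]
    simp

end Adic

/-! ### The reduction of a lift -/

section Reduction

variable {O : Type u} [CommRing O] [IsLocalRing O]
  {B : Type v} [Ring B] [Algebra (ResidueField O) B]

/-- The reduction homomorphism of a lift. -/
def OrderLift.toRingHom (L : OrderLift.{u, v, w} O B) : L.carrier →+* B :=
  (L.reduction : (ResidueField O ⊗[O] L.carrier) →+* B).comp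
    (Algebra.TensorProduct.includeRight : L.carrier →ₐ[O] ResidueField O ⊗[O] L.carrier).toRingHom

theorem OrderLift.toRingHom_apply (L : OrderLift.{u, v, w} O B) (x : L.carrier) :
    L.toRingHom x = L.reduction (1 ⊗ₜ x) := rfl

theorem OrderLift.toRingHom_smul (L : OrderLift.{u, v, w} O B) (r : O) (x : L.carrier) :
    L.toRingHom (r • x) = IsLocalRing.residue O r • L.toRingHom x := by
  rw [toRingHom_apply, toRingHom_apply, ← map_smul, TensorProduct.smul_tmul', ← TensorProduct.smul_tmul]
  congr 2

theorem OrderLift.toRingHom_surjective (L : OrderLift.{u, v, w} O B) :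
    Function.Surjective L.toRingHom := by
  intro y
  obtain ⟨t, rfl⟩ := L.reduction.surjective y
  induction t with
  | zero => exact ⟨0, by simp⟩
  | add a b ha hb =>
    obtain ⟨a', ha⟩ := ha
    obtain ⟨b', hb⟩ := hb
    exact ⟨a' + b', by rw [map_add, map_add, ha, hb]⟩
  | tmul r x =>
    obtain ⟨r, rfl⟩ := IsLocalRing.residue_surjective r
    refine ⟨r • x, ?_⟩
    rw [toRingHom_smul, toRingHom_apply, ← map_smul, TensorProduct.smul_tmul']
    simp

theorem OrderLift.exists_smul_of_toRingHom_eq_zero (L : OrderLift.{u, v, w} O B) {a : O}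
    (ha : maximalIdeal O = Ideal.span {a}) {x : L.carrier} (hx : L.toRingHom x = 0) :
    ∃ y, x = a • y := by
  have h1 : (1 : ResidueField O) ⊗ₜ[O] x = 0 := by
    apply L.reduction.injective
    rw [map_zero]; exact hx
  have h2 : Submodule.Quotient.mk (p := maximalIdeal O • (⊤ : Submodule O L.carrier)) x = 0 := by
    have h3 := (congrArg (TensorProduct.quotTensorEquivQuotSMul L.carrier (maximalIdeal O)) h1).trans
      (LinearEquiv.map_zero _)
    have h4 := TensorProduct.quotTensorEquivQuotSMul_mk_tmul (M := L.carrier)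
      (I := maximalIdeal O) 1 x
    rw [one_smul] at h4
    exact h4.symm.trans h3
  rw [Submodule.Quotient.mk_eq_zero, ha, Submodule.ideal_span_singleton_smul] at h2
  obtain ⟨y, -, hy⟩ := h2
  exact ⟨y, hy.symm⟩

theorem OrderLift.toRingHom_eq_zero_of_smul (L : OrderLift.{u, v, w} O B) {a : O}
    (ha : maximalIdeal O = Ideal.span {a}) (y : L.carrier) : L.toRingHom (a • y) = 0 := by
  have : IsLocalRing.residue O a = 0 := by
    rw [IsLocalRing.residue_eq_zero_iff, ha]
    exact Ideal.mem_span_singleton_self a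
  rw [L.toRingHom_smul, this, zero_smul]

end Reduction

end

section

/-! ### The structure of `𝒟(2B)^{κ,c}` -/

namespace DTwoB

variable {k : Type u} [Field k] (κ : ℕ) (c : k)

/-- The trivial path at a vertex. -/
def vertex (i : Fin 2) : DTwoB k κ c := RingQuot.mkAlgHom k _ (dTwoBVertex k i)

/-- The class of an arrow. -/
def arrow (a : DTwoBArrow) : DTwoB k κ c := RingQuot.mkAlgHom k _ (dTwoBArrow k a)

theorem vertex_mul_vertex (i j : Fin 2) :
    vertex κ c i * vertex κ c j = if i = j then vertex κ c i else 0 := by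
  have := RingQuot.mkAlgHom_rel k (DTwoBRel.vertex_mul (κ := κ) (c := c) i j)
  rw [map_mul] at this
  refine this.trans ?_
  split_ifs
  · rfl
  · exact map_zero _

theorem vertex_add_vertex : vertex κ c 0 + vertex κ c 1 = 1 := by
  have := RingQuot.mkAlgHom_rel k (DTwoBRel.vertex_sum (κ := κ) (c := c))
  rwa [map_add, map_one] at this

theorem vertex_source_mul (a : DTwoBArrow) : vertex κ c a.source * arrow κ c a = arrow κ c a := by
  have := RingQuot.mkAlgHom_rel k (DTwoBRel.source_mul (κ := κ) (c := c) a)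
  rwa [map_mul] at this

theorem arrow_mul_vertex_target (a : DTwoBArrow) :
    arrow κ c a * vertex κ c a.target = arrow κ c a := by
  have := RingQuot.mkAlgHom_rel k (DTwoBRel.mul_target (κ := κ) (c := c) a)
  rwa [map_mul] at this

theorem β_mul_η : arrow κ c .β * arrow κ c .η = 0 := by
  have := RingQuot.mkAlgHom_rel k (DTwoBRel.β_η (κ := κ) (c := c))
  rwa [map_mul, map_zero] at this

theorem η_mul_γ : arrow κ c .η * arrow κ c .γ = 0 := by
  have := RingQuot.mkAlgHom_rel k (DTwoBRel.η_γ (κ := κ) (c := c))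
  rwa [map_mul, map_zero] at this

theorem γ_mul_β : arrow κ c .γ * arrow κ c .β = 0 := by
  have := RingQuot.mkAlgHom_rel k (DTwoBRel.γ_β (κ := κ) (c := c))
  rwa [map_mul, map_zero] at this

theorem α_mul_α : arrow κ c .α * arrow κ c .α =
    c • (arrow κ c .α * arrow κ c .β * arrow κ c .γ) := by
  have := RingQuot.mkAlgHom_rel k (DTwoBRel.α_sq (κ := κ) (c := c))
  rwa [pow_two, map_mul, map_smul, map_mul, map_mul] at this

theorem αβγ_eq : arrow κ c .α * arrow κ c .β * arrow κ c .γ =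
    arrow κ c .β * arrow κ c .γ * arrow κ c .α := by
  have := RingQuot.mkAlgHom_rel k (DTwoBRel.αβγ (κ := κ) (c := c))
  rwa [map_mul, map_mul, map_mul, map_mul] at this

theorem γαβ_eq : arrow κ c .γ * arrow κ c .α * arrow κ c .β = arrow κ c .η ^ κ := by
  have := RingQuot.mkAlgHom_rel k (DTwoBRel.γαβ (κ := κ) (c := c))
  rwa [map_mul, map_mul, map_pow] at this

theorem arrow_mul_vertex (a : DTwoBArrow) (i : Fin 2) :
    arrow κ c a * vertex κ c i = if a.target = i then arrow κ c a else 0 := by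
  rw [← arrow_mul_vertex_target, mul_assoc, vertex_mul_vertex]
  split_ifs
  · rfl
  · exact mul_zero _

theorem vertex_mul_arrow (a : DTwoBArrow) (i : Fin 2) :
    vertex κ c i * arrow κ c a = if a.source = i then arrow κ c a else 0 := by
  rw [← vertex_source_mul, ← mul_assoc, vertex_mul_vertex]
  by_cases h : i = a.source
  · rw [if_pos h, if_pos h.symm, h]
  · rw [if_neg h, if_neg (Ne.symm h), zero_mul]

theorem arrow_mul_arrow_eq_zero {a b : DTwoBArrow} (h : a.target ≠ b.source) :
    arrow κ c a * arrow κ c b = 0 := by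
  rw [← vertex_source_mul κ c b, ← mul_assoc, arrow_mul_vertex, if_neg h, zero_mul]

/-- γα² = c·γαβγ = c·η^κγ, and ηγ = 0. -/
theorem γαα_eq_zero (hκ : κ ≠ 0) :
    arrow κ c .γ * arrow κ c .α * arrow κ c .α = 0 := by
  rw [mul_assoc, α_mul_α, mul_smul_comm, ← mul_assoc, ← mul_assoc, γαβ_eq,
    ← Nat.succ_pred_eq_of_ne_zero hκ, pow_succ, mul_assoc, η_mul_γ, mul_zero, smul_zero]

/-- α³ = c·αβγα = c·α²βγ = c²·αβγβγ, and γβ = 0. Nilpotency of α is what makes all its coordinates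
even later on. -/
theorem α_pow_eq_zero : arrow κ c .α ^ 3 = 0 := by
  have h : arrow κ c .α * arrow κ c .β * arrow κ c .γ * arrow κ c .α =
      arrow κ c .α * arrow κ c .α * (arrow κ c .β * arrow κ c .γ) := by
    have h' : arrow κ c .α * arrow κ c .β * arrow κ c .γ * arrow κ c .α =
        arrow κ c .α * (arrow κ c .β * arrow κ c .γ * arrow κ c .α) := by simp only [mul_assoc]
    rw [h', ← αβγ_eq]
    simp only [mul_assoc]
  rw [pow_succ, pow_two, α_mul_α, smul_mul_assoc, h, α_mul_α, smul_mul_assoc,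
    mul_assoc _ (arrow κ c .γ), ← mul_assoc (arrow κ c .γ), γ_mul_β, zero_mul, mul_zero, smul_zero,
    smul_zero]

theorem η_pow_succ_eq_zero : arrow κ c .η ^ (κ + 1) = 0 := by
  rw [pow_succ, ← γαβ_eq, mul_assoc, β_mul_η, mul_zero]

/-- The nontrivial paths that, with the vertices, span the algebra. -/
def spanningPaths : Set (DTwoB k κ c) :=
  {arrow κ c .α, arrow κ c .β * arrow κ c .γ, arrow κ c .α * arrow κ c .β * arrow κ c .γ,
    arrow κ c .β, arrow κ c .α * arrow κ c .β, arrow κ c .γ, arrow κ c .γ * arrow κ c .α} ∪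
  Set.range fun i : Fin κ => arrow κ c .η ^ ((i : ℕ) + 1)

/-- A spanning set consisting of paths. -/
def spanningSet : Set (DTwoB k κ c) := {vertex κ c 0, vertex κ c 1} ∪ spanningPaths κ c

theorem span_induction_mul_right (W : Submodule k (DTwoB k κ c)) (h1 : 1 ∈ W)
    (hv : ∀ w ∈ W, ∀ i, w * vertex κ c i ∈ W) (ha : ∀ w ∈ W, ∀ a, w * arrow κ c a ∈ W) :
    W = ⊤ := by
  rw [eq_top_iff]
  have key : ∀ x : FreeAlgebra k (Fin 2 ⊕ DTwoBArrow), ∀ w ∈ W,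
      w * RingQuot.mkAlgHom k (DTwoBRel k κ c) x ∈ W := by
    intro x
    induction x with
    | grade0 r =>
      intro w hw
      rw [AlgHom.commutes, ← Algebra.commutes, ← Algebra.smul_def]
      exact W.smul_mem _ hw
    | grade1 x =>
      intro w hw
      rcases x with i | a
      · exact hv w hw i
      · exact ha w hw a
    | mul a b iha ihb =>
      intro w hw
      rw [map_mul, ← mul_assoc]
      exact ihb _ (iha _ hw)
    | add a b iha ihb =>
      intro w hw
      rw [map_add, mul_add]
      exact W.add_mem (iha _ hw) (ihb _ hw)
  intro y _
  obtain ⟨x, rfl⟩ := RingQuot.mkAlgHom_surjective k (DTwoBRel k κ c) y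
  simpa using key x 1 h1

/-- Right multiplication by each generator keeps the listed paths in their span. Linear independence
is never needed: lower bounds for ranks come from the rational algebra instead. -/
theorem span_spanningSet (hκ : κ ≠ 0) : Submodule.span k (spanningSet κ c) = ⊤ := by
  have mul_mem : ∀ y : DTwoB k κ c, (∀ s ∈ spanningSet κ c,
      s * y ∈ Submodule.span k (spanningSet κ c)) → ∀ w ∈ Submodule.span k (spanningSet κ c),
      w * y ∈ Submodule.span k (spanningSet κ c) := by
    intro y hy w hw
    induction hw using Submodule.span_induction with
    | mem x hx => exact hy x hx
    | zero => rw [zero_mul]; exact Submodule.zero_mem _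
    | add a b _ _ ha hb => rw [add_mul]; exact Submodule.add_mem _ ha hb
    | smul r a _ ha => rw [smul_mul_assoc]; exact Submodule.smul_mem _ _ ha
  have sub : ∀ s ∈ spanningSet κ c, s ∈ Submodule.span k (spanningSet κ c) :=
    fun s hs => Submodule.subset_span hs
  have zero : (0 : DTwoB k κ c) ∈ Submodule.span k (spanningSet κ c) := Submodule.zero_mem _
  have hvert : ∀ i, vertex κ c i ∈ spanningSet κ c := by
    intro i; left; fin_cases i <;> simp
  have hη : ∀ i : Fin κ, arrow κ c .η ^ ((i : ℕ) + 1) ∈ spanningSet κ c :=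
    fun i => Or.inr (Or.inr ⟨i, rfl⟩)
  have hη1 : arrow κ c .η ∈ spanningSet κ c := by simpa using hη ⟨0, Nat.pos_of_ne_zero hκ⟩
  have ite_mem : ∀ {p : Prop} [Decidable p] {s}, s ∈ spanningSet κ c →
      (if p then s else 0) ∈ Submodule.span k (spanningSet κ c) := by
    intro p _ s hs
    split_ifs
    exacts [sub _ hs, zero]
  have hα : arrow κ c .α ∈ spanningSet κ c := by simp [spanningSet, spanningPaths]
  have hβ : arrow κ c .β ∈ spanningSet κ c := by simp [spanningSet, spanningPaths]
  have hγ : arrow κ c .γ ∈ spanningSet κ c := by simp [spanningSet, spanningPaths]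
  have hβγ : arrow κ c .β * arrow κ c .γ ∈ spanningSet κ c := by simp [spanningSet, spanningPaths]
  have hαβ : arrow κ c .α * arrow κ c .β ∈ spanningSet κ c := by simp [spanningSet, spanningPaths]
  have hγα : arrow κ c .γ * arrow κ c .α ∈ spanningSet κ c := by simp [spanningSet, spanningPaths]
  have hαβγ : arrow κ c .α * arrow κ c .β * arrow κ c .γ ∈ spanningSet κ c := by
    simp [spanningSet, spanningPaths]
  have harrow : ∀ a, arrow κ c a ∈ spanningSet κ c := by
    intro a; cases a <;> assumption
  have hβα : arrow κ c .β * arrow κ c .α = 0 := arrow_mul_arrow_eq_zero κ c (by decide)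
  have hββ : arrow κ c .β * arrow κ c .β = 0 := arrow_mul_arrow_eq_zero κ c (by decide)
  have hγγ : arrow κ c .γ * arrow κ c .γ = 0 := arrow_mul_arrow_eq_zero κ c (by decide)
  have hγη : arrow κ c .γ * arrow κ c .η = 0 := arrow_mul_arrow_eq_zero κ c (by decide)
  have hαγ : arrow κ c .α * arrow κ c .γ = 0 := arrow_mul_arrow_eq_zero κ c (by decide)
  have hαη : arrow κ c .α * arrow κ c .η = 0 := arrow_mul_arrow_eq_zero κ c (by decide)
  have hηα : arrow κ c .η * arrow κ c .α = 0 := arrow_mul_arrow_eq_zero κ c (by decide)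
  have hηβ : arrow κ c .η * arrow κ c .β = 0 := arrow_mul_arrow_eq_zero κ c (by decide)
  have hββ' : ∀ x, x * arrow κ c .γ * arrow κ c .β = 0 := fun x => by
    rw [mul_assoc, γ_mul_β, mul_zero]
  have hκη : arrow κ c .η ^ κ ∈ spanningSet κ c := by
    have := hη ⟨κ - 1, by omega⟩
    rwa [Nat.sub_add_cancel (by omega)] at this
  apply span_induction_mul_right
  · rw [← vertex_add_vertex κ c]
    exact Submodule.add_mem _ (sub _ (hvert 0)) (sub _ (hvert 1))
  · intro w hw i
    refine mul_mem _ ?_ w hw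
    rintro s ((rfl | rfl) | ((rfl | rfl | rfl | rfl | rfl | rfl | rfl) | ⟨m, rfl⟩))
    · rw [vertex_mul_vertex]; exact ite_mem (hvert _)
    · rw [vertex_mul_vertex]; exact ite_mem (hvert _)
    all_goals
      simp only [pow_succ, mul_assoc, arrow_mul_vertex, mul_ite, mul_zero]
      apply ite_mem
    exacts [hα, hβγ, by simpa [mul_assoc] using hαβγ, hβ, hαβ, hγ, hγα,
      by simpa [pow_succ] using hη m]
  · intro w hw a
    refine mul_mem _ ?_ w hw
    rintro s ((rfl | rfl) | ((rfl | rfl | rfl | rfl | rfl | rfl | rfl) | ⟨m, rfl⟩))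
    · rw [vertex_mul_arrow]; exact ite_mem (harrow _)
    · rw [vertex_mul_arrow]; exact ite_mem (harrow _)
    · cases a
      · rw [α_mul_α]; exact Submodule.smul_mem _ _ (sub _ hαβγ)
      · exact sub _ hαβ
      · rw [hαγ]; exact zero
      · rw [hαη]; exact zero
    · cases a
      · rw [← αβγ_eq]; exact sub _ hαβγ
      · rw [hββ']; exact zero
      · rw [mul_assoc, hγγ, mul_zero]; exact zero
      · rw [mul_assoc, hγη, mul_zero]; exact zero
    · cases a
      · rw [αβγ_eq, mul_assoc, α_mul_α, mul_smul_comm, αβγ_eq, ← mul_assoc, ← mul_assoc, hββ',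
          zero_mul, zero_mul, smul_zero]
        exact zero
      · rw [hββ']; exact zero
      · rw [mul_assoc, hγγ, mul_zero]; exact zero
      · rw [mul_assoc, hγη, mul_zero]; exact zero
    · cases a
      · rw [hβα]; exact zero
      · rw [hββ]; exact zero
      · exact sub _ hβγ
      · rw [β_mul_η]; exact zero
    · cases a
      · rw [mul_assoc, hβα, mul_zero]; exact zero
      · rw [mul_assoc, hββ, mul_zero]; exact zero
      · exact sub _ hαβγ
      · rw [mul_assoc, β_mul_η, mul_zero]; exact zero
    · cases a
      · exact sub _ hγα
      · rw [γ_mul_β]; exact zero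
      · rw [hγγ]; exact zero
      · rw [hγη]; exact zero
    · cases a
      · rw [γαα_eq_zero κ c hκ]; exact zero
      · rw [γαβ_eq]; exact sub _ hκη
      · rw [mul_assoc, hαγ, mul_zero]; exact zero
      · rw [mul_assoc, hαη, mul_zero]; exact zero
    · cases a
      · simp only [pow_succ]; rw [mul_assoc, hηα, mul_zero]; exact zero
      · simp only [pow_succ]; rw [mul_assoc, hηβ, mul_zero]; exact zero
      · simp only [pow_succ]; rw [mul_assoc, η_mul_γ, mul_zero]; exact zero
      · simp only [← pow_succ]
        by_cases hm : (m : ℕ) + 1 < κ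
        · exact sub _ (hη ⟨m + 1, hm⟩)
        · rw [show (m : ℕ) + 1 = κ by omega, η_pow_succ_eq_zero]; exact zero

/-- The character of the algebra belonging to a vertex. -/
def character (hκ : κ ≠ 0) (i : Fin 2) : DTwoB k κ c →ₐ[k] k :=
  RingQuot.liftAlgHom k ⟨FreeAlgebra.lift k (Sum.elim (fun j => if j = i then 1 else 0) fun _ => 0),
    by
      intro x y h
      induction h with
      | vertex_mul a b => fin_cases a <;> fin_cases b <;> fin_cases i <;> simp [dTwoBVertex]
      | vertex_sum => fin_cases i <;> simp [dTwoBVertex]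
      -- For γαβ = η^κ the right side must vanish as well, which is where κ ≠ 0 enters.
      | _ => simp [dTwoBVertex, dTwoBArrow, hκ]⟩

theorem character_vertex (hκ : κ ≠ 0) (i j : Fin 2) :
    character κ c hκ i (vertex κ c j) = if j = i then 1 else 0 := by
  simp [character, vertex, dTwoBVertex]

theorem character_arrow (hκ : κ ≠ 0) (i : Fin 2) (a : DTwoBArrow) :
    character κ c hκ i (arrow κ c a) = 0 := by
  simp [character, arrow, dTwoBArrow]

end DTwoB

end

section

/-! ### Generators of a lift -/

section Nakayama

variable {O : Type u} [CommRing O] [IsLocalRing O]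
  {B : Type v} [Ring B] [Algebra (ResidueField O) B]

theorem OrderLift.toRingHom_algebraMap (L : OrderLift.{u, v, w} O B) (r : O) :
    L.toRingHom (algebraMap O _ r) = algebraMap _ B (IsLocalRing.residue O r) := by
  rw [Algebra.algebraMap_eq_smul_one, L.toRingHom_smul, map_one, Algebra.algebraMap_eq_smul_one]

theorem OrderLift.toRingHom_aeval (L : OrderLift.{u, v, w} O B) (P : Polynomial O)
    (x : L.carrier) : L.toRingHom (Polynomial.aeval x P) =
      Polynomial.aeval (L.toRingHom x) (P.map (IsLocalRing.residue O)) := by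
  refine Polynomial.map_aeval_eq_aeval_map (φ := IsLocalRing.residue O) ?_ P x
  ext r
  exact (L.toRingHom_algebraMap r).symm

/-- Nakayama's lemma: lifts of a spanning set over the residue field span the order. -/
theorem OrderLift.span_eq_top (L : OrderLift.{u, v, w} O B) {a : O}
    (ha : maximalIdeal O = Ideal.span {a}) (S : Set L.carrier)
    (hS : Submodule.span (ResidueField O) (L.toRingHom '' S) = ⊤) : Submodule.span O S = ⊤ := by
  have key : ∀ y ∈ Submodule.span (ResidueField O) (L.toRingHom '' S),
      ∃ x ∈ Submodule.span O S, L.toRingHom x = y := by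
    intro y hy
    induction hy using Submodule.span_induction with
    | mem y hy =>
      obtain ⟨x, hx, rfl⟩ := hy
      exact ⟨x, Submodule.subset_span hx, rfl⟩
    | zero => exact ⟨0, Submodule.zero_mem _, map_zero _⟩
    | add y z _ _ hy hz =>
      obtain ⟨x, hx, rfl⟩ := hy
      obtain ⟨t, ht, rfl⟩ := hz
      exact ⟨x + t, Submodule.add_mem _ hx ht, map_add _ _ _⟩
    | smul r y _ hy =>
      obtain ⟨x, hx, rfl⟩ := hy
      obtain ⟨r, rfl⟩ := IsLocalRing.residue_surjective r
      exact ⟨r • x, Submodule.smul_mem _ _ hx, L.toRingHom_smul _ _⟩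
  rw [eq_top_iff]
  refine Submodule.le_of_le_smul_of_le_jacobson_bot (I := maximalIdeal O) Module.Finite.fg_top
    (IsLocalRing.maximalIdeal_le_jacobson _) ?_
  intro x _
  obtain ⟨y, hy, hxy⟩ := key (L.toRingHom x) (by rw [hS]; trivial)
  obtain ⟨z, hz⟩ := L.exists_smul_of_toRingHom_eq_zero ha (x := x - y) (by rw [map_sub, hxy, sub_self])
  rw [Submodule.mem_sup]
  refine ⟨y, hy, a • z, ?_, by rw [← hz]; abel⟩
  exact Submodule.smul_mem_smul (by rw [ha]; exact Ideal.mem_span_singleton_self a) trivial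

end Nakayama

/-- Elements of an algebra that behave like lifts of the vertices and arrows of the quiver with
relations of `𝒟(2B)^{κ,c}` from the residue ring `O / 2 O` to `O`. -/
structure LiftedQuiver (O : Type u) [CommRing O] (κ : ℕ) (c : O) (Γ : Type w) [Ring Γ]
    [Algebra O Γ] where
  (f₀ f₁ α β γ η : Γ)
  f₀_mul_self : f₀ * f₀ = f₀
  f₀_add_f₁ : f₀ + f₁ = 1
  f₀_mul_α : f₀ * α = α
  α_mul_f₀ : α * f₀ = α
  f₀_mul_β : f₀ * β = β
  β_mul_f₁ : β * f₁ = β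
  f₁_mul_γ : f₁ * γ = γ
  γ_mul_f₀ : γ * f₀ = γ
  f₁_mul_η : f₁ * η = η
  η_mul_f₁ : η * f₁ = η
  corner₀₀ : ∀ x, ∃ r₀ r₁ r₂ r₃ : O,
    f₀ * x * f₀ = r₀ • f₀ + r₁ • α + r₂ • (β * γ) + r₃ • (α * β * γ)
  corner₀₁ : ∀ x, ∃ r₀ r₁ : O, f₀ * x * f₁ = r₀ • β + r₁ • (α * β)
  corner₁₀ : ∀ x, ∃ r₀ r₁ : O, f₁ * x * f₀ = r₀ • γ + r₁ • (γ * α)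
  corner₁₁ : ∀ x, ∃ P : Polynomial O, P.natDegree ≤ κ ∧ f₁ * x * f₁ = Polynomial.aeval η P * f₁
  β_mul_η : ∃ y, β * η = (2 : O) • y
  α_mul_α : ∃ y, α * α - c • (α * β * γ) = (2 : O) • y
  α_pow : ∃ y, α ^ 3 = (2 : O) • y
  η_pow : ∃ y, η ^ (κ + 1) = (2 : O) • y
  eq_zero_or_eq_f₀ : ∀ p, p * p = p → f₀ * p = p → p * f₀ = p → p = 0 ∨ p = f₀
  eq_zero_or_eq_f₁ : ∀ p, p * p = p → f₁ * p = p → p * f₁ = p → p = 0 ∨ p = f₁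
  f₀_ne_zero : f₀ ≠ 0
  f₁_ne_zero : f₁ ≠ 0
  mul_f₁_mul_ne_f₀ : ∀ x y, f₀ * x * f₁ * y * f₀ ≠ f₀

section Lift

open DTwoB

variable {O : Type u} [CommRing O] [IsLocalRing O]

theorem exists_mul_mul_eq {A : Type*} {B : Type*} [Ring A] [Ring B] {φ : A →+* B}
    (hφ : Function.Surjective φ) {e f : A} (he : e * e = e) (hf : f * f = f) {y : B}
    (h : φ e * y = y) (h' : y * φ f = y) : ∃ x, φ x = y ∧ e * x = x ∧ x * f = x := by
  obtain ⟨x, rfl⟩ := hφ y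
  refine ⟨e * x * f, by rw [map_mul, map_mul, h, h'], ?_, ?_⟩
  · rw [← mul_assoc, ← mul_assoc, he]
  · rw [mul_assoc, hf]

theorem mul_mul_mem_of_span_eq_top {O : Type*} [CommRing O] {Γ : Type*} [Ring Γ] [Algebra O Γ] {S : Set Γ}
    (hS : Submodule.span O S = ⊤) (e f : Γ) (W : Submodule O Γ) (h : ∀ s ∈ S, e * s * f ∈ W)
    (x : Γ) : e * x * f ∈ W := by
  have hx : x ∈ Submodule.span O S := by rw [hS]; trivial
  induction hx using Submodule.span_induction with
  | mem x hx => exact h x hx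
  | zero => simp
  | add y z _ _ hy hz => rw [mul_add, add_mul]; exact W.add_mem hy hz
  | smul r y _ hy => rw [mul_smul_comm, smul_mul_assoc]; exact W.smul_mem r hy

/-- The square of such a combination is a multiple of αβγ, and (αβγ)² = 0; so an idempotent of this
shape is zero. -/
theorem DTwoB.eq_zero_of_corner₀ {k : Type u} [Field k] (κ : ℕ) (c : k) (y : DTwoB k κ c)
    (hy : y * y = y) (r s t : k) (h : y = r • arrow κ c .α + s • (arrow κ c .β * arrow κ c .γ) +
      t • (arrow κ c .α * arrow κ c .β * arrow κ c .γ)) : y = 0 := by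
  set a := arrow κ c .α with ha
  set b := arrow κ c .β * arrow κ c .γ with hb
  have hbb : b * b = 0 := by
    rw [hb, mul_assoc, ← mul_assoc (arrow κ c .γ), γ_mul_β, zero_mul, mul_zero]
  have haa : a * a = c • (a * b) := by rw [ha, α_mul_α, hb, mul_assoc]
  have hba : b * a = a * b := by rw [hb, ha, ← αβγ_eq, mul_assoc]
  have haba : a * b * a = 0 := by
    rw [mul_assoc, hba, ← mul_assoc, haa, smul_mul_assoc, mul_assoc, hbb, mul_zero, smul_zero]
  have haab : a * (a * b) = 0 := by
    rw [← mul_assoc, haa, smul_mul_assoc, mul_assoc, hbb, mul_zero, smul_zero]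
  have habb : a * b * b = 0 := by rw [mul_assoc, hbb, mul_zero]
  have hbab : b * (a * b) = 0 := by rw [← mul_assoc, hba, habb]
  have habab : a * b * (a * b) = 0 := by rw [← mul_assoc, haba, zero_mul]
  rw [mul_assoc, ← hb] at h
  have h2 : y = (r * r * c + r * s + s * r) • (a * b) := by
    rw [← hy, h]
    simp only [add_mul, mul_add, smul_mul_assoc, mul_smul_comm, haa, hba, hbb, haba, haab, habb,
      hbab, habab, smul_zero, add_zero, smul_smul, add_smul, smul_add]
    module
  rw [← hy, h2, smul_mul_assoc, mul_smul_comm, habab, smul_zero, smul_zero]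

/-- An idempotent in 2Γ equals all its powers, hence lies in every 2ⁿΓ. -/
theorem OrderLift.eq_zero_of_isIdempotentElem [Fact (maximalIdeal O = Ideal.span {(2 : O)})]
    [IsAdicComplete (maximalIdeal O) O] {B : Type v} [Ring B] [Algebra (ResidueField O) B]
    (L : OrderLift.{u, v, w} O B) {p : L.carrier} (hp : p * p = p) (h : L.toRingHom p = 0) :
    p = 0 := by
  have hO : maximalIdeal O = Ideal.span {(2 : O)} := Fact.out
  have : IsAdicComplete (Ideal.span {(2 : O)}) O := hO ▸ inferInstance
  obtain ⟨y, hy⟩ := L.exists_smul_of_toRingHom_eq_zero hO h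
  refine eq_zero_of_forall_pow_smul (a := (2 : O)) p fun n => ⟨y ^ n * p, ?_⟩
  have h1 : ∀ n : ℕ, p = p ^ n * p := by
    intro n
    induction n with
    | zero => simp
    | succ n ih => rw [pow_succ, mul_assoc, hp, ← ih]
  conv_lhs => rw [h1 n, hy, smul_pow, smul_mul_assoc, ← hy]

/-- The vertex idempotent lifts by completeness and each arrow lifts inside its own Peirce corner.
By Nakayama the lifted paths span Γ, and sorting them by corners gives the corner descriptions. The
relations survive only modulo 2. Primitivity of the lifted vertices is checked on the residue
algebra with the help of the characters. -/
theorem OrderLift.nonempty_liftedQuiver [Fact (maximalIdeal O = Ideal.span {(2 : O)})]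
    [IsAdicComplete (maximalIdeal O) O] {κ : ℕ} (hκ : κ ≠ 0) {c : O}
    {c' : ResidueField O} (hc : IsLocalRing.residue O c = c')
    (L : OrderLift.{u, u, w} O (DTwoB (ResidueField O) κ c')) :
    Nonempty (LiftedQuiver O κ c L.carrier) := by
  have hO : maximalIdeal O = Ideal.span {(2 : O)} := Fact.out
  have : IsAdicComplete (Ideal.span {(2 : O)}) O := hO ▸ inferInstance
  set ρ := L.toRingHom with hρ
  have hsurj : Function.Surjective ρ := L.toRingHom_surjective
  have hker : ∀ {x}, ρ x = 0 → ∃ y, x = (2 : O) • y :=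
    fun h => L.exists_smul_of_toRingHom_eq_zero hO h
  obtain ⟨x, hx⟩ := hsurj (vertex κ c' 0)
  obtain ⟨f₀, hf₀, y, hy⟩ := exists_isIdempotentElem_sub_eq_smul (a := (2 : O)) x (hker (by
    rw [map_sub, map_mul, hx, vertex_mul_vertex, if_pos rfl, sub_self]))
  have hρf₀ : ρ f₀ = vertex κ c' 0 := by
    have := congrArg ρ hy
    rw [L.toRingHom_eq_zero_of_smul hO, map_sub, hx, sub_eq_zero] at this
    exact this
  obtain ⟨f₁, hf₁_def⟩ : ∃ f₁, f₁ = 1 - f₀ := ⟨_, rfl⟩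
  have hf₁ : f₁ * f₁ = f₁ := hf₁_def ▸ hf₀.one_sub
  have hf₀₁ : f₀ * f₁ = 0 := hf₁_def ▸ hf₀.mul_one_sub_self
  have hf₁₀ : f₁ * f₀ = 0 := hf₁_def ▸ hf₀.one_sub_mul_self
  have hρf₁ : ρ f₁ = vertex κ c' 1 := by
    rw [hf₁_def, map_sub, map_one, hρf₀, ← vertex_add_vertex κ c', add_sub_cancel_left]
  obtain ⟨α, hα, hα0, hα1⟩ := exists_mul_mul_eq hsurj hf₀ hf₀ (y := arrow κ c' .α)
    (by rw [hρf₀]; exact vertex_source_mul κ c' .α) (by rw [hρf₀]; exact arrow_mul_vertex_target κ c' .α)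
  obtain ⟨β, hβ, hβ0, hβ1⟩ := exists_mul_mul_eq hsurj hf₀ hf₁ (y := arrow κ c' .β)
    (by rw [hρf₀]; exact vertex_source_mul κ c' .β) (by rw [hρf₁]; exact arrow_mul_vertex_target κ c' .β)
  obtain ⟨γ, hγ, hγ0, hγ1⟩ := exists_mul_mul_eq hsurj hf₁ hf₀ (y := arrow κ c' .γ)
    (by rw [hρf₁]; exact vertex_source_mul κ c' .γ) (by rw [hρf₀]; exact arrow_mul_vertex_target κ c' .γ)
  obtain ⟨η, hη, hη0, hη1⟩ := exists_mul_mul_eq hsurj hf₁ hf₁ (y := arrow κ c' .η)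
    (by rw [hρf₁]; exact vertex_source_mul κ c' .η) (by rw [hρf₁]; exact arrow_mul_vertex_target κ c' .η)
  let S : Set L.carrier := {f₀, f₁} ∪ ({α, β * γ, α * β * γ, β, α * β, γ, γ * α} ∪
    Set.range fun i : Fin κ => η ^ ((i : ℕ) + 1))
  have hS : Submodule.span O S = ⊤ := by
    apply L.span_eq_top hO
    rw [← span_spanningSet κ c' hκ]
    congr 1
    simp only [S, spanningSet, spanningPaths, Set.image_union, Set.image_insert_eq,
      Set.image_singleton, ← Set.range_comp, Function.comp_def, ← hρ, map_mul, map_pow, hα, hβ, hγ,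
      hη, hρf₀, hρf₁]
  have h01 : ∀ x, f₁ * x = x → f₀ * x = 0 := fun x hx => by rw [← hx, ← mul_assoc, hf₀₁, zero_mul]
  have h10 : ∀ x, f₀ * x = x → f₁ * x = 0 := fun x hx => by rw [← hx, ← mul_assoc, hf₁₀, zero_mul]
  have h01' : ∀ x, x * f₀ = x → x * f₁ = 0 := fun x hx => by rw [← hx, mul_assoc, hf₀₁, mul_zero]
  have h10' : ∀ x, x * f₁ = x → x * f₀ = 0 := fun x hx => by rw [← hx, mul_assoc, hf₁₀, mul_zero]
  have hαf : α * f₁ = 0 := h01' _ hα1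
  have hβf : β * f₀ = 0 := h10' _ hβ1
  have hγf : γ * f₁ = 0 := h01' _ hγ1
  have hηf : η * f₀ = 0 := h10' _ hη1
  have hfα : f₁ * α = 0 := h10 _ hα0
  have hfβ : f₁ * β = 0 := h10 _ hβ0
  have hfγ : f₀ * γ = 0 := h01 _ hγ0
  have hfη : f₀ * η = 0 := h01 _ hη0
  have hηpow : ∀ i : ℕ, η ^ (i + 1) * f₀ = 0 := fun i => by rw [pow_succ, mul_assoc, hηf, mul_zero]
  have hηpow' : ∀ i : ℕ, f₀ * η ^ (i + 1) = 0 := fun i => by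
    rw [pow_succ', ← mul_assoc, hfη, zero_mul]
  have hηpow'' : ∀ i : ℕ, f₁ * η ^ (i + 1) = η ^ (i + 1) := fun i => by
    rw [pow_succ', ← mul_assoc, hη0]
  have c00 : ∀ x, f₀ * x * f₀ ∈ Submodule.span O {f₀, α, β * γ, α * β * γ} := by
    apply mul_mul_mem_of_span_eq_top hS
    rintro s ((rfl | rfl) | ((rfl | rfl | rfl | rfl | rfl | rfl | rfl) | ⟨m, rfl⟩))
    · rw [hf₀, hf₀]; exact Submodule.subset_span (by simp)
    · rw [hf₀₁, zero_mul]; exact Submodule.zero_mem _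
    · rw [hα0, hα1]; exact Submodule.subset_span (by simp)
    · rw [← mul_assoc, hβ0, mul_assoc β, hγ1]; exact Submodule.subset_span (by simp)
    · rw [← mul_assoc, ← mul_assoc, hα0, mul_assoc (α * β), hγ1]
      exact Submodule.subset_span (by simp)
    · rw [mul_assoc f₀ _ f₀, hβf, mul_zero]; exact Submodule.zero_mem _
    · rw [mul_assoc f₀ _ f₀, mul_assoc α β f₀, hβf, mul_zero, mul_zero]; exact Submodule.zero_mem _
    · rw [hfγ, zero_mul]; exact Submodule.zero_mem _
    · rw [← mul_assoc, hfγ, zero_mul, zero_mul]; exact Submodule.zero_mem _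
    · simp only [hηpow', zero_mul]; exact Submodule.zero_mem _
  have c01 : ∀ x, f₀ * x * f₁ ∈ Submodule.span O {β, α * β} := by
    apply mul_mul_mem_of_span_eq_top hS
    rintro s ((rfl | rfl) | ((rfl | rfl | rfl | rfl | rfl | rfl | rfl) | ⟨m, rfl⟩))
    · rw [hf₀, hf₀₁]; exact Submodule.zero_mem _
    · rw [hf₀₁, zero_mul]; exact Submodule.zero_mem _
    · rw [mul_assoc, hαf, mul_zero]; exact Submodule.zero_mem _
    · rw [mul_assoc, mul_assoc, hγf, mul_zero, mul_zero]; exact Submodule.zero_mem _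
    · rw [mul_assoc, mul_assoc, hγf, mul_zero, mul_zero]; exact Submodule.zero_mem _
    · rw [hβ0, hβ1]; exact Submodule.subset_span (by simp)
    · rw [← mul_assoc, hα0, mul_assoc, hβ1]; exact Submodule.subset_span (by simp)
    · rw [hfγ, zero_mul]; exact Submodule.zero_mem _
    · rw [← mul_assoc, hfγ, zero_mul, zero_mul]; exact Submodule.zero_mem _
    · simp only [hηpow', zero_mul]; exact Submodule.zero_mem _
  have c10 : ∀ x, f₁ * x * f₀ ∈ Submodule.span O {γ, γ * α} := by
    apply mul_mul_mem_of_span_eq_top hS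
    rintro s ((rfl | rfl) | ((rfl | rfl | rfl | rfl | rfl | rfl | rfl) | ⟨m, rfl⟩))
    · rw [hf₁₀, zero_mul]; exact Submodule.zero_mem _
    · rw [hf₁, hf₁₀]; exact Submodule.zero_mem _
    · rw [hfα, zero_mul]; exact Submodule.zero_mem _
    · rw [← mul_assoc, hfβ, zero_mul, zero_mul]; exact Submodule.zero_mem _
    · rw [← mul_assoc, ← mul_assoc, hfα, zero_mul, zero_mul, zero_mul]; exact Submodule.zero_mem _
    · rw [hfβ, zero_mul]; exact Submodule.zero_mem _
    · rw [← mul_assoc, hfα, zero_mul, zero_mul]; exact Submodule.zero_mem _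
    · rw [hγ0, hγ1]; exact Submodule.subset_span (by simp)
    · rw [← mul_assoc, hγ0, mul_assoc, hα1]; exact Submodule.subset_span (by simp)
    · rw [mul_assoc]; simp only [hηpow, mul_zero]; exact Submodule.zero_mem _
  have c11 : ∀ x, f₁ * x * f₁ ∈ (Polynomial.degreeLE O κ).map
      ((LinearMap.mulRight O f₁).comp (Polynomial.aeval η).toLinearMap) := by
    apply mul_mul_mem_of_span_eq_top hS
    rintro s ((rfl | rfl) | ((rfl | rfl | rfl | rfl | rfl | rfl | rfl) | ⟨m, rfl⟩))
    · rw [hf₁₀, zero_mul]; exact Submodule.zero_mem _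
    · rw [hf₁, hf₁]
      exact ⟨1, Polynomial.mem_degreeLE.2 (Polynomial.degree_one_le.trans (by simp)), by simp⟩
    · rw [hfα, zero_mul]; exact Submodule.zero_mem _
    · rw [← mul_assoc, hfβ, zero_mul, zero_mul]; exact Submodule.zero_mem _
    · rw [← mul_assoc, ← mul_assoc, hfα, zero_mul, zero_mul, zero_mul]; exact Submodule.zero_mem _
    · rw [hfβ, zero_mul]; exact Submodule.zero_mem _
    · rw [← mul_assoc, hfα, zero_mul, zero_mul]; exact Submodule.zero_mem _
    · rw [mul_assoc, hγf, mul_zero]; exact Submodule.zero_mem _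
    · rw [mul_assoc, mul_assoc, hαf, mul_zero, mul_zero]; exact Submodule.zero_mem _
    · simp only [hηpow'']
      refine ⟨Polynomial.X ^ ((m : ℕ) + 1), Polynomial.mem_degreeLE.2
        ((Polynomial.degree_X_pow_le _).trans ?_), by simp⟩
      exact_mod_cast m.2
  have corner00 : ∀ x, ∃ r₀ r₁ r₂ r₃ : O,
      f₀ * x * f₀ = r₀ • f₀ + r₁ • α + r₂ • (β * γ) + r₃ • (α * β * γ) := by
    intro x
    obtain ⟨r₀, z, hz, h⟩ := Submodule.mem_span_insert.1 (c00 x)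
    obtain ⟨r₁, z', hz', h'⟩ := Submodule.mem_span_insert.1 hz
    obtain ⟨r₂, r₃, h''⟩ := Submodule.mem_span_pair.1 hz'
    exact ⟨r₀, r₁, r₂, r₃, by rw [h, h', ← h'', add_assoc, add_assoc]⟩
  have corner11 : ∀ x, ∃ P : Polynomial O, P.natDegree ≤ κ ∧
      f₁ * x * f₁ = Polynomial.aeval η P * f₁ := by
    intro x
    obtain ⟨P, hP, h⟩ := c11 x
    exact ⟨P, Polynomial.natDegree_le_of_degree_le (Polynomial.mem_degreeLE.1 hP), h.symm⟩
  have hχ0 := character_vertex κ c' hκ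
  refine ⟨⟨f₀, f₁, α, β, γ, η, hf₀, by rw [hf₁_def]; abel, hα0, hα1, hβ0, hβ1, hγ0, hγ1, hη0, hη1,
    corner00, ?_, ?_, corner11, ?_, ?_, ?_, ?_, ?_, ?_, ?_, ?_, ?_⟩⟩
  · intro x
    obtain ⟨r, s, h⟩ := Submodule.mem_span_pair.1 (c01 x)
    exact ⟨r, s, h.symm⟩
  · intro x
    obtain ⟨r, s, h⟩ := Submodule.mem_span_pair.1 (c10 x)
    exact ⟨r, s, h.symm⟩
  · apply hker
    rw [map_mul, hβ, hη, DTwoB.β_mul_η]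
  · apply hker
    rw [map_sub, map_mul, hρ, L.toRingHom_smul, ← hρ, map_mul, map_mul, hα, hβ, hγ, hc,
      DTwoB.α_mul_α, sub_self]
  · apply hker
    rw [map_pow, hα, α_pow_eq_zero]
  · apply hker
    rw [map_pow, hη, η_pow_succ_eq_zero]
  -- The character takes the value 0 or 1 on p. Value 0 puts the reduction of p into the nilpotent
  -- part of the corner, so p = 0; value 1 is reduced to this case by passing to f₀ - p.
  · have key : ∀ p, p * p = p → f₀ * p = p → p * f₀ = p →
        character κ c' hκ 0 (ρ p) = 0 → p = 0 := by
      intro p hp h h' h0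
      apply L.eq_zero_of_isIdempotentElem hp
      obtain ⟨r₀, r₁, r₂, r₃, hr⟩ := corner00 p
      rw [h, h'] at hr
      have hρp : ρ p = IsLocalRing.residue O r₀ • vertex κ c' 0 + IsLocalRing.residue O r₁ • arrow κ c' .α +
          IsLocalRing.residue O r₂ • (arrow κ c' .β * arrow κ c' .γ) +
          IsLocalRing.residue O r₃ • (arrow κ c' .α * arrow κ c' .β * arrow κ c' .γ) := by
        rw [hr]
        simp only [map_add, hρ, L.toRingHom_smul]
        simp only [← hρ, map_mul, hα, hβ, hγ, hρf₀]
      have hr₀ : IsLocalRing.residue O r₀ = 0 := by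
        rw [hρp] at h0
        simpa only [map_add, map_smul, map_mul, character_vertex, character_arrow, if_true,
          smul_eq_mul, mul_zero, add_zero, mul_one] using h0
      rw [hr₀, zero_smul, zero_add] at hρp
      exact eq_zero_of_corner₀ κ c' _ (by rw [← hρ, ← map_mul, hp]) _ _ _ hρp
    intro p hp h h'
    have hi : IsIdempotentElem (character κ c' hκ 0 (ρ p)) := by
      rw [IsIdempotentElem, ← map_mul, ← map_mul, hp]
    rcases IsIdempotentElem.iff_eq_zero_or_one.1 hi with h0 | h1
    · exact Or.inl (key p hp h h' h0)
    · right
      have := key (f₀ - p) (by rw [mul_sub, sub_mul, sub_mul, hf₀, h, h', hp]; abel)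
        (by rw [mul_sub, hf₀, h]) (by rw [sub_mul, hf₀, h']) (by
          rw [map_sub, map_sub, h1, hρf₀, character_vertex, if_pos rfl, sub_self])
      exact (sub_eq_zero.1 this).symm
  · have key : ∀ p, p * p = p → f₁ * p = p → p * f₁ = p →
        character κ c' hκ 1 (ρ p) = 0 → p = 0 := by
      intro p hp h h' h0
      apply L.eq_zero_of_isIdempotentElem hp
      obtain ⟨P, -, hP⟩ := corner11 p
      rw [h, h'] at hP
      have hρp : ρ p = Polynomial.aeval (arrow κ c' .η) (P.map (IsLocalRing.residue O)) * vertex κ c' 1 := by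
        rw [hP, map_mul, hρ, L.toRingHom_aeval, ← hρ, hη, hρf₁]
      set Q := P.map (IsLocalRing.residue O)
      have hQ : Q.coeff 0 = 0 := by
        rw [hρp, map_mul, character_vertex, if_pos rfl, mul_one, ← Polynomial.aeval_algHom_apply,
          character_arrow, Polynomial.coe_aeval_eq_eval, ← Polynomial.coeff_zero_eq_eval_zero] at h0
        exact h0
      -- Vanishing of the character means that the polynomial in η has no constant term, so the
      -- reduction of p is η times something commuting with η, and its (κ+1)-st power is zero.
      obtain ⟨R, hR⟩ := Polynomial.X_dvd_iff.2 hQ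
      have hc : Commute (arrow κ c' .η) (Polynomial.aeval (arrow κ c' .η) R * vertex κ c' 1) := by
        apply Commute.mul_right
        · simpa using (Polynomial.commute_X R).map (Polynomial.aeval (arrow κ c' .η))
        · rw [Commute, SemiconjBy, vertex_mul_arrow, arrow_mul_vertex]
          rfl
      have hidem : IsIdempotentElem (ρ p) := by rw [IsIdempotentElem, ← map_mul, hp]
      rw [← hρ, ← hidem.pow_succ_eq κ]
      rw [hρp, hR, map_mul, Polynomial.aeval_X, mul_assoc, hc.mul_pow, η_pow_succ_eq_zero, zero_mul]
    intro p hp h h'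
    have hi : IsIdempotentElem (character κ c' hκ 1 (ρ p)) := by
      rw [IsIdempotentElem, ← map_mul, ← map_mul, hp]
    rcases IsIdempotentElem.iff_eq_zero_or_one.1 hi with h0 | h1
    · exact Or.inl (key p hp h h' h0)
    · right
      have := key (f₁ - p) (by rw [mul_sub, sub_mul, sub_mul, hf₁, h, h', hp]; abel)
        (by rw [mul_sub, hf₁, h]) (by rw [sub_mul, hf₁, h']) (by
          rw [map_sub, map_sub, h1, hρf₁, character_vertex, if_pos rfl, sub_self])
      exact (sub_eq_zero.1 this).symm
  · intro h
    have := character_vertex κ c' hκ 0 0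
    rw [← hρf₀, h, map_zero, map_zero, if_pos rfl] at this
    exact zero_ne_one this
  · intro h
    have := character_vertex κ c' hκ 1 1
    rw [← hρf₁, h, map_zero, map_zero, if_pos rfl] at this
    exact zero_ne_one this
  -- The character at vertex 0 kills every product passing through f₁ but sends f₀ to 1.
  · intro x y h
    have := congrArg (fun t => character κ c' hκ 0 (ρ t)) h
    simp only [map_mul, hρf₀, hρf₁, character_vertex] at this
    simp at this

end Lift

end

section

/-! ### The coordinate algebra -/

/-- The semisimple algebra `K² × M₂(K)² × ∏ F r`. -/
abbrev CoordinateAlgebra (K : Type*) [Field K] {ι : Type*} (F : ι → Type*) : Type _ :=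
  (Fin 2 → K) × (Fin 2 → Matrix (Fin 2) (Fin 2) K) × (∀ r, F r)

namespace CoordinateAlgebra

variable {K : Type*} [Field K] {ι : Type*} {F : ι → Type*} [∀ r, Field (F r)]

/-- The elements of the corner belonging to the first idempotent. -/
def corner₀₀ (a p : Fin 2 → K) : CoordinateAlgebra K F := (a, fun i => !![p i, 0; 0, 0], 0)

/-- The elements of the upper right corner. -/
def corner₀₁ (m : Fin 2 → K) : CoordinateAlgebra K F := (0, fun i => !![0, m i; 0, 0], 0)

/-- The elements of the lower left corner. -/
def corner₁₀ (m : Fin 2 → K) : CoordinateAlgebra K F := (0, fun i => !![0, 0; m i, 0], 0)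

/-- The elements of the corner belonging to the second idempotent. -/
def corner₁₁ (h : Fin 2 → K) (d : ∀ r, F r) : CoordinateAlgebra K F :=
  (0, fun i => !![0, 0; 0, h i], d)

theorem corner₀₀_mul_corner₀₀ (a p a' p' : Fin 2 → K) :
    (corner₀₀ a p * corner₀₀ a' p' : CoordinateAlgebra K F) = corner₀₀ (a * a') (p * p') := by
  refine Prod.ext rfl (Prod.ext ?_ (mul_zero _))
  ext i j k; fin_cases j <;> fin_cases k <;> simp [corner₀₀]

theorem corner₀₀_mul_corner₀₁ (a p m : Fin 2 → K) :
    (corner₀₀ a p * corner₀₁ m : CoordinateAlgebra K F) = corner₀₁ (p * m) := by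
  refine Prod.ext (mul_zero _) (Prod.ext ?_ (mul_zero _))
  ext i j k; fin_cases j <;> fin_cases k <;> simp [corner₀₀, corner₀₁]

theorem corner₀₁_mul_corner₁₀ (m n : Fin 2 → K) :
    (corner₀₁ m * corner₁₀ n : CoordinateAlgebra K F) = corner₀₀ 0 (m * n) := by
  refine Prod.ext (mul_zero _) (Prod.ext ?_ (mul_zero _))
  ext i j k; fin_cases j <;> fin_cases k <;> simp [corner₀₀, corner₀₁, corner₁₀]

theorem corner₁₀_mul_corner₀₀ (n a p : Fin 2 → K) :
    (corner₁₀ n * corner₀₀ a p : CoordinateAlgebra K F) = corner₁₀ (n * p) := by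
  refine Prod.ext (zero_mul _) (Prod.ext ?_ (mul_zero _))
  ext i j k; fin_cases j <;> fin_cases k <;> simp [corner₀₀, corner₁₀]

theorem corner₀₁_mul_corner₁₁ (m h : Fin 2 → K) (d : ∀ r, F r) :
    (corner₀₁ m * corner₁₁ h d : CoordinateAlgebra K F) = corner₀₁ (m * h) := by
  refine Prod.ext (zero_mul _) (Prod.ext ?_ (zero_mul _))
  ext i j k; fin_cases j <;> fin_cases k <;> simp [corner₁₁, corner₀₁]

theorem corner₁₁_mul_corner₁₁ (h h' : Fin 2 → K) (d d' : ∀ r, F r) :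
    (corner₁₁ h d * corner₁₁ h' d' : CoordinateAlgebra K F) = corner₁₁ (h * h') (d * d') := by
  refine Prod.ext (zero_mul _) (Prod.ext ?_ rfl)
  ext i j k; fin_cases j <;> fin_cases k <;> simp [corner₁₁]

theorem corner₀₀_mul_mul_corner₀₀ (x : CoordinateAlgebra K F) :
    corner₀₀ 1 1 * x * corner₀₀ 1 1 = corner₀₀ x.1 fun i => x.2.1 i 0 0 := by
  refine Prod.ext (by simp [corner₀₀]) (Prod.ext ?_ (mul_zero _))
  ext i j k; fin_cases j <;> fin_cases k <;> simp [corner₀₀, Matrix.mul_apply, Matrix.vecMul, dotProduct]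

theorem corner₀₀_mul_mul_corner₁₁ (x : CoordinateAlgebra K F) :
    corner₀₀ 1 1 * x * corner₁₁ 1 1 = corner₀₁ fun i => x.2.1 i 0 1 := by
  refine Prod.ext (by simp [corner₀₁, corner₁₁]) (Prod.ext ?_ (by simp [corner₀₀, corner₀₁]))
  ext i j k; fin_cases j <;> fin_cases k <;>
    simp [corner₀₀, corner₁₁, corner₀₁, Matrix.mul_apply, Matrix.vecMul, dotProduct]

theorem corner₁₁_mul_mul_corner₀₀ (x : CoordinateAlgebra K F) :
    corner₁₁ 1 1 * x * corner₀₀ 1 1 = corner₁₀ fun i => x.2.1 i 1 0 := by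
  refine Prod.ext (by simp [corner₁₀, corner₁₁]) (Prod.ext ?_ (by simp [corner₀₀, corner₁₀]))
  ext i j k; fin_cases j <;> fin_cases k <;>
    simp [corner₀₀, corner₁₁, corner₁₀, Matrix.mul_apply, Matrix.vecMul, dotProduct]

theorem corner₁₁_mul_mul_corner₁₁ (x : CoordinateAlgebra K F) :
    corner₁₁ 1 1 * x * corner₁₁ 1 1 = corner₁₁ (fun i => x.2.1 i 1 1) x.2.2 := by
  refine Prod.ext (by simp [corner₁₁]) (Prod.ext ?_ (by simp [corner₁₁]))
  ext i j k; fin_cases j <;> fin_cases k <;> simp [corner₁₁, Matrix.mul_apply, Matrix.vecMul, dotProduct]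

theorem corner₀₀_add_corner₁₁ :
    (corner₀₀ 1 1 + corner₁₁ 1 1 : CoordinateAlgebra K F) = 1 := by
  refine Prod.ext (by simp [corner₀₀, corner₁₁]) (Prod.ext ?_ (by simp [corner₀₀, corner₁₁]))
  ext i j k; fin_cases j <;> fin_cases k <;> simp [corner₀₀, corner₁₁]

theorem corner₀₀_add (a p a' p' : Fin 2 → K) :
    (corner₀₀ a p + corner₀₀ a' p' : CoordinateAlgebra K F) = corner₀₀ (a + a') (p + p') := by
  refine Prod.ext rfl (Prod.ext ?_ (add_zero _))
  ext i j k; fin_cases j <;> fin_cases k <;> simp [corner₀₀]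

theorem corner₀₁_add (m m' : Fin 2 → K) :
    (corner₀₁ m + corner₀₁ m' : CoordinateAlgebra K F) = corner₀₁ (m + m') := by
  refine Prod.ext (add_zero _) (Prod.ext ?_ (add_zero _))
  ext i j k; fin_cases j <;> fin_cases k <;> simp [corner₀₁]

theorem corner₁₀_add (m m' : Fin 2 → K) :
    (corner₁₀ m + corner₁₀ m' : CoordinateAlgebra K F) = corner₁₀ (m + m') := by
  refine Prod.ext (add_zero _) (Prod.ext ?_ (add_zero _))
  ext i j k; fin_cases j <;> fin_cases k <;> simp [corner₁₀]

theorem corner₁₁_add (h h' : Fin 2 → K) (d d' : ∀ r, F r) :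
    (corner₁₁ h d + corner₁₁ h' d' : CoordinateAlgebra K F) = corner₁₁ (h + h') (d + d') := by
  refine Prod.ext (add_zero _) (Prod.ext ?_ rfl)
  ext i j k; fin_cases j <;> fin_cases k <;> simp [corner₁₁]

theorem corner₀₀_inj {a p a' p' : Fin 2 → K} :
    (corner₀₀ a p : CoordinateAlgebra K F) = corner₀₀ a' p' ↔ a = a' ∧ p = p' := by
  refine ⟨fun h => ⟨congrArg Prod.fst h, ?_⟩, by rintro ⟨rfl, rfl⟩; rfl⟩
  ext i
  exact congrFun (congrFun (congrFun (congrArg (fun x => x.2.1) h) i) 0) 0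

theorem corner₀₁_inj {m m' : Fin 2 → K} :
    (corner₀₁ m : CoordinateAlgebra K F) = corner₀₁ m' ↔ m = m' := by
  refine ⟨fun h => ?_, by rintro rfl; rfl⟩
  ext i
  exact congrFun (congrFun (congrFun (congrArg (fun x => x.2.1) h) i) 0) 1

theorem corner₁₀_inj {m m' : Fin 2 → K} :
    (corner₁₀ m : CoordinateAlgebra K F) = corner₁₀ m' ↔ m = m' := by
  refine ⟨fun h => ?_, by rintro rfl; rfl⟩
  ext i
  exact congrFun (congrFun (congrFun (congrArg (fun x => x.2.1) h) i) 1) 0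

theorem corner₁₁_inj {F : ι → Type*} {h h' : Fin 2 → K} {d d' : ∀ r, F r} :
    (corner₁₁ h d : CoordinateAlgebra K F) = corner₁₁ h' d' ↔ h = h' ∧ d = d' := by
  refine ⟨fun e => ⟨?_, congrArg (fun x => x.2.2) e⟩, by rintro ⟨rfl, rfl⟩; rfl⟩
  ext i
  exact congrFun (congrFun (congrFun (congrArg (fun x => x.2.1) e) i) 1) 1

/-- The automorphism that multiplies the upper right corner by `b` and the lower left one by
its inverse. -/
def scale (b : Fin 2 → Kˣ) : CoordinateAlgebra K F ≃+* CoordinateAlgebra K F where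
  toFun x := (x.1, fun i => !![x.2.1 i 0 0, b i * x.2.1 i 0 1;
    ((b i)⁻¹ : Kˣ) * x.2.1 i 1 0, x.2.1 i 1 1], x.2.2)
  invFun x := (x.1, fun i => !![x.2.1 i 0 0, ((b i)⁻¹ : Kˣ) * x.2.1 i 0 1;
    b i * x.2.1 i 1 0, x.2.1 i 1 1], x.2.2)
  left_inv x := by
    refine Prod.ext rfl (Prod.ext ?_ rfl)
    ext i j k; fin_cases j <;> fin_cases k <;> simp
  right_inv x := by
    refine Prod.ext rfl (Prod.ext ?_ rfl)
    ext i j k; fin_cases j <;> fin_cases k <;> simp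
  map_mul' x y := by
    refine Prod.ext rfl (Prod.ext ?_ rfl)
    ext i j k
    have := (b i).ne_zero
    fin_cases j <;> fin_cases k <;> simp [Matrix.mul_apply] <;> field_simp
  map_add' x y := by
    refine Prod.ext rfl (Prod.ext ?_ rfl)
    ext i j k; fin_cases j <;> fin_cases k <;> simp [mul_add]

theorem scale_corner₀₀ (b : Fin 2 → Kˣ) (a p : Fin 2 → K) :
    scale b (corner₀₀ a p : CoordinateAlgebra K F) = corner₀₀ a p := by
  refine Prod.ext rfl (Prod.ext ?_ rfl)
  ext i j k; fin_cases j <;> fin_cases k <;> simp [scale, corner₀₀]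

theorem scale_corner₀₁ (b : Fin 2 → Kˣ) (m : Fin 2 → K) :
    scale b (corner₀₁ m : CoordinateAlgebra K F) = corner₀₁ fun i => b i * m i := by
  refine Prod.ext rfl (Prod.ext ?_ rfl)
  ext i j k; fin_cases j <;> fin_cases k <;> simp [scale, corner₀₁]

/-- The automorphism that permutes the two components `K` by `σ` and the two components `M₂(K)`
by `τ`. -/
def permute (σ τ : Equiv.Perm (Fin 2)) : CoordinateAlgebra K F ≃+* CoordinateAlgebra K F where
  toFun x := (x.1 ∘ σ, x.2.1 ∘ τ, x.2.2)
  invFun x := (x.1 ∘ σ.symm, x.2.1 ∘ τ.symm, x.2.2)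
  left_inv x := by simp [Function.comp_assoc]
  right_inv x := by simp [Function.comp_assoc]
  map_mul' _ _ := rfl
  map_add' _ _ := rfl

theorem permute_corner₀₀ (σ τ : Equiv.Perm (Fin 2)) (a p : Fin 2 → K) :
    permute σ τ (corner₀₀ a p : CoordinateAlgebra K F) = corner₀₀ (a ∘ σ) (p ∘ τ) := rfl

theorem permute_corner₀₁ (σ τ : Equiv.Perm (Fin 2)) (m : Fin 2 → K) :
    permute σ τ (corner₀₁ m : CoordinateAlgebra K F) = corner₀₁ (m ∘ τ) := rfl

theorem permute_corner₁₀ (σ τ : Equiv.Perm (Fin 2)) (m : Fin 2 → K) :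
    permute σ τ (corner₁₀ m : CoordinateAlgebra K F) = corner₁₀ (m ∘ τ) := rfl

theorem permute_corner₁₁ (σ τ : Equiv.Perm (Fin 2)) (h : Fin 2 → K) (d : ∀ r, F r) :
    permute σ τ (corner₁₁ h d : CoordinateAlgebra K F) = corner₁₁ (h ∘ τ) d := rfl

variable [∀ r, Algebra K (F r)]

theorem smul_corner₀₀ (s : K) (a p : Fin 2 → K) :
    s • (corner₀₀ a p : CoordinateAlgebra K F) = corner₀₀ (s • a) (s • p) := by
  refine Prod.ext rfl (Prod.ext ?_ (smul_zero _))
  ext i j k; fin_cases j <;> fin_cases k <;> simp [corner₀₀]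

theorem smul_corner₀₁ (s : K) (m : Fin 2 → K) :
    s • (corner₀₁ m : CoordinateAlgebra K F) = corner₀₁ (s • m) := by
  refine Prod.ext (smul_zero _) (Prod.ext ?_ (smul_zero _))
  ext i j k; fin_cases j <;> fin_cases k <;> simp [corner₀₁]

theorem smul_corner₁₀ (s : K) (m : Fin 2 → K) :
    s • (corner₁₀ m : CoordinateAlgebra K F) = corner₁₀ (s • m) := by
  refine Prod.ext (smul_zero _) (Prod.ext ?_ (smul_zero _))
  ext i j k; fin_cases j <;> fin_cases k <;> simp [corner₁₀]

theorem smul_corner₁₁ (s : K) (h : Fin 2 → K) (d : ∀ r, F r) :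
    s • (corner₁₁ h d : CoordinateAlgebra K F) = corner₁₁ (s • h) (s • d) := by
  refine Prod.ext (smul_zero _) (Prod.ext ?_ rfl)
  ext i j k; fin_cases j <;> fin_cases k <;> simp [corner₁₁]

theorem scale_smul (b : Fin 2 → Kˣ) (s : K) (x : CoordinateAlgebra K F) :
    scale b (s • x) = s • scale b x := by
  refine Prod.ext rfl (Prod.ext ?_ rfl)
  ext i j k; fin_cases j <;> fin_cases k <;> simp [scale, mul_left_comm]

theorem permute_smul (σ τ : Equiv.Perm (Fin 2)) (s : K) (x : CoordinateAlgebra K F) :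
    permute σ τ (s • x) = s • permute σ τ x := rfl

variable [Fintype ι]

/-- The linear form whose associated bilinear form is `T_u`. -/
def form (u₁ u₂ u₃ : K) (x : CoordinateAlgebra K F) : K :=
  u₁ * (x.1 0 + x.1 1) + u₂ * ((x.2.1 0).trace + (x.2.1 1).trace) +
    ∑ r, Algebra.trace K (F r) (algebraMap K (F r) u₃ * x.2.2 r)

theorem form_corner₀₀ (u₁ u₂ u₃ : K) (a p : Fin 2 → K) :
    form u₁ u₂ u₃ (corner₀₀ a p : CoordinateAlgebra K F) =
      u₁ * (a 0 + a 1) + u₂ * (p 0 + p 1) := by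
  simp [form, corner₀₀, Matrix.trace_fin_two]

theorem form_corner₀₁_mul (u₁ u₂ u₃ : K) (m : Fin 2 → K) (x : CoordinateAlgebra K F) :
    form u₁ u₂ u₃ (corner₀₁ m * x) = u₂ * (m 0 * x.2.1 0 1 0 + m 1 * x.2.1 1 1 0) := by
  simp [form, corner₀₁, Matrix.trace_fin_two, Matrix.vecMul, dotProduct]

theorem form_corner₁₁_mul (u₁ u₂ u₃ : K) (h : Fin 2 → K) (x : CoordinateAlgebra K F) :
    form u₁ u₂ u₃ (corner₁₁ h 0 * x) = u₂ * (h 0 * x.2.1 0 1 1 + h 1 * x.2.1 1 1 1) := by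
  simp [form, corner₁₁, Matrix.trace_fin_two, Matrix.vecMul, dotProduct]

theorem form_scale (u₁ u₂ u₃ : K) (b : Fin 2 → Kˣ) (x : CoordinateAlgebra K F) :
    form u₁ u₂ u₃ (scale b x) = form u₁ u₂ u₃ x := by
  simp [form, scale, Matrix.trace_fin_two]

end CoordinateAlgebra

open CoordinateAlgebra

/-- An embedding of an order into the coordinate algebra as a full lattice, such that the given
orthogonal idempotents have the standard coordinates. -/
structure IsLatticeEmbedding (O : Type*) {K Γ : Type*} [CommRing O] [Field K] [Algebra O K] [Ring Γ]
    [Algebra O Γ] {ι : Type*} {F : ι → Type*} [∀ r, Field (F r)] [∀ r, Algebra K (F r)]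
    (f₀ f₁ : Γ) (θ : Γ →+* CoordinateAlgebra K F) : Prop where
  map_smul : ∀ (r : O) x, θ (r • x) = algebraMap O K r • θ x
  injective : Function.Injective θ
  dense : ∀ y, ∃ N : ℕ, ∃ x, θ x = (2 : K) ^ N • y
  map_f₀ : θ f₀ = corner₀₀ 1 1
  map_f₁ : θ f₁ = corner₁₁ 1 1

/-- An embedding of an order into the coordinate algebra that is self-dual with respect to the
form `T_u`. -/
structure IsSelfDualEmbedding (O : Type*) {K Γ : Type*} [CommRing O] [Field K] [Algebra O K] [Ring Γ]
    [Algebra O Γ] {ι : Type*} [Fintype ι] {F : ι → Type*} [∀ r, Field (F r)] [∀ r, Algebra K (F r)]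
    (u₁ u₂ u₃ : K) (f₀ f₁ : Γ) (θ : Γ →+* CoordinateAlgebra K F) : Prop
    extends IsLatticeEmbedding O f₀ f₁ θ where
  form_mem : ∀ x, ∃ r : O, algebraMap O K r = form u₁ u₂ u₃ (θ x)
  mem_of_form : ∀ y, (∀ x, ∃ r : O, algebraMap O K r = form u₁ u₂ u₃ (y * θ x)) → ∃ x, θ x = y

section Transport

variable {O : Type*} {K Γ : Type*} [CommRing O] [Field K] [Algebra O K] [Ring Γ]
  [Algebra O Γ] {ι : Type*} [Fintype ι] {F : ι → Type*} [∀ r, Field (F r)] [∀ r, Algebra K (F r)]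
  {u₁ u₂ u₃ : K} {f₀ f₁ : Γ} {θ : Γ →+* CoordinateAlgebra K F}

theorem IsLatticeEmbedding.comp {ι : Type*} {F : ι → Type*} [∀ r, Field (F r)]
    [∀ r, Algebra K (F r)] {θ : Γ →+* CoordinateAlgebra K F} (hθ : IsLatticeEmbedding O f₀ f₁ θ)
    (σ : CoordinateAlgebra K F ≃+* CoordinateAlgebra K F) (hσ : ∀ (s : K) x, σ (s • x) = s • σ x)
    (h₀ : σ (corner₀₀ 1 1) = corner₀₀ 1 1) :
    IsLatticeEmbedding O f₀ f₁ (σ.toRingHom.comp θ) where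
  map_smul r x := by simp [hθ.map_smul, hσ]
  injective := σ.injective.comp hθ.injective
  dense y := by
    obtain ⟨N, x, hx⟩ := hθ.dense (σ.symm y)
    exact ⟨N, x, by simp [hx, hσ]⟩
  map_f₀ := by simp [hθ.map_f₀, h₀]
  map_f₁ := by
    have h : (corner₁₁ 1 1 : CoordinateAlgebra K F) = 1 - corner₀₀ 1 1 :=
      (sub_eq_of_eq_add' corner₀₀_add_corner₁₁.symm).symm
    simp [hθ.map_f₁, h, h₀]

theorem IsSelfDualEmbedding.comp (hθ : IsSelfDualEmbedding O u₁ u₂ u₃ f₀ f₁ θ)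
    (σ : CoordinateAlgebra K F ≃+* CoordinateAlgebra K F) (hσ : ∀ (s : K) x, σ (s • x) = s • σ x)
    (h₀ : σ (corner₀₀ 1 1) = corner₀₀ 1 1)
    (hform : ∀ x, form u₁ u₂ u₃ (σ x) = form u₁ u₂ u₃ x) :
    IsSelfDualEmbedding O u₁ u₂ u₃ f₀ f₁ (σ.toRingHom.comp θ) where
  toIsLatticeEmbedding := hθ.toIsLatticeEmbedding.comp σ hσ h₀
  form_mem x := by simpa [hform] using hθ.form_mem x
  mem_of_form y hy := by
    obtain ⟨x, hx⟩ := hθ.mem_of_form (σ.symm y) fun x => by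
      obtain ⟨r, hr⟩ := hy x
      refine ⟨r, hr.trans ?_⟩
      rw [← hform (σ.symm y * θ x)]
      simp
    exact ⟨x, by simp [hx]⟩

end Transport

end

section

/-! ### Arithmetic in the coefficient ring -/

section Arithmetic

variable {O : Type*} [CommRing O] [IsDomain O]

/-- The congruences that tie together the coordinates of the generators of a lift. -/
theorem dvd_of_generator_congruences (h2 : Prime (2 : O)) (hunit : ∀ x : O, ¬ 2 ∣ x → IsUnit x)
    {m : ℕ} {ε₁ ε₂ p₀ p₁ a₀ a₁ b₀ b₁ w t₀ t₁ s t e f : O} (hε₂ : IsUnit ε₂) (hw : ¬ 2 ∣ w)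
    (ht₁ : ¬ 2 ∣ t₁) (hp₀ : 2 ∣ p₀) (hp₁ : 2 ∣ p₁) (ha₀ : 2 ∣ a₀) (hs : 2 ∣ s)
    (hδ : a₁ - a₀ = 2 * w) (hone : ε₁ + ε₂ = 2 ^ (m + 1) * e)
    (hα : ε₁ * (p₀ + p₁) + ε₂ * (a₀ + a₁) = 2 ^ (m + 2) * f)
    (h₀ : ε₂ * (b₀ + b₁) = 2 ^ (m + 2) * t₀)
    (h₁ : ε₂ * (a₀ * b₀ + a₁ * b₁) = 2 ^ (m + 2) * t₁)
    (hr₀ : (a₀ - p₀) * (a₀ - p₁) = s * b₀ + t * (a₀ * b₀))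
    (hr₁ : (a₁ - p₀) * (a₁ - p₁) = s * b₁ + t * (a₁ * b₁)) :
    2 ∣ t ∧ 2 ^ (m + 2) ∣ a₀ + a₁ - p₀ - p₁ ∧
      (2 ^ (m + 1) ∣ a₀ - p₀ ∨ 2 ^ (m + 1) ∣ a₀ - p₁) := by
  have hpow : ∀ k : ℕ, (2 : O) ^ k ≠ 0 := fun k => pow_ne_zero k h2.ne_zero
  obtain ⟨p₀', rfl⟩ := hp₀
  obtain ⟨p₁', rfl⟩ := hp₁
  -- Since ε₁ ≡ -ε₂ modulo 2^(m+1) and p₀ + p₁ is even, the trace of α becomes ε₂(a₀ + a₁ - p₀ - p₁)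
  -- modulo 2^(m+2).
  obtain ⟨ν, hν⟩ := hε₂.exists_right_inv
  obtain ⟨z, hz⟩ : ∃ z, a₀ + a₁ - 2 * p₀' - 2 * p₁' = 2 ^ (m + 2) * z :=
    ⟨ν * (f - e * (p₀' + p₁')), by
      linear_combination ν * hα - ν * (2 * p₀' + 2 * p₁') * hone -
        (a₀ + a₁ - 2 * p₀' - 2 * p₁') * hν⟩
  -- Add `hr₀` and `hr₁`. On the right ε₂ times the sum is 2^(m+2)(st₀ + tt₁). On the left a₁ ≈ p₀ +
  -- p₁ - a₀ makes both products nearly equal to (a₀ - p₀)(a₀ - p₁) = (s + ta₀)b₀, where Cramer's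
  -- rule gives 2wε₂b₀ = 2^(m+2)(a₁t₀ - t₁). The terms with z are the error of this approximation.
  have main : w * (s * t₀ + t * t₁) = (s + t * a₀) * (a₁ * t₀ - t₁) -
      w * ε₂ * z * (2 * a₀ - 2 * p₀' - 2 * p₁') + w * ε₂ * 2 ^ (m + 2) * z ^ 2 := by
    apply mul_left_cancel₀ (hpow (m + 2))
    linear_combination (-w * s + (s + t * a₀) * a₁) * h₀ - (w * t + (s + t * a₀)) * h₁ +
      (-w * ε₂ + ε₂ * (a₁ - a₀)) * hr₀ - w * ε₂ * hr₁ -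
      ε₂ * (a₀ - 2 * p₀') * (a₀ - 2 * p₁') * hδ +
      w * ε₂ * ((a₀ + a₁ - 2 * p₀' - 2 * p₁') + 2 ^ (m + 2) * z -
        (2 * a₀ - 2 * p₀' - 2 * p₁')) * hz
  obtain ⟨s', rfl⟩ := hs
  obtain ⟨a₀', rfl⟩ := ha₀
  -- All terms of `main` other than wtt₁ are even, and w and t₁ are odd.
  have ht : 2 ∣ t := by
    have : 2 ∣ w * (t * t₁) := by
      refine ⟨-(w * s' * t₀) + (s' + t * a₀') * (a₁ * t₀ - t₁) -
        w * ε₂ * z * (2 * a₀' - p₀' - p₁') + w * ε₂ * 2 ^ (m + 1) * z ^ 2, ?_⟩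
      linear_combination main
    rcases h2.dvd_or_dvd this with h | h
    · exact absurd h hw
    · exact (h2.dvd_or_dvd h).resolve_right ht₁
  refine ⟨ht, ⟨z, hz⟩, ?_⟩
  obtain ⟨t', rfl⟩ := ht
  -- The half differences a₀' - p₀' and a₀' - p₁' have an odd sum, because w is odd. At least one of
  -- them is therefore a unit, and the power 2^m dividing their product divides the other.
  have hq : 2 * a₀' + w - p₀' - p₁' = 2 ^ (m + 1) * z := by
    apply mul_left_cancel₀ h2.ne_zero
    linear_combination hz - hδ
  have hb : 2 ^ (m + 1) ∣ b₀ := by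
    have h : w * ε₂ * b₀ = 2 ^ (m + 1) * (a₁ * t₀ - t₁) := by
      apply mul_left_cancel₀ h2.ne_zero
      linear_combination a₁ * h₀ - h₁ - ε₂ * b₀ * hδ
    exact ((hunit w hw).mul (hε₂)).dvd_mul_left.1 ⟨_, h⟩
  obtain ⟨b', rfl⟩ := hb
  have hprod : (2 : O) ^ m ∣ (a₀' - p₀') * (a₀' - p₁') := by
    refine ⟨(s' + t' * (2 * a₀')) * b', ?_⟩
    apply mul_left_cancel₀ h2.ne_zero
    apply mul_left_cancel₀ h2.ne_zero
    linear_combination hr₀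
  have lift : ∀ x : O, 2 ^ m ∣ x → (2 : O) ^ (m + 1) ∣ 2 * x := fun x hx => by
    rw [pow_succ']; exact mul_dvd_mul_left 2 hx
  rw [← mul_sub, ← mul_sub]
  by_cases hA : 2 ∣ a₀' - p₀'
  · left
    apply lift
    refine (hunit (a₀' - p₁') fun hB => hw ?_).dvd_mul_right.1 hprod
    obtain ⟨x, hx⟩ := hA
    obtain ⟨y, hy⟩ := hB
    exact ⟨2 ^ m * z - x - y, by linear_combination hq - hx - hy⟩
  · right
    exact lift _ ((hunit _ hA).dvd_mul_left.1 hprod)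

end Arithmetic

/-! ### Minimal polynomials of topologically nilpotent elements -/

section MinimalPolynomial

variable {O K L : Type*} [CommRing O] [IsIntegrallyClosed O] [Field K] [Algebra O K]
  [IsFractionRing O K] [Field L] [Algebra K L]

theorem exists_map_eq_minpoly [IsDomain O] {π : L}
    (hπ : ((algebraMap K L).comp (algebraMap O K)).IsIntegralElem π) :
    ∃ g : Polynomial O, g.Monic ∧ g.map (algebraMap O K) = minpoly K π := by
  let _ : Algebra O L := ((algebraMap K L).comp (algebraMap O K)).toAlgebra
  have : IsScalarTower O K L := IsScalarTower.of_algebraMap_eq fun _ => rfl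
  have h : IsIntegral O π := hπ
  exact ⟨minpoly O π, minpoly.monic h, (minpoly.isIntegrallyClosed_eq_field_fractions K L h).symm⟩

/-- If the constant term were a unit, π would have an integral inverse, namely a polynomial in π.
Then πᵏ = 2y would make 1/2 integral over O, which is impossible in an integrally closed ring where
2 is not a unit. -/
theorem two_dvd_coeff_zero_of_map_eq_minpoly (hunit : ∀ x : O, ¬ 2 ∣ x → IsUnit x)
    (h2 : ¬ IsUnit (2 : O)) [CharZero O] {π y : L} {k : ℕ}
    (hy : ((algebraMap K L).comp (algebraMap O K)).IsIntegralElem y) (hk : π ^ k = 2 * y)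
    (hπ : ((algebraMap K L).comp (algebraMap O K)).IsIntegralElem π)
    {g : Polynomial O} (hg : g.map (algebraMap O K) = minpoly K π) : 2 ∣ g.coeff 0 := by
  by_contra hcon
  let _ : Algebra O L := ((algebraMap K L).comp (algebraMap O K)).toAlgebra
  have : IsScalarTower O K L := IsScalarTower.of_algebraMap_eq fun _ => rfl
  have hinj : Function.Injective (algebraMap O L) :=
    (algebraMap K L).injective.comp (IsFractionRing.injective O K)
  obtain ⟨e, he⟩ := (hunit _ hcon).exists_right_inv
  have h0 : Polynomial.aeval π g = 0 := by
    rw [← Polynomial.aeval_map_algebraMap K, hg, minpoly.aeval]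
  have h1 : Polynomial.aeval π g.divX * π = - algebraMap O L (g.coeff 0) := by
    rw [← Polynomial.divX_mul_X_add g, map_add, map_mul, Polynomial.aeval_X, Polynomial.aeval_C]
      at h0
    exact eq_neg_of_add_eq_zero_left h0
  have hint : IsIntegral O (Polynomial.aeval π g.divX) :=
    IsIntegral.of_mem_of_fg (Algebra.adjoin O {π}) (IsIntegral.fg_adjoin_singleton hπ) _
      (Polynomial.aeval_mem_adjoin_singleton O π)
  have h3 : 2 * ((Polynomial.aeval π g.divX * algebraMap O L (-e)) ^ k * y) = 1 := by
    have h4 : (Polynomial.aeval π g.divX * algebraMap O L (-e)) * π = 1 := by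
      rw [mul_right_comm, h1, map_neg, neg_mul_neg, ← map_mul, he, map_one]
    rw [mul_left_comm, ← hk, ← mul_pow, h4, one_pow]
  have h2L : (algebraMap O L 2) ≠ 0 := by
    rw [Ne, map_eq_zero_iff _ hinj]; exact two_ne_zero
  have hintK : IsIntegral O ((algebraMap O K 2)⁻¹) := by
    have h5 : algebraMap K L ((algebraMap O K 2)⁻¹) =
        (Polynomial.aeval π g.divX * algebraMap O L (-e)) ^ k * y := by
      rw [map_inv₀, ← IsScalarTower.algebraMap_apply O K L]
      exact inv_eq_of_mul_eq_one_right (by rw [map_ofNat]; exact h3)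
    rw [← isIntegral_algHom_iff (IsScalarTower.toAlgHom O K L) (algebraMap K L).injective]
    rw [IsScalarTower.coe_toAlgHom', h5]
    exact (((hint.mul isIntegral_algebraMap).pow k)).mul hy
  obtain ⟨x, hx⟩ := IsIntegrallyClosed.isIntegral_iff.1 hintK
  apply h2
  refine IsUnit.of_mul_eq_one x (IsFractionRing.injective O K ?_)
  rw [map_mul, hx, map_one, mul_inv_cancel₀]
  rw [Ne, map_eq_zero_iff _ (IsFractionRing.injective O K)]; exact two_ne_zero

end MinimalPolynomial

/-- The minimal polynomials of the π r are distinct irreducibles because of `hsep`, so their product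
divides P already over O. Each has an even constant term, hence an even value at an even argument,
and there is one factor for each index. -/
theorem two_pow_card_dvd_eval {O K ι : Type*} [CommRing O] [IsDomain O] [IsIntegrallyClosed O]
    [CharZero O] [Field K] [Algebra O K] [IsFractionRing O K] [Fintype ι] {F : ι → Type*}
    [∀ r, Field (F r)] [∀ r, Algebra K (F r)] (hunit : ∀ x : O, ¬ 2 ∣ x → IsUnit x)
    (h2 : ¬ IsUnit (2 : O)) {π y : ∀ r, F r} {k : ℕ}
    (hy : ∀ r, ((algebraMap K (F r)).comp (algebraMap O K)).IsIntegralElem (y r))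
    (hk : ∀ r, π r ^ k = 2 * y r)
    (hπ : ∀ r, ((algebraMap K (F r)).comp (algebraMap O K)).IsIntegralElem (π r))
    (hsep : ∀ r s, r ≠ s → ∃ Q : Polynomial K,
      Polynomial.aeval (π r) Q = 0 ∧ Polynomial.aeval (π s) Q ≠ 0)
    {P : Polynomial O} (hP : ∀ r, Polynomial.aeval (π r) (P.map (algebraMap O K)) = 0)
    {h : O} (hh : 2 ∣ h) : 2 ^ Fintype.card ι ∣ P.eval h := by
  choose g hg hgm using fun r => exists_map_eq_minpoly (hπ r)
  have hint : ∀ r, IsIntegral K (π r) := fun r => by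
    obtain ⟨f, hf, hf0⟩ := hπ r
    exact ⟨f.map (algebraMap O K), hf.map _, by rwa [Polynomial.eval₂_map]⟩
  have hdvd : (∏ r, g r) ∣ P := by
    rw [← Polynomial.map_dvd_map (algebraMap O K) (IsFractionRing.injective O K)
      (Polynomial.monic_prod_of_monic _ _ fun r _ => hg r), Polynomial.map_prod]
    apply Finset.prod_dvd_of_coprime
    · intro r _ s _ hrs
      simp only [Function.onFun, hgm]
      rw [(minpoly.irreducible (hint r)).coprime_iff_not_dvd]
      intro hd
      have heq : minpoly K (π r) = minpoly K (π s) :=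
        Polynomial.eq_of_monic_of_associated (minpoly.monic (hint r)) (minpoly.monic (hint s))
          (((minpoly.irreducible (hint r)).dvd_irreducible_iff_associated
            (minpoly.irreducible (hint s))).1 hd)
      obtain ⟨Q, hQ, hQ'⟩ := hsep r s hrs
      obtain ⟨R, rfl⟩ := minpoly.dvd K (π r) hQ
      apply hQ'
      rw [heq, map_mul, minpoly.aeval, zero_mul]
    · intro r _
      rw [hgm]
      exact minpoly.dvd K _ (hP r)
  refine dvd_trans ?_ (Polynomial.eval_dvd hdvd)
  rw [Polynomial.eval_prod, Fintype.card, ← Finset.prod_const]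
  apply Finset.prod_dvd_prod_of_dvd
  intro r _
  have h0 := two_dvd_coeff_zero_of_map_eq_minpoly hunit h2 (hy r) (hk r) (hπ r) (hgm r)
  rw [Polynomial.coeff_zero_eq_eval_zero] at h0
  have := (dvd_trans hh (by simpa using (g r).sub_dvd_eval_sub h 0))
  exact (dvd_sub_left h0).1 this

end

/-! ### Corners of an embedded order and coordinates of the generators -/

section

set_option linter.unusedSectionVars false

open CoordinateAlgebra

section Corners

variable {O K Γ ι : Type*} [CommRing O] [Field K] [Algebra O K] [Ring Γ] [Algebra O Γ]
  {F : ι → Type*} [∀ r, Field (F r)] [∀ r, Algebra K (F r)] {f₀ f₁ : Γ}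
  {θ : Γ →+* CoordinateAlgebra K F}

namespace IsLatticeEmbedding

theorem map_f₀_mul_mul_f₀ (hθ : IsLatticeEmbedding O f₀ f₁ θ) (x : Γ) :
    θ (f₀ * x * f₀) = corner₀₀ (θ x).1 fun i => (θ x).2.1 i 0 0 := by
  rw [map_mul, map_mul, hθ.map_f₀, corner₀₀_mul_mul_corner₀₀]

theorem map_f₀_mul_mul_f₁ (hθ : IsLatticeEmbedding O f₀ f₁ θ) (x : Γ) :
    θ (f₀ * x * f₁) = corner₀₁ fun i => (θ x).2.1 i 0 1 := by
  rw [map_mul, map_mul, hθ.map_f₀, hθ.map_f₁, corner₀₀_mul_mul_corner₁₁]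

theorem map_f₁_mul_mul_f₀ (hθ : IsLatticeEmbedding O f₀ f₁ θ) (x : Γ) :
    θ (f₁ * x * f₀) = corner₁₀ fun i => (θ x).2.1 i 1 0 := by
  rw [map_mul, map_mul, hθ.map_f₀, hθ.map_f₁, corner₁₁_mul_mul_corner₀₀]

theorem map_f₁_mul_mul_f₁ (hθ : IsLatticeEmbedding O f₀ f₁ θ) (x : Γ) :
    θ (f₁ * x * f₁) = corner₁₁ (fun i => (θ x).2.1 i 1 1) (θ x).2.2 := by
  rw [map_mul, map_mul, hθ.map_f₁, corner₁₁_mul_mul_corner₁₁]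

theorem f₀_mul_mul_f₀_eq (hθ : IsLatticeEmbedding O f₀ f₁ θ) {x : Γ} {a p : Fin 2 → K}
    (hx : θ x = corner₀₀ a p) : f₀ * x * f₀ = x := by
  apply hθ.injective
  rw [hθ.map_f₀_mul_mul_f₀, hx]
  rfl

theorem f₀_mul_mul_f₁_eq (hθ : IsLatticeEmbedding O f₀ f₁ θ) {x : Γ} {a : Fin 2 → K}
    (hx : θ x = corner₀₁ a) : f₀ * x * f₁ = x := by
  apply hθ.injective
  rw [hθ.map_f₀_mul_mul_f₁, hx]
  rfl

theorem f₁_mul_mul_f₀_eq (hθ : IsLatticeEmbedding O f₀ f₁ θ) {x : Γ} {a : Fin 2 → K}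
    (hx : θ x = corner₁₀ a) : f₁ * x * f₀ = x := by
  apply hθ.injective
  rw [hθ.map_f₁_mul_mul_f₀, hx]
  rfl

theorem f₁_mul_mul_f₁_eq (hθ : IsLatticeEmbedding O f₀ f₁ θ) {x : Γ} {a : Fin 2 → K}
    {d : ∀ r, F r} (hx : θ x = corner₁₁ a d) : f₁ * x * f₁ = x := by
  apply hθ.injective
  rw [hθ.map_f₁_mul_mul_f₁, hx]
  rfl

/-- A monic polynomial annihilating x annihilates each coordinate. Multiplying by f₀ is needed
because the constant term must act through the unit of the corner. -/
theorem isIntegral_corner₀₀ [Module.Finite O Γ] (hθ : IsLatticeEmbedding O f₀ f₁ θ) {x : Γ}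
    {a p : Fin 2 → K} (hx : θ x = corner₀₀ a p) (i : Fin 2) :
    IsIntegral O (a i) ∧ IsIntegral O (p i) := by
  obtain ⟨f, hf, hf0⟩ : IsIntegral O x := IsIntegral.of_finite O x
  have key : ∀ f : Polynomial O, θ (Polynomial.aeval x f * f₀) =
      corner₀₀ (fun i => Polynomial.aeval (a i) f) (fun i => Polynomial.aeval (p i) f) := by
    intro f
    induction f using Polynomial.induction_on' with
    | add f g hf hg =>
      rw [map_add, add_mul, map_add, hf, hg, corner₀₀_add]
      congr 1 <;> ext i <;> simp
    | monomial n r =>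
      have hpow : ∀ n : ℕ, θ (x ^ n * f₀) = corner₀₀ (a ^ n) (p ^ n) := by
        intro n
        induction n with
        | zero => rw [pow_zero, one_mul, hθ.map_f₀, pow_zero, pow_zero]
        | succ n ih =>
          rw [pow_succ', mul_assoc, map_mul, ih, hx, corner₀₀_mul_corner₀₀, pow_succ', pow_succ']
      rw [Polynomial.aeval_monomial, ← Algebra.smul_def, smul_mul_assoc, hθ.map_smul, hpow,
        smul_corner₀₀]
      congr 1 <;> ext i <;> simp
  have h := key f
  rw [Polynomial.aeval_def, hf0, zero_mul, map_zero] at h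
  have h' : (corner₀₀ 0 0 : CoordinateAlgebra K F) = corner₀₀ _ _ :=
    (by rw [← zero_smul K (corner₀₀ 0 0), smul_corner₀₀, zero_smul] : _ = (0 : CoordinateAlgebra K F)).trans h
  obtain ⟨ha, hp⟩ := corner₀₀_inj.1 h'
  exact ⟨⟨f, hf, (congrFun ha i).symm⟩, ⟨f, hf, (congrFun hp i).symm⟩⟩

theorem map_aeval_mul_f₁ (hθ : IsLatticeEmbedding O f₀ f₁ θ) {x : Γ}
    {h : Fin 2 → K} {d : ∀ r, F r} (hx : θ x = corner₁₁ h d) (f : Polynomial O) :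
    θ (Polynomial.aeval x f * f₁) = corner₁₁ (fun i => Polynomial.aeval (h i) f)
      (fun r => Polynomial.aeval (d r) (f.map (algebraMap O K))) := by
  induction f using Polynomial.induction_on' with
  | add f g hf hg =>
    rw [map_add, add_mul, map_add, hf, hg, corner₁₁_add]
    congr 1 <;> ext i <;> simp
  | monomial n r =>
    have hpow : ∀ n : ℕ, θ (x ^ n * f₁) = corner₁₁ (h ^ n) (d ^ n) := by
      intro n
      induction n with
      | zero => rw [pow_zero, one_mul, hθ.map_f₁, pow_zero, pow_zero]
      | succ n ih =>
        rw [pow_succ', mul_assoc, map_mul, ih, hx, corner₁₁_mul_corner₁₁, pow_succ', pow_succ']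
    rw [Polynomial.aeval_monomial, ← Algebra.smul_def, smul_mul_assoc, hθ.map_smul, hpow,
      smul_corner₁₁]
    congr 1 <;> ext i <;> simp [Polynomial.aeval_monomial, Algebra.smul_def]

theorem isIntegral_corner₁₁ [Module.Finite O Γ] (hθ : IsLatticeEmbedding O f₀ f₁ θ) {x : Γ}
    {h : Fin 2 → K} {d : ∀ r, F r} (hx : θ x = corner₁₁ h d) :
    (∀ i, IsIntegral O (h i)) ∧
      ∀ r, ((algebraMap K (F r)).comp (algebraMap O K)).IsIntegralElem (d r) := by
  obtain ⟨f, hf, hf0⟩ : IsIntegral O x := IsIntegral.of_finite O x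
  have key := hθ.map_aeval_mul_f₁ hx f
  rw [Polynomial.aeval_def, hf0, zero_mul, map_zero] at key
  have h' : (corner₁₁ 0 0 : CoordinateAlgebra K F) = corner₁₁ _ _ :=
    (by rw [← zero_smul K (corner₁₁ 0 0), smul_corner₁₁, zero_smul, zero_smul] :
      _ = (0 : CoordinateAlgebra K F)).trans key
  obtain ⟨ha, hp⟩ := corner₁₁_inj.1 h'
  refine ⟨fun i => ⟨f, hf, (congrFun ha i).symm⟩, fun r => ⟨f, hf, ?_⟩⟩
  have := (congrFun hp r).symm
  rwa [Polynomial.aeval_def, Polynomial.eval₂_map] at this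

end IsLatticeEmbedding

end Corners

/-- The coordinates of the generators of a lift, normalized at `β`. -/
structure GeneratorCoordinates {O K Γ ι : Type*} [CommRing O] [Field K] [Algebra O K] [Ring Γ]
    [Algebra O Γ] {F : ι → Type*} [∀ r, Field (F r)] {κ : ℕ} {c : O}
    (q : LiftedQuiver O κ c Γ) (θ : Γ →+* CoordinateAlgebra K F)
    (p₀ p₁ a₀ a₁ b₀ b₁ h₀ h₁ : O) (π : ∀ r, F r) : Prop where
  α : θ q.α = corner₀₀ ![algebraMap O K p₀, algebraMap O K p₁] ![algebraMap O K a₀, algebraMap O K a₁]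
  β : θ q.β = corner₀₁ 1
  γ : θ q.γ = corner₁₀ ![algebraMap O K b₀, algebraMap O K b₁]
  η : θ q.η = corner₁₁ ![algebraMap O K h₀, algebraMap O K h₁] π

section Generators

variable {O K Γ ι : Type*} [CommRing O] [IsIntegrallyClosed O] [CharZero O] [Field K] [Algebra O K]
  [IsFractionRing O K] [Ring Γ] [Algebra O Γ] {F : ι → Type*} [∀ r, Field (F r)]
  [∀ r, Algebra K (F r)] {κ : ℕ} {c : O} {q : LiftedQuiver O κ c Γ}
  {θ : Γ →+* CoordinateAlgebra K F}

theorem two_ne_zero_of_isFractionRing (O K : Type*) [CommRing O] [CharZero O] [Field K] [Algebra O K]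
    [IsFractionRing O K] : (2 : K) ≠ 0 := by
  rw [← map_ofNat (algebraMap O K) 2, Ne, map_eq_zero_iff _ (IsFractionRing.injective O K)]
  exact two_ne_zero

/-- The corner f₀Γf₁ is spanned by β and αβ. If β had a zero coordinate, the whole corner would
vanish there and Γ would not be a full lattice. -/
theorem IsLatticeEmbedding.exists_scale (hθ : IsLatticeEmbedding O q.f₀ q.f₁ θ) :
    ∃ b : Fin 2 → Kˣ, (scale b) (θ q.β) = corner₀₁ 1 := by
  have hβ : θ q.β = corner₀₁ fun i => (θ q.β).2.1 i 0 1 := by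
    rw [← hθ.map_f₀_mul_mul_f₁, q.f₀_mul_β, q.β_mul_f₁]
  have hα : θ q.α = corner₀₀ (θ q.α).1 fun i => (θ q.α).2.1 i 0 0 := by
    rw [← hθ.map_f₀_mul_mul_f₀, q.f₀_mul_α, q.α_mul_f₀]
  set m := fun i => (θ q.β).2.1 i 0 1
  have hm : ∀ i, m i ≠ 0 := by
    intro i hi
    obtain ⟨N, x, hx⟩ := hθ.dense (corner₀₁ 1)
    rw [smul_corner₀₁] at hx
    obtain ⟨r₀, r₁, h⟩ := q.corner₀₁ x
    rw [hθ.f₀_mul_mul_f₁_eq hx] at h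
    rw [h, map_add, hθ.map_smul, hθ.map_smul, map_mul, hβ, hα, corner₀₀_mul_corner₀₁, smul_corner₀₁,
      smul_corner₀₁, corner₀₁_add, corner₀₁_inj] at hx
    have := congrFun hx i
    simp [hi] at this
    exact pow_ne_zero N (two_ne_zero_of_isFractionRing O K) this.symm
  refine ⟨fun i => (Units.mk0 (m i) (hm i))⁻¹, ?_⟩
  rw [hβ, scale_corner₀₁]
  congr 1
  ext i
  simp [hm i]

theorem IsLatticeEmbedding.exists_generatorCoordinates [Module.Finite O Γ]
    (hθ : IsLatticeEmbedding O q.f₀ q.f₁ θ) (hβ : θ q.β = corner₀₁ 1) :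
    ∃ p₀ p₁ a₀ a₁ b₀ b₁ h₀ h₁ π, GeneratorCoordinates q θ p₀ p₁ a₀ a₁ b₀ b₁ h₀ h₁ π := by
  have hα : θ q.α = corner₀₀ (θ q.α).1 fun i => (θ q.α).2.1 i 0 0 := by
    rw [← hθ.map_f₀_mul_mul_f₀, q.f₀_mul_α, q.α_mul_f₀]
  have hγ : θ q.γ = corner₁₀ fun i => (θ q.γ).2.1 i 1 0 := by
    rw [← hθ.map_f₁_mul_mul_f₀, q.f₁_mul_γ, q.γ_mul_f₀]
  have hη : θ q.η = corner₁₁ (fun i => (θ q.η).2.1 i 1 1) (θ q.η).2.2 := by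
    rw [← hθ.map_f₁_mul_mul_f₁, q.f₁_mul_η, q.η_mul_f₁]
  -- An off-diagonal element such as γ need not have integral entries. Its entries are read off from
  -- βγ, where β has been normalized to 1.
  have hβγ : θ (q.β * q.γ) = corner₀₀ 0 (1 * fun i => (θ q.γ).2.1 i 1 0) := by
    rw [map_mul, hβ, hγ, corner₀₁_mul_corner₁₀]
    rfl
  choose p hp using fun i => IsIntegrallyClosed.isIntegral_iff.1 (hθ.isIntegral_corner₀₀ hα i).1
  choose a ha using fun i => IsIntegrallyClosed.isIntegral_iff.1 (hθ.isIntegral_corner₀₀ hα i).2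
  choose b hb using fun i => IsIntegrallyClosed.isIntegral_iff.1 (hθ.isIntegral_corner₀₀ hβγ i).2
  choose h hh using fun i => IsIntegrallyClosed.isIntegral_iff.1 ((hθ.isIntegral_corner₁₁ hη).1 i)
  refine ⟨p 0, p 1, a 0, a 1, b 0, b 1, h 0, h 1, (θ q.η).2.2, ?_, hβ, ?_, ?_⟩
  · rw [hα, corner₀₀_inj]
    constructor <;> ext i <;> fin_cases i <;> simp [hp, ha]
  · rw [hγ, corner₁₀_inj]
    ext i; fin_cases i <;> simp [hb]
  · rw [hη, corner₁₁_inj]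
    refine ⟨?_, rfl⟩
    ext i; fin_cases i <;> simp [hh]

variable {p₀ p₁ a₀ a₁ b₀ b₁ h₀ h₁ : O} {π : ∀ r, F r}

namespace GeneratorCoordinates

theorem map_corner₀₀ (hg : GeneratorCoordinates q θ p₀ p₁ a₀ a₁ b₀ b₁ h₀ h₁ π)
    (hθ : IsLatticeEmbedding O q.f₀ q.f₁ θ) (r₀ r₁ r₂ r₃ : O) :
    θ (r₀ • q.f₀ + r₁ • q.α + r₂ • (q.β * q.γ) + r₃ • (q.α * q.β * q.γ)) =
      corner₀₀ ![algebraMap O K (r₀ + r₁ * p₀), algebraMap O K (r₀ + r₁ * p₁)]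
        ![algebraMap O K (r₀ + r₁ * a₀ + r₂ * b₀ + r₃ * (a₀ * b₀)),
          algebraMap O K (r₀ + r₁ * a₁ + r₂ * b₁ + r₃ * (a₁ * b₁))] := by
  simp only [map_add, hθ.map_smul, map_mul, hg.α, hg.β, hg.γ, hθ.map_f₀, mul_assoc,
    corner₀₁_mul_corner₁₀, corner₀₀_mul_corner₀₀, smul_corner₀₀, corner₀₀_add, corner₀₀_inj]
  constructor <;> ext i <;> fin_cases i <;> simp [-algebraMap_smul, Matrix.vecHead, Matrix.vecTail]

theorem map_corner₀₁ (hg : GeneratorCoordinates q θ p₀ p₁ a₀ a₁ b₀ b₁ h₀ h₁ π)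
    (hθ : IsLatticeEmbedding O q.f₀ q.f₁ θ) (r₀ r₁ : O) :
    θ (r₀ • q.β + r₁ • (q.α * q.β)) =
      corner₀₁ ![algebraMap O K (r₀ + r₁ * a₀), algebraMap O K (r₀ + r₁ * a₁)] := by
  simp only [map_add, hθ.map_smul, map_mul, hg.α, hg.β,
    corner₀₀_mul_corner₀₁, smul_corner₀₁, corner₀₁_add, corner₀₁_inj]
  ext i; fin_cases i <;> simp [-algebraMap_smul, Matrix.vecHead, Matrix.vecTail]

theorem map_corner₁₀ (hg : GeneratorCoordinates q θ p₀ p₁ a₀ a₁ b₀ b₁ h₀ h₁ π)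
    (hθ : IsLatticeEmbedding O q.f₀ q.f₁ θ) (r₀ r₁ : O) :
    θ (r₀ • q.γ + r₁ • (q.γ * q.α)) =
      corner₁₀ ![algebraMap O K (b₀ * (r₀ + r₁ * a₀)), algebraMap O K (b₁ * (r₀ + r₁ * a₁))] := by
  simp only [map_add, hθ.map_smul, map_mul, hg.α, hg.γ,
    corner₁₀_mul_corner₀₀, smul_corner₁₀, corner₁₀_add, corner₁₀_inj]
  ext i; fin_cases i <;> simp [-algebraMap_smul] <;> ring

theorem exists_corner₀₀ (hg : GeneratorCoordinates q θ p₀ p₁ a₀ a₁ b₀ b₁ h₀ h₁ π)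
    (hθ : IsLatticeEmbedding O q.f₀ q.f₁ θ) {x : Γ} {a p : Fin 2 → K} (hx : θ x = corner₀₀ a p) :
    ∃ r₀ r₁ r₂ r₃ : O, a = ![algebraMap O K (r₀ + r₁ * p₀), algebraMap O K (r₀ + r₁ * p₁)] ∧
      p = ![algebraMap O K (r₀ + r₁ * a₀ + r₂ * b₀ + r₃ * (a₀ * b₀)),
          algebraMap O K (r₀ + r₁ * a₁ + r₂ * b₁ + r₃ * (a₁ * b₁))] := by
  obtain ⟨r₀, r₁, r₂, r₃, h⟩ := q.corner₀₀ x
  rw [hθ.f₀_mul_mul_f₀_eq hx] at h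
  rw [h, hg.map_corner₀₀ hθ, corner₀₀_inj] at hx
  exact ⟨r₀, r₁, r₂, r₃, hx.1.symm, hx.2.symm⟩

theorem exists_corner₀₁ (hg : GeneratorCoordinates q θ p₀ p₁ a₀ a₁ b₀ b₁ h₀ h₁ π)
    (hθ : IsLatticeEmbedding O q.f₀ q.f₁ θ) {x : Γ} {m : Fin 2 → K} (hx : θ x = corner₀₁ m) :
    ∃ r₀ r₁ : O, m = ![algebraMap O K (r₀ + r₁ * a₀), algebraMap O K (r₀ + r₁ * a₁)] := by
  obtain ⟨r₀, r₁, h⟩ := q.corner₀₁ x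
  rw [hθ.f₀_mul_mul_f₁_eq hx] at h
  rw [h, hg.map_corner₀₁ hθ, corner₀₁_inj] at hx
  exact ⟨r₀, r₁, hx.symm⟩

theorem exists_corner₁₀ (hg : GeneratorCoordinates q θ p₀ p₁ a₀ a₁ b₀ b₁ h₀ h₁ π)
    (hθ : IsLatticeEmbedding O q.f₀ q.f₁ θ) {x : Γ} {m : Fin 2 → K} (hx : θ x = corner₁₀ m) :
    ∃ r₀ r₁ : O,
      m = ![algebraMap O K (b₀ * (r₀ + r₁ * a₀)), algebraMap O K (b₁ * (r₀ + r₁ * a₁))] := by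
  obtain ⟨r₀, r₁, h⟩ := q.corner₁₀ x
  rw [hθ.f₁_mul_mul_f₀_eq hx] at h
  rw [h, hg.map_corner₁₀ hθ, corner₁₀_inj] at hx
  exact ⟨r₀, r₁, hx.symm⟩

theorem exists_corner₁₁ (hg : GeneratorCoordinates q θ p₀ p₁ a₀ a₁ b₀ b₁ h₀ h₁ π)
    (hθ : IsLatticeEmbedding O q.f₀ q.f₁ θ) {x : Γ} {h : Fin 2 → K} {d : ∀ r, F r}
    (hx : θ x = corner₁₁ h d) :
    ∃ P : Polynomial O, h = ![algebraMap O K (P.eval h₀), algebraMap O K (P.eval h₁)] ∧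
      d = fun r => Polynomial.aeval (π r) (P.map (algebraMap O K)) := by
  obtain ⟨P, -, hP⟩ := q.corner₁₁ x
  rw [hθ.f₁_mul_mul_f₁_eq hx] at hP
  rw [hP, hθ.map_aeval_mul_f₁ hg.η, corner₁₁_inj] at hx
  refine ⟨P, ?_, hx.2.symm⟩
  rw [← hx.1]
  ext i; fin_cases i <;> simp [Polynomial.aeval_algebraMap_apply]

/-- Equal coordinates would be inherited by the whole corner, so no power of 2 could bring (1, 0)
into it. The same argument separates the p's and the h's. -/
theorem a₀_ne_a₁ (hg : GeneratorCoordinates q θ p₀ p₁ a₀ a₁ b₀ b₁ h₀ h₁ π)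
    (hθ : IsLatticeEmbedding O q.f₀ q.f₁ θ) : a₀ ≠ a₁ := by
  rintro rfl
  obtain ⟨N, x, hx⟩ := hθ.dense (corner₀₁ ![1, 0])
  rw [smul_corner₀₁] at hx
  obtain ⟨r₀, r₁, h⟩ := hg.exists_corner₀₁ hθ hx
  have h0 := congrFun h 0
  have h1 := congrFun h 1
  simp only [Pi.smul_apply, Matrix.cons_val_zero, Matrix.cons_val_one, smul_eq_mul, mul_one,
    mul_zero] at h0 h1
  exact pow_ne_zero N (two_ne_zero_of_isFractionRing O K) (h0.trans h1.symm)

theorem p₀_ne_p₁ (hg : GeneratorCoordinates q θ p₀ p₁ a₀ a₁ b₀ b₁ h₀ h₁ π)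
    (hθ : IsLatticeEmbedding O q.f₀ q.f₁ θ) : p₀ ≠ p₁ := by
  rintro rfl
  obtain ⟨N, x, hx⟩ := hθ.dense (corner₀₀ ![1, 0] 0)
  rw [smul_corner₀₀] at hx
  obtain ⟨r₀, r₁, r₂, r₃, h, -⟩ := hg.exists_corner₀₀ hθ hx
  have h0 := congrFun h 0
  have h1 := congrFun h 1
  simp only [Pi.smul_apply, Matrix.cons_val_zero, Matrix.cons_val_one, smul_eq_mul, mul_one,
    mul_zero] at h0 h1
  exact pow_ne_zero N (two_ne_zero_of_isFractionRing O K) (h0.trans h1.symm)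

theorem h₀_ne_h₁ (hg : GeneratorCoordinates q θ p₀ p₁ a₀ a₁ b₀ b₁ h₀ h₁ π)
    (hθ : IsLatticeEmbedding O q.f₀ q.f₁ θ) : h₀ ≠ h₁ := by
  rintro rfl
  obtain ⟨N, x, hx⟩ := hθ.dense (corner₁₁ ![1, 0] 0)
  rw [smul_corner₁₁] at hx
  obtain ⟨P, h, -⟩ := hg.exists_corner₁₁ hθ hx
  have h0 := congrFun h 0
  have h1 := congrFun h 1
  simp only [Pi.smul_apply, Matrix.cons_val_zero, Matrix.cons_val_one, smul_eq_mul, mul_one,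
    mul_zero] at h0 h1
  exact pow_ne_zero N (two_ne_zero_of_isFractionRing O K) (h0.trans h1.symm)

/-- A power of 2 times the idempotent of the component s lies in f₁Γf₁, hence is a polynomial in η.
-/
theorem exists_separating_polynomial [DecidableEq ι]
    (hg : GeneratorCoordinates q θ p₀ p₁ a₀ a₁ b₀ b₁ h₀ h₁ π)
    (hθ : IsLatticeEmbedding O q.f₀ q.f₁ θ) {r s : ι} (hrs : r ≠ s) :
    ∃ Q : Polynomial K, Polynomial.aeval (π r) Q = 0 ∧ Polynomial.aeval (π s) Q ≠ 0 := by
  obtain ⟨N, x, hx⟩ := hθ.dense (corner₁₁ 0 (Pi.single s 1))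
  rw [smul_corner₁₁] at hx
  obtain ⟨P, -, h⟩ := hg.exists_corner₁₁ hθ hx
  refine ⟨_, (congrFun h r).symm.trans ?_, fun h0 => ?_⟩
  · simp [hrs]
  · have := (congrFun h s).trans h0
    simp only [Pi.smul_apply, Pi.single_eq_same, smul_eq_zero, one_ne_zero, or_false] at this
    exact pow_ne_zero N (two_ne_zero_of_isFractionRing O K) this

end GeneratorCoordinates

end Generators

end

/-! ### Consequences of self-duality and the standard form of a lift -/

section

set_option linter.unusedSectionVars false

open CoordinateAlgebra

/-- An embedding of an order into the coordinate algebra whose image is in standard form outside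
the corner belonging to the second idempotent. -/
structure IsStandardEmbedding (O : Type*) {K Γ : Type*} [CommRing O] [Field K] [Algebra O K] [Ring Γ]
    [Algebra O Γ] {ι : Type*} {F : ι → Type*} [∀ r, Field (F r)] [∀ r, Algebra K (F r)]
    (m : ℕ) (f₀ f₁ : Γ) (θ : Γ →+* CoordinateAlgebra K F) : Prop
    extends IsLatticeEmbedding O f₀ f₁ θ where
  mem₀₀ : ∀ a p : Fin 2 → K, (∃ x, θ x = corner₀₀ a p) ↔ ∃ x₀ x₁ x₂ x₃ : O,
    a = ![algebraMap O K x₀, algebraMap O K x₁] ∧ p = ![algebraMap O K x₂, algebraMap O K x₃] ∧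
    2 ∣ x₁ - x₀ ∧ 2 ^ (m + 1) ∣ x₂ - x₀ ∧ 2 ^ (m + 2) ∣ x₀ - x₁ - x₂ + x₃
  mem₀₁ : ∀ a : Fin 2 → K, (∃ x, θ x = corner₀₁ a) ↔ ∃ y₀ y₁ : O,
    a = ![algebraMap O K y₀, algebraMap O K y₁] ∧ 2 ∣ y₁ - y₀
  mem₁₀ : ∀ a : Fin 2 → K, (∃ x, θ x = corner₁₀ a) ↔ ∃ y₀ y₁ : O,
    a = ![algebraMap O K (2 ^ (m + 1) * y₀), algebraMap O K (2 ^ (m + 1) * y₁)] ∧ 2 ∣ y₁ - y₀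
  integral₁₁ : ∀ x (h : Fin 2 → K) (d : ∀ r, F r), θ x = corner₁₁ h d → ∃ y₀ y₁ : O,
    h = ![algebraMap O K y₀, algebraMap O K y₁] ∧ 2 ∣ y₁ - y₀

section Generators

variable {O K Γ ι : Type*} [CommRing O] [IsDomain O] [IsIntegrallyClosed O] [CharZero O] [Field K]
  [Algebra O K] [IsFractionRing O K] [Ring Γ] [Algebra O Γ] {F : ι → Type*} [∀ r, Field (F r)]
  [∀ r, Algebra K (F r)] {κ : ℕ} {c : O} {q : LiftedQuiver O κ c Γ}
  {θ : Γ →+* CoordinateAlgebra K F} {p₀ p₁ a₀ a₁ b₀ b₁ h₀ h₁ : O} {π : ∀ r, F r}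

theorem cons_algebraMap_inj {x₀ x₁ y₀ y₁ : O} :
    (![algebraMap O K x₀, algebraMap O K x₁] : Fin 2 → K) = ![algebraMap O K y₀, algebraMap O K y₁] ↔
      x₀ = y₀ ∧ x₁ = y₁ := by
  refine ⟨fun h => ⟨IsFractionRing.injective O K (congrFun h 0),
    IsFractionRing.injective O K (congrFun h 1)⟩, by rintro ⟨rfl, rfl⟩; rfl⟩

theorem cons_mul_cons {M : Type*} [Mul M] (a b c d : M) :
    (![a, b] * ![c, d] : Fin 2 → M) = ![a * c, b * d] := by
  ext i; fin_cases i <;> rfl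

namespace GeneratorCoordinates

/-- Since α³ ∈ 2Γ, the cubes of the coordinates of α are even, and 2 is prime. -/
theorem two_dvd (hg : GeneratorCoordinates q θ p₀ p₁ a₀ a₁ b₀ b₁ h₀ h₁ π)
    (hθ : IsLatticeEmbedding O q.f₀ q.f₁ θ) (h2 : Prime (2 : O)) :
    (2 ∣ p₀ ∧ 2 ∣ p₁) ∧ (2 ∣ a₀ ∧ 2 ∣ a₁) := by
  obtain ⟨y, hy⟩ := q.α_pow
  have h : q.α ^ 3 = (2 : O) • (q.f₀ * y * q.f₀) := by
    rw [← smul_mul_assoc, ← mul_smul_comm, ← hy, pow_succ, ← mul_assoc, mul_assoc _ q.α, q.α_mul_f₀,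
      pow_two, ← mul_assoc, q.f₀_mul_α]
  obtain ⟨r₀, r₁, r₂, r₃, hr⟩ := q.corner₀₀ y
  rw [hr] at h
  have h' := congrArg θ h
  rw [hθ.map_smul, hg.map_corner₀₀ hθ, pow_succ, pow_two, map_mul, map_mul, hg.α,
    corner₀₀_mul_corner₀₀, corner₀₀_mul_corner₀₀, smul_corner₀₀, corner₀₀_inj] at h'
  simp only [cons_mul_cons, Matrix.smul_cons, smul_eq_mul, ← map_mul, Matrix.smul_empty,
    cons_algebraMap_inj] at h'
  obtain ⟨⟨e1, e2⟩, e3, e4⟩ := h'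
  exact ⟨⟨h2.dvd_of_dvd_pow (n := 3) ⟨r₀ + r₁ * p₀, by linear_combination e1⟩,
    h2.dvd_of_dvd_pow (n := 3) ⟨r₀ + r₁ * p₁, by linear_combination e2⟩⟩,
    h2.dvd_of_dvd_pow (n := 3) ⟨r₀ + r₁ * a₀ + r₂ * b₀ + r₃ * (a₀ * b₀),
      by linear_combination e3⟩,
    h2.dvd_of_dvd_pow (n := 3) ⟨r₀ + r₁ * a₁ + r₂ * b₁ + r₃ * (a₁ * b₁),
      by linear_combination e4⟩⟩

/-- With β = (1, 1), the pair (h₀, h₁) consists of the coordinates of βη, which lies in twice the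
corner spanned by β and αβ. -/
theorem exists_h_eq (hg : GeneratorCoordinates q θ p₀ p₁ a₀ a₁ b₀ b₁ h₀ h₁ π)
    (hθ : IsLatticeEmbedding O q.f₀ q.f₁ θ) :
    ∃ s t : O, h₀ = 2 * (s + t * a₀) ∧ h₁ = 2 * (s + t * a₁) := by
  obtain ⟨y, hy⟩ := q.β_mul_η
  have h : q.β * q.η = (2 : O) • (q.f₀ * y * q.f₁) := by
    rw [← smul_mul_assoc, ← mul_smul_comm, ← hy, ← mul_assoc, q.f₀_mul_β, mul_assoc, q.η_mul_f₁]
  obtain ⟨s, t, hr⟩ := q.corner₀₁ y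
  rw [hr] at h
  have h' := congrArg θ h
  rw [hθ.map_smul, hg.map_corner₀₁ hθ, map_mul, hg.β, hg.η, corner₀₁_mul_corner₁₁, one_mul,
    smul_corner₀₁, corner₀₁_inj] at h'
  simp only [Matrix.smul_cons, smul_eq_mul, ← map_mul, Matrix.smul_empty, cons_algebraMap_inj] at h'
  exact ⟨s, t, h'⟩

theorem exists_relation (hg : GeneratorCoordinates q θ p₀ p₁ a₀ a₁ b₀ b₁ h₀ h₁ π)
    (hθ : IsLatticeEmbedding O q.f₀ q.f₁ θ) :
    ∃ s t : O, (a₀ - p₀) * (a₀ - p₁) = s * b₀ + t * (a₀ * b₀) ∧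
      (a₁ - p₀) * (a₁ - p₁) = s * b₁ + t * (a₁ * b₁) ∧ 2 ∣ s ∧ 2 ∣ t - c := by
  obtain ⟨y, hy⟩ := q.α_mul_α
  have h : q.α * q.α = c • (q.α * q.β * q.γ) + (2 : O) • (q.f₀ * y * q.f₀) := by
    have h0 : (2 : O) • (q.f₀ * y * q.f₀) = q.f₀ * ((2 : O) • y) * q.f₀ := by
      rw [mul_smul_comm, smul_mul_assoc]
    have h1 : q.f₀ * (q.α * q.α) * q.f₀ = q.α * q.α := by
      rw [← mul_assoc, q.f₀_mul_α, mul_assoc, q.α_mul_f₀]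
    have h2 : q.f₀ * (q.α * q.β * q.γ) * q.f₀ = q.α * q.β * q.γ := by
      rw [← mul_assoc, ← mul_assoc, q.f₀_mul_α, mul_assoc _ q.γ, q.γ_mul_f₀]
    rw [h0, ← hy, mul_sub, sub_mul, mul_smul_comm, smul_mul_assoc, h1, h2, add_sub_cancel]
  obtain ⟨r₀, r₁, r₂, r₃, hr⟩ := q.corner₀₀ y
  have h3 : c • (q.α * q.β * q.γ) + (2 : O) • (q.f₀ * y * q.f₀) = (2 * r₀) • q.f₀ +
      (2 * r₁) • q.α + (2 * r₂) • (q.β * q.γ) + (c + 2 * r₃) • (q.α * q.β * q.γ) := by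
    rw [hr]; module
  rw [h3] at h
  have h' := congrArg θ h
  rw [hg.map_corner₀₀ hθ, map_mul, hg.α, corner₀₀_mul_corner₀₀, corner₀₀_inj] at h'
  simp only [cons_mul_cons, ← map_mul, cons_algebraMap_inj] at h'
  obtain ⟨⟨e1, e2⟩, e3, e4⟩ := h'
  -- In the two components K the relation reads pᵢ² = 2r₀ + 2r₁pᵢ. As p₀ ≠ p₁, these are the two
  -- roots, so X² - 2r₁X - 2r₀ = (X - p₀)(X - p₁). Evaluating it at a₀ and a₁ gives the claim.
  have e5 : p₀ + p₁ = 2 * r₁ := by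
    apply mul_left_cancel₀ (sub_ne_zero.2 (hg.p₀_ne_p₁ hθ))
    linear_combination e1 - e2
  refine ⟨2 * r₂, c + 2 * r₃, ?_, ?_, ⟨_, rfl⟩, ⟨r₃, by ring⟩⟩
  · linear_combination e3 - e1 + (p₀ - a₀) * e5
  · linear_combination e4 - e1 + (p₀ - a₁) * e5

end GeneratorCoordinates

variable [Fintype ι] {u₁ u₂ u₃ : K} {ε₁ ε₂ : O} {m : ℕ}

theorem exists_eq_of_form (hu₂ : (2 : K) ^ m * u₂ = algebraMap O K ε₂) {b : O} {t : O}
    (ht : algebraMap O K t = u₂ * algebraMap O K b) : ε₂ * b = 2 ^ m * t := by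
  apply IsFractionRing.injective O K
  simp only [map_mul, map_pow, map_ofNat, ← hu₂, ht]
  ring

namespace GeneratorCoordinates

theorem exists_form_βγ (hg : GeneratorCoordinates q θ p₀ p₁ a₀ a₁ b₀ b₁ h₀ h₁ π)
    (hθ : IsSelfDualEmbedding O u₁ u₂ u₃ q.f₀ q.f₁ θ) (r₀ r₁ : O) :
    ∃ t, algebraMap O K t = u₂ * algebraMap O K ((r₀ * b₀ + r₁ * (a₀ * b₀)) +
      (r₀ * b₁ + r₁ * (a₁ * b₁))) := by
  obtain ⟨t, ht⟩ := hθ.form_mem ((0 : O) • q.f₀ + (0 : O) • q.α + r₀ • (q.β * q.γ) +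
    r₁ • (q.α * q.β * q.γ))
  refine ⟨t, ht.trans ?_⟩
  rw [hg.map_corner₀₀ hθ.toIsLatticeEmbedding, form_corner₀₀]
  simp

/-- If T_u(αβγ) were even, αβ/2 would pair integrally with γ and γα, so self-duality would put it
into Γ. But an element of f₀Γf₁ is an integral combination of β and αβ, and a₀ ≠ a₁ makes the
coefficients unique. -/
theorem not_two_dvd_form_αβγ (hg : GeneratorCoordinates q θ p₀ p₁ a₀ a₁ b₀ b₁ h₀ h₁ π)
    (hθ : IsSelfDualEmbedding O u₁ u₂ u₃ q.f₀ q.f₁ θ) (h2 : Prime (2 : O)) {t₁ : O}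
    (ht₁ : algebraMap O K t₁ = u₂ * algebraMap O K (a₀ * b₀ + a₁ * b₁)) : ¬ 2 ∣ t₁ := by
  rintro ⟨t, rfl⟩
  have hθ' := hθ.toIsLatticeEmbedding
  have hK := two_ne_zero_of_isFractionRing O K
  obtain ⟨t₀, ht₀⟩ := hg.exists_form_βγ hθ 1 0
  obtain ⟨-, ⟨a₀', rfl⟩, ⟨a₁', rfl⟩⟩ := hg.two_dvd hθ' h2
  obtain ⟨x, hx⟩ := hθ.mem_of_form (corner₀₁ ![algebraMap O K a₀', algebraMap O K a₁']) (by
    intro x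
    obtain ⟨r₀, r₁, hr⟩ := hg.exists_corner₁₀ hθ' (hθ'.map_f₁_mul_mul_f₀ x)
    -- The coefficient of r₁ is T_u(α²βγ)/2, computed from aᵢ² = (a₀ + a₁)aᵢ - a₀a₁ with aᵢ = 2aᵢ'.
    refine ⟨r₀ * t + r₁ * ((2 * a₀' + 2 * a₁') * t - 2 * a₀' * a₁' * t₀), ?_⟩
    rw [form_corner₀₁_mul, congrFun hr 0, congrFun hr 1]
    apply mul_left_cancel₀ hK
    simp only [Matrix.cons_val_zero, Matrix.cons_val_one, map_add, map_mul, map_sub, map_ofNat,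
      map_one, map_zero] at ht₁ ht₀ ⊢
    linear_combination (algebraMap O K r₀ + algebraMap O K r₁ * (2 * algebraMap O K a₀' +
      2 * algebraMap O K a₁')) * ht₁ - 4 * algebraMap O K r₁ * algebraMap O K a₀' *
      algebraMap O K a₁' * ht₀)
  obtain ⟨r₀, r₁, hr⟩ := hg.exists_corner₀₁ hθ' hx
  rw [cons_algebraMap_inj] at hr
  have hne := hg.a₀_ne_a₁ hθ'
  apply h2.not_isUnit
  refine IsUnit.of_mul_eq_one r₁ ?_
  apply mul_left_cancel₀ (sub_ne_zero.2 hne)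
  linear_combination 2 * hr.2 - 2 * hr.1

/-- A dual element concentrated in the matrix components of f₁Γf₁ is a polynomial P in η that
vanishes at every π r. This makes P(h₀) divisible by 2^m, whereas self-duality fixes its value as
1/(u₂(h₁ - h₀)). The difference h₁ - h₀ can therefore be divisible by no more than 4. -/
theorem not_two_dvd_difference (hg : GeneratorCoordinates q θ p₀ p₁ a₀ a₁ b₀ b₁ h₀ h₁ π)
    [Module.Finite O Γ]
    (hθ : IsSelfDualEmbedding O u₁ u₂ u₃ q.f₀ q.f₁ θ) (h2 : Prime (2 : O))
    (hunit : ∀ x : O, ¬ 2 ∣ x → IsUnit x) (hm : Fintype.card ι = m)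
    (hu₂ : (2 : K) ^ (m + 2) * u₂ = algebraMap O K ε₂) (hε₂ : IsUnit ε₂) {w : O}
    (hw : a₁ - a₀ = 2 * w) : ¬ 2 ∣ w := by
  classical
  have hθ' := hθ.toIsLatticeEmbedding
  have hK := two_ne_zero_of_isFractionRing O K
  obtain ⟨s, t, hh₀, hh₁⟩ := hg.exists_h_eq hθ'
  have hinj := IsFractionRing.injective O K
  have hu₂0 : u₂ ≠ 0 := by
    rintro rfl
    rw [mul_zero, eq_comm, map_eq_zero_iff _ hinj] at hu₂
    exact hε₂.ne_zero hu₂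
  have hσ : algebraMap O K (h₁ - h₀) ≠ 0 := by
    rw [Ne, map_eq_zero_iff _ hinj, sub_eq_zero]
    exact (hg.h₀_ne_h₁ hθ').symm
  -- Pairing this element with a polynomial P in η gives minus the divided difference (P(h₁) -
  -- P(h₀))/(h₁ - h₀), which is integral.
  obtain ⟨x, hx⟩ := hθ.mem_of_form (corner₁₁ ![(u₂ * algebraMap O K (h₁ - h₀))⁻¹,
      -(u₂ * algebraMap O K (h₁ - h₀))⁻¹] 0) (by
    intro x
    obtain ⟨P, hP, -⟩ := hg.exists_corner₁₁ hθ' (hθ'.map_f₁_mul_mul_f₁ x)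
    obtain ⟨z, hz⟩ := P.sub_dvd_eval_sub h₁ h₀
    refine ⟨-z, ?_⟩
    rw [form_corner₁₁_mul, congrFun hP 0, congrFun hP 1]
    have hz' := congrArg (algebraMap O K) hz
    rw [map_sub, map_mul] at hz'
    simp only [Matrix.cons_val_zero, Matrix.cons_val_one, map_neg]
    field_simp
    linear_combination hz')
  obtain ⟨P, hP, hP'⟩ := hg.exists_corner₁₁ hθ' hx
  obtain ⟨y, hy⟩ := q.η_pow
  have hηint := (hθ'.isIntegral_corner₁₁ hg.η).2
  have hyint := (hθ'.isIntegral_corner₁₁ (hθ'.map_f₁_mul_mul_f₁ y)).2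
  have hk : ∀ r, π r ^ (κ + 1) = 2 * (θ y).2.2 r := by
    have h := congrArg θ hy
    rw [hθ'.map_smul, map_pow, hg.η] at h
    intro r
    have h' := congrFun (congrArg (fun x => x.2.2) h) r
    have h2F : algebraMap K (F r) (algebraMap O K 2) = 2 := by rw [map_ofNat, map_ofNat]
    rw [← h2F, ← Algebra.smul_def]
    exact h'
  obtain ⟨z, hz⟩ := two_pow_card_dvd_eval hunit h2.not_isUnit hyint hk hηint
    (fun r s hrs => hg.exists_separating_polynomial hθ' hrs)
    (fun r => (congrFun hP' r).symm) (h := h₀) ⟨_, hh₀⟩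
  have h3 := congrFun hP 0
  simp only [Matrix.cons_val_zero] at h3
  replace h3 : u₂ * algebraMap O K (h₁ - h₀) * algebraMap O K (2 ^ m * z) = 1 := by
    rw [← hm, ← hz, ← h3, mul_inv_cancel₀ (mul_ne_zero hu₂0 hσ)]
  have h4 : ε₂ * (h₁ - h₀) * z = 4 := by
    apply mul_left_cancel₀ (pow_ne_zero m h2.ne_zero)
    apply hinj
    simp only [map_mul, map_pow, map_ofNat, ← hu₂] at h3 ⊢
    linear_combination 2 ^ (m + 2) * h3
  have h5 : w * (ε₂ * t * z) = 1 := by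
    apply mul_left_cancel₀ h2.ne_zero
    apply mul_left_cancel₀ h2.ne_zero
    rw [hh₀, hh₁] at h4
    linear_combination h4 - 2 * ε₂ * t * z * hw
  intro hdvd
  exact h2.not_isUnit (isUnit_of_dvd_one (hdvd.trans ⟨_, h5.symm⟩))

/-- The standard form of a lift, under the congruences that its coordinates satisfy up to
a permutation of the components. -/
theorem isStandardEmbedding (hg : GeneratorCoordinates q θ p₀ p₁ a₀ a₁ b₀ b₁ h₀ h₁ π)
    (hθ : IsLatticeEmbedding O q.f₀ q.f₁ θ) (h2 : Prime (2 : O))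
    (hunit : ∀ x : O, ¬ 2 ∣ x → IsUnit x) (hε₂ : IsUnit ε₂) {w t₀ t₁ : O}
    (hw : a₁ - a₀ = 2 * w) (hw2 : ¬ 2 ∣ w) (ht₁ : ¬ 2 ∣ t₁)
    (ht : ε₂ * (b₀ + b₁) = 2 ^ (m + 2) * t₀) (ht' : ε₂ * (a₀ * b₀ + a₁ * b₁) = 2 ^ (m + 2) * t₁)
    (hsum : 2 ^ (m + 2) ∣ a₀ + a₁ - p₀ - p₁) (hdiff : 2 ^ (m + 1) ∣ a₀ - p₀) :
    IsStandardEmbedding O m q.f₀ q.f₁ θ := by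
  obtain ⟨-, ha₀, ha₁⟩ := hg.two_dvd hθ h2
  have hpow : ∀ k : ℕ, (2 : O) ^ k ≠ 0 := fun k => pow_ne_zero k h2.ne_zero
  obtain ⟨S, hS⟩ := hsum
  obtain ⟨A, hA⟩ := hdiff
  obtain ⟨ν, hν⟩ := hε₂.exists_right_inv
  obtain ⟨w', hw'⟩ := (hunit w hw2).exists_right_inv
  -- Cramer's rule applied to `ht` and `ht'` gives b₀ = 2^(m+1)ω. Here ω is odd because t₁ is odd
  -- and a₁ is even; the companion ω₁ for b₁ is odd because it is congruent to -ω modulo 2.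
  obtain ⟨ω, hω⟩ : ∃ ω, ω = w' * ν * (a₁ * t₀ - t₁) := ⟨_, rfl⟩
  have hb₀ : b₀ = 2 ^ (m + 1) * ω := by
    have h : w * ε₂ * b₀ = 2 ^ (m + 1) * (a₁ * t₀ - t₁) := by
      apply mul_left_cancel₀ h2.ne_zero
      linear_combination a₁ * ht - ht' - ε₂ * b₀ * hw
    linear_combination w' * ν * h - 2 ^ (m + 1) * hω + (-b₀ * ε₂ * ν) * hw' - b₀ * hν
  obtain ⟨ω₁, hω₁⟩ : ∃ ω₁, ω₁ = 2 * (ν * t₀) - ω := ⟨_, rfl⟩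
  have hb₁ : b₁ = 2 ^ (m + 1) * ω₁ := by
    linear_combination ν * ht - 2 ^ (m + 1) * hω₁ - (b₀ + b₁) * hν - hb₀
  have hω2 : ¬ 2 ∣ ω := by
    intro h
    apply ht₁
    have h6 : w * ε₂ * ω = a₁ * t₀ - t₁ := by
      linear_combination (w * ε₂) * hω + (a₁ * t₀ - t₁) * (ν * ε₂ * hw' + hν)
    have h7 : t₁ = a₁ * t₀ - w * ε₂ * ω := by linear_combination h6
    rw [h7]
    exact dvd_sub (ha₁.mul_right _) (h.mul_left _)
  have hω₁2 : ¬ 2 ∣ ω₁ := by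
    rw [hω₁]
    intro h
    exact hω2 ((dvd_sub_right (dvd_mul_right 2 _)).1 h)
  obtain ⟨v, hv⟩ := (hunit ω hω2).exists_right_inv
  obtain ⟨v₁, hv₁⟩ := (hunit ω₁ hω₁2).exists_right_inv
  -- By the two congruences p₁ - p₀ agrees with a₁ - a₀ modulo 2^(m+2), so its half is odd like w.
  obtain ⟨q', hq'⟩ : ∃ q', q' = w + 2 ^ (m + 1) * (A - S) := ⟨_, rfl⟩
  have hp : p₁ - p₀ = 2 * q' := by linear_combination hw + 2 * hA - hS - 2 * hq'
  have hq2 : ¬ 2 ∣ q' := by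
    rw [hq']
    intro h
    refine hw2 ((dvd_add_left ?_).1 h)
    exact (dvd_pow_self 2 (Nat.succ_ne_zero m)).mul_right _
  obtain ⟨q'', hq''⟩ := (hunit q' hq2).exists_right_inv
  obtain ⟨s, t, hh₀, hh₁⟩ := hg.exists_h_eq hθ
  obtain ⟨a₀', ha₀'⟩ := ha₀
  refine { toIsLatticeEmbedding := hθ, mem₀₀ := ?_, mem₀₁ := ?_, mem₁₀ := ?_, integral₁₁ := ?_ }
  · intro a p
    constructor
    · rintro ⟨x, hx⟩
      obtain ⟨r₀, r₁, r₂, r₃, rfl, rfl⟩ := hg.exists_corner₀₀ hθ hx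
      refine ⟨_, _, _, _, rfl, rfl, ⟨r₁ * q', ?_⟩, ⟨r₁ * A + (r₂ + r₃ * a₀) * ω, ?_⟩,
        ⟨r₁ * (S - A) + r₂ * (ν * t₀ - ω) + r₃ * (ω₁ * w + a₀' * (ω₁ - ω)), ?_⟩⟩
      · linear_combination r₁ * hp
      · linear_combination r₁ * hA + (r₂ + r₃ * a₀) * hb₀
      · linear_combination r₁ * hS - 2 * r₁ * hA + (-r₂ - r₃ * a₀) * hb₀ + (r₂ + r₃ * a₁) * hb₁ +
          2 ^ (m + 1) * r₂ * hω₁ + r₃ * 2 ^ (m + 1) * ω₁ * hw +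
          r₃ * 2 ^ (m + 1) * (ω₁ - ω) * ha₀'
    · rintro ⟨x₀, x₁, x₂, x₃, rfl, rfl, ⟨y, hy⟩, ⟨z, hz⟩, ⟨k, hk⟩⟩
      -- The coefficient r₁ is determined by the components K. The numbers g₀ and g₁ are the values
      -- that r₂ + r₃a₀ and r₂ + r₃a₁ must then take in the matrix components.
      obtain ⟨r₁, hr₁⟩ : ∃ r₁, r₁ = y * q'' := ⟨_, rfl⟩
      obtain ⟨g₀, hg₀⟩ : ∃ g₀, g₀ = v * (z - r₁ * A) := ⟨_, rfl⟩
      obtain ⟨g₁, hg₁⟩ : ∃ g₁, g₁ = v₁ * (z - r₁ * A + 2 * (k - r₁ * (S - A))) := ⟨_, rfl⟩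
      -- Since a₁ - a₀ = 2w with w a unit, two prescribed values can be interpolated by r₂ + r₃X
      -- exactly when they agree modulo 2.
      obtain ⟨d, hd⟩ : 2 ∣ g₁ - g₀ := by
        have hu : IsUnit (ω * ω₁) := (hunit ω hω2).mul (hunit ω₁ hω₁2)
        refine hu.dvd_mul_left.1 (?_ : 2 ∣ ω * ω₁ * (g₁ - g₀))
        refine ⟨ω * (k - r₁ * (S - A)) + (z - r₁ * A) * (ω - ν * t₀), ?_⟩
        rw [hg₁, hg₀]
        linear_combination ω * (z - r₁ * A + 2 * (k - r₁ * (S - A))) * hv₁ -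
          ω₁ * (z - r₁ * A) * hv - (z - r₁ * A) * hω₁
      refine ⟨_, (hg.map_corner₀₀ hθ (x₀ - r₁ * p₀) r₁ (g₀ - w' * d * a₀) (w' * d)).trans ?_⟩
      rw [corner₀₀_inj, cons_algebraMap_inj, cons_algebraMap_inj]
      have e1 : 2 ^ (m + 1) * ω * g₀ = x₂ - x₀ - r₁ * (a₀ - p₀) := by
        rw [hg₀]
        linear_combination 2 ^ (m + 1) * (z - r₁ * A) * hv - hz + r₁ * hA
      have e0 : r₁ * (p₁ - p₀) = x₁ - x₀ := by
        rw [hr₁]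
        linear_combination y * q'' * hp + 2 * y * hq'' - hy
      have e2 : 2 ^ (m + 1) * ω₁ * g₁ = x₃ - x₀ - r₁ * (a₁ - p₀) := by
        rw [hg₁]
        linear_combination 2 ^ (m + 1) * (z - r₁ * A + 2 * (k - r₁ * (S - A))) * hv₁ -
          hz - hk + r₁ * hS - r₁ * hA + e0
      refine ⟨⟨by ring, by linear_combination e0⟩, ?_, ?_⟩
      · linear_combination e1 + g₀ * hb₀
      · linear_combination e2 + (g₁) * hb₁ + (b₁ * w' * d) * hw + 2 * b₁ * d * hw' - b₁ * hd
  · intro a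
    constructor
    · rintro ⟨x, hx⟩
      obtain ⟨r₀, r₁, rfl⟩ := hg.exists_corner₀₁ hθ hx
      exact ⟨_, _, rfl, r₁ * w, by linear_combination r₁ * hw⟩
    · rintro ⟨y₀, y₁, rfl, y, hy⟩
      refine ⟨_, (hg.map_corner₀₁ hθ (y₀ - w' * y * a₀) (w' * y)).trans ?_⟩
      rw [corner₀₁_inj, cons_algebraMap_inj]
      exact ⟨by ring, by linear_combination w' * y * hw + 2 * y * hw' - hy⟩
  · intro a
    constructor
    · rintro ⟨x, hx⟩
      obtain ⟨r₀, r₁, rfl⟩ := hg.exists_corner₁₀ hθ hx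
      refine ⟨ω * (r₀ + r₁ * a₀), ω₁ * (r₀ + r₁ * a₁), ?_, ?_⟩
      · rw [cons_algebraMap_inj]
        exact ⟨by linear_combination (r₀ + r₁ * a₀) * hb₀,
          by linear_combination (r₀ + r₁ * a₁) * hb₁⟩
      · refine ⟨ω₁ * r₁ * w + (r₀ + r₁ * a₀) * (ν * t₀ - ω), ?_⟩
        linear_combination ω₁ * r₁ * hw + (r₀ + r₁ * a₀) * hω₁
    · rintro ⟨y₀, y₁, rfl, y, hy⟩
      obtain ⟨d, hd⟩ : 2 ∣ v₁ * y₁ - v * y₀ := by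
        have hu : IsUnit (ω * ω₁) := (hunit ω hω2).mul (hunit ω₁ hω₁2)
        refine hu.dvd_mul_left.1 (?_ : 2 ∣ ω * ω₁ * (v₁ * y₁ - v * y₀))
        refine ⟨ω * y + y₀ * (ω - ν * t₀), ?_⟩
        linear_combination ω * y₁ * hv₁ - ω₁ * y₀ * hv + ω * hy - y₀ * hω₁
      refine ⟨_, (hg.map_corner₁₀ hθ (v * y₀ - w' * d * a₀) (w' * d)).trans ?_⟩
      rw [corner₁₀_inj, cons_algebraMap_inj]
      refine ⟨?_, ?_⟩
      · linear_combination v * y₀ * hb₀ + 2 ^ (m + 1) * y₀ * hv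
      · linear_combination (b₁ * w' * d) * hw + 2 * b₁ * d * hw' - b₁ * hd + v₁ * y₁ * hb₁ +
          2 ^ (m + 1) * y₁ * hv₁
  -- A polynomial takes values at h₀ and h₁ whose difference is divisible by h₁ - h₀, which is even.
  · intro x h d hx
    obtain ⟨P, hP, -⟩ := hg.exists_corner₁₁ hθ hx
    refine ⟨_, _, hP, dvd_trans ⟨t * (a₁ - a₀), ?_⟩ (P.sub_dvd_eval_sub h₁ h₀)⟩
    rw [hh₀, hh₁]; ring

end GeneratorCoordinates

/-- Every self-dual lift has `c = 0` modulo `2` and can be brought into standard form. -/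
theorem IsSelfDualEmbedding.exists_isStandardEmbedding [Module.Finite O Γ]
    (hθ : IsSelfDualEmbedding O u₁ u₂ u₃ q.f₀ q.f₁ θ) (h2 : Prime (2 : O))
    (hunit : ∀ x : O, ¬ 2 ∣ x → IsUnit x) (hm : Fintype.card ι = m)
    (hu₁ : (2 : K) ^ (m + 2) * u₁ = algebraMap O K ε₁)
    (hu₂ : (2 : K) ^ (m + 2) * u₂ = algebraMap O K ε₂) (hε₂ : IsUnit ε₂) :
    2 ∣ c ∧ ∃ θ' : Γ →+* CoordinateAlgebra K F, IsStandardEmbedding O m q.f₀ q.f₁ θ' := by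
  obtain ⟨b, hb⟩ := hθ.toIsLatticeEmbedding.exists_scale
  have hη := hθ.comp (scale b) (scale_smul b) (scale_corner₀₀ b 1 1) (form_scale u₁ u₂ u₃ b)
  set η := (scale b).toRingHom.comp θ
  have hη' := hη.toIsLatticeEmbedding
  obtain ⟨p₀, p₁, a₀, a₁, b₀, b₁, h₀, h₁, π, hg⟩ := hη'.exists_generatorCoordinates hb
  obtain ⟨⟨hp₀, hp₁⟩, ha₀, ha₁⟩ := hg.two_dvd hη' h2
  obtain ⟨w, hw⟩ : 2 ∣ a₁ - a₀ := dvd_sub ha₁ ha₀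
  have hw2 := hg.not_two_dvd_difference hη h2 hunit hm hu₂ hε₂ hw
  obtain ⟨t₀, ht₀⟩ := hg.exists_form_βγ hη 1 0
  obtain ⟨t₁, ht₁⟩ := hg.exists_form_βγ hη 0 1
  have e₀ : ε₂ * (b₀ + b₁) = 2 ^ (m + 2) * t₀ := by
    have := exists_eq_of_form hu₂ ht₀
    linear_combination this
  have e₁ : ε₂ * (a₀ * b₀ + a₁ * b₁) = 2 ^ (m + 2) * t₁ := by
    have := exists_eq_of_form hu₂ ht₁
    linear_combination this
  have ht₁2 : ¬ 2 ∣ t₁ := hg.not_two_dvd_form_αβγ hη h2 (by rw [ht₁]; congr 2; ring)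
  obtain ⟨s, t, hr₀, hr₁, hs, htc⟩ := hg.exists_relation hη'
  obtain ⟨e, he⟩ := hη.form_mem q.f₀
  obtain ⟨f, hf⟩ := hη.form_mem q.α
  rw [hη'.map_f₀, form_corner₀₀] at he
  rw [hg.α, form_corner₀₀] at hf
  -- The form takes the value 2(u₁ + u₂) at f₀, so one power of 2 is lost compared with the other
  -- traces.
  have he' : ε₁ + ε₂ = 2 ^ (m + 1) * e := by
    apply mul_left_cancel₀ h2.ne_zero
    apply IsFractionRing.injective O K
    simp only [map_mul, map_add, map_pow, map_ofNat, ← hu₁, ← hu₂, he, Pi.one_apply]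
    ring
  have hf' : ε₁ * (p₀ + p₁) + ε₂ * (a₀ + a₁) = 2 ^ (m + 2) * f := by
    apply IsFractionRing.injective O K
    simp only [map_mul, map_add, map_pow, map_ofNat, ← hu₁, ← hu₂, hf, Matrix.cons_val_zero,
      Matrix.cons_val_one]
    ring
  obtain ⟨ht, hsum, hdiff⟩ := dvd_of_generator_congruences h2 hunit hε₂ hw2 ht₁2 hp₀ hp₁ ha₀ hs hw
    he' hf' e₀ e₁ hr₀ hr₁
  refine ⟨(dvd_sub_right ht).1 htc, ?_⟩
  rcases hdiff with hd | hd
  · exact ⟨η, hg.isStandardEmbedding hη' h2 hunit hε₂ hw hw2 ht₁2 e₀ e₁ hsum hd⟩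
  -- If a₀ is close to p₁ instead of p₀, only the two components K are interchanged. The remaining
  -- congruence is symmetric in p₀ and p₁.
  · refine ⟨(permute (Equiv.swap 0 1) 1).toRingHom.comp η, ?_⟩
    have hg' : GeneratorCoordinates q
        ((permute (Equiv.swap 0 1) 1 : CoordinateAlgebra K F ≃+* _).toRingHom.comp η)
        p₁ p₀ a₀ a₁ b₀ b₁ h₀ h₁ π := by
      refine ⟨?_, ?_, ?_, ?_⟩
      · simp only [RingHom.comp_apply, hg.α]
        refine (permute_corner₀₀ _ _ _ _).trans ?_
        congr 1
        ext i; fin_cases i <;> simp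
      · simp only [RingHom.comp_apply, hg.β]
        rfl
      · simp only [RingHom.comp_apply, hg.γ]
        rfl
      · simp only [RingHom.comp_apply, hg.η]
        rfl
    refine hg'.isStandardEmbedding (hη'.comp _ (permute_smul _ _) rfl) h2 hunit hε₂ hw hw2 ht₁2
      e₀ e₁ ?_ hd
    rwa [sub_right_comm]

end Generators

end

/-! ### Centers in coordinates and reconstruction of the order -/

section

set_option linter.unusedSectionVars false

open CoordinateAlgebra

section Center

variable {O K Γ ι : Type*} [CommRing O] [CharZero O] [Field K]
  [Algebra O K] [IsFractionRing O K] [Ring Γ] [Algebra O Γ] {F : ι → Type*} [∀ r, Field (F r)]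
  [∀ r, Algebra K (F r)] {θ : Γ →+* CoordinateAlgebra K F} {f₀ f₁ : Γ}

namespace IsLatticeEmbedding

theorem commute_of_mem_center (hθ : IsLatticeEmbedding O f₀ f₁ θ) {x : Γ}
    (hx : x ∈ Subalgebra.center O Γ) (y : CoordinateAlgebra K F) : y * θ x = θ x * y := by
  obtain ⟨N, x', hx'⟩ := hθ.dense y
  have h := congrArg θ (Subalgebra.mem_center_iff.1 hx x')
  rw [map_mul, map_mul, hx', smul_mul_assoc, mul_smul_comm] at h
  exact smul_right_injective _ (pow_ne_zero N (two_ne_zero_of_isFractionRing O K)) h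

theorem map_mem_center (hθ : IsLatticeEmbedding O f₀ f₁ θ) {x : Γ}
    (hx : x ∈ Subalgebra.center O Γ) (s : Fin 2) : (θ x).2.1 s = (θ x).2.1 s 1 1 • 1 := by
  have h₁ := congrFun (congrArg (fun y => y.2.1) (hθ.commute_of_mem_center hx (corner₀₁ 1))) s
  have h₂ := congrFun (congrArg (fun y => y.2.1) (hθ.commute_of_mem_center hx (corner₁₀ 1))) s
  simp only [corner₀₁, corner₁₀, Prod.snd_mul, Prod.fst_mul, Pi.mul_apply] at h₁ h₂
  have e₁ := congrFun (congrFun h₁ 0) 0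
  have e₂ := congrFun (congrFun h₁ 0) 1
  have e₃ := congrFun (congrFun h₂ 0) 0
  simp [Matrix.mul_apply] at e₁ e₂ e₃
  ext i j
  fin_cases i <;> fin_cases j <;> simp [e₁, e₂, ← e₃]

theorem mem_center (hθ : IsLatticeEmbedding O f₀ f₁ θ) {x : Γ} {h : Fin 2 → K}
    (hx : ∀ s, (θ x).2.1 s = h s • 1) : x ∈ Subalgebra.center O Γ := by
  refine Subalgebra.mem_center_iff.2 fun y => hθ.injective ?_
  rw [map_mul, map_mul]
  refine Prod.ext (mul_comm _ _) (Prod.ext ?_ (mul_comm _ _))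
  ext1 s
  simp [hx s]

theorem exists_center (hθ : IsLatticeEmbedding O f₀ f₁ θ) (a h : Fin 2 → K) (d : ∀ r, F r) :
    ∃ (N : ℕ) (z : Subalgebra.center O Γ),
      θ z = (2 : K) ^ N • ((a, fun s => h s • 1, d) : CoordinateAlgebra K F) := by
  obtain ⟨N, x, hx⟩ := hθ.dense (a, fun s => h s • 1, d)
  refine ⟨N, ⟨x, hθ.mem_center (h := fun s => (2 : K) ^ N * h s) fun s => ?_⟩, hx⟩
  rw [hx]
  simp [mul_smul]

theorem mul_f₀_eq_zero_iff (hθ : IsLatticeEmbedding O f₀ f₁ θ) (z : Subalgebra.center O Γ) :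
    (z : Γ) * f₀ = 0 ↔ (θ z).1 = 0 ∧ ∀ s, (θ z).2.1 s 1 1 = 0 := by
  rw [← map_eq_zero_iff θ hθ.injective, map_mul, hθ.map_f₀]
  constructor
  · intro h
    refine ⟨by simpa [corner₀₀] using congrArg Prod.fst h, fun s => ?_⟩
    have h' := congrFun (congrArg (fun y => y.2.1) h) s
    simp only [corner₀₀, Prod.snd_mul, Prod.fst_mul, Pi.mul_apply] at h'
    rw [hθ.map_mem_center z.2 s] at h'
    simpa using congrFun (congrFun h' 0) 0
  · rintro ⟨h, h'⟩
    refine Prod.ext (by simp [h]) (Prod.ext ?_ (mul_zero _))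
    ext1 s
    simp only [Prod.snd_mul, Prod.fst_mul, Pi.mul_apply]
    rw [hθ.map_mem_center z.2 s, h' s]
    simp

theorem map_mul_f₁ (hθ : IsLatticeEmbedding O f₀ f₁ θ) (z : Subalgebra.center O Γ) :
    θ ((z : Γ) * f₁) = corner₁₁ (fun s => (θ z).2.1 s 1 1) (θ z).2.2 := by
  rw [map_mul, hθ.map_f₁]
  refine Prod.ext (mul_zero _) (Prod.ext ?_ (mul_one _))
  ext1 s
  simp only [Prod.snd_mul, Prod.fst_mul, Pi.mul_apply]
  rw [hθ.map_mem_center z.2 s]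
  ext i j
  fin_cases i <;> fin_cases j <;> simp [corner₁₁]

theorem mul_f₁_eq_zero_iff (hθ : IsLatticeEmbedding O f₀ f₁ θ) (z : Subalgebra.center O Γ) :
    (z : Γ) * f₁ = 0 ↔ (∀ s, (θ z).2.1 s 1 1 = 0) ∧ (θ z).2.2 = 0 := by
  rw [← map_eq_zero_iff θ hθ.injective, hθ.map_mul_f₁]
  have h : (0 : CoordinateAlgebra K F) = corner₁₁ 0 0 := by
    refine Prod.ext rfl (Prod.ext ?_ rfl)
    ext s i j
    fin_cases i <;> fin_cases j <;> simp [corner₁₁]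
  rw [h, corner₁₁_inj]
  simp only [funext_iff, Pi.zero_apply]

/-- The central elements with vanishing coordinates in the components `M₂(K)` are, up to powers of
two, the sums of central elements annihilating one of the idempotents. -/
theorem forall_eq_zero_iff (hθ : IsLatticeEmbedding O f₀ f₁ θ) (z : Subalgebra.center O Γ) :
    (∀ s, (θ z).2.1 s 1 1 = 0) ↔ ∃ (N : ℕ) (x y : Subalgebra.center O Γ),
      (x : Γ) * f₀ = 0 ∧ (y : Γ) * f₁ = 0 ∧ (2 : O) ^ N • z = x + y := by
  constructor
  · intro h
    obtain ⟨N, y, hy⟩ := hθ.exists_center (θ z).1 0 0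
    refine ⟨N, (2 : O) ^ N • z - y, y, ?_, ?_, by abel⟩
    · rw [hθ.mul_f₀_eq_zero_iff]
      simp only [AddSubgroupClass.coe_sub, Subalgebra.coe_smul, map_sub, hθ.map_smul, map_pow, map_ofNat,
        hy]
      simp [h]
    · rw [hθ.mul_f₁_eq_zero_iff]
      simp [hy]
  · rintro ⟨N, x, y, hx, hy, h⟩ s
    have h' := congrArg (fun x : Subalgebra.center O Γ => (θ x).2.1 s 1 1) h
    have e₁ := ((hθ.mul_f₀_eq_zero_iff x).1 hx).2 s
    have e₂ := ((hθ.mul_f₁_eq_zero_iff y).1 hy).1 s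
    simpa [hθ.map_smul, e₁, e₂, two_ne_zero_of_isFractionRing O K] using h'

/-- The central elements annihilating f₀ are those supported on the field components, and up to
powers of 2 they fill these. Vanishing there thus becomes a condition inside the center, which an
isomorphism of centers can transport. -/
theorem snd_snd_eq_zero_iff (hθ : IsLatticeEmbedding O f₀ f₁ θ) (z : Subalgebra.center O Γ) :
    (θ z).2.2 = 0 ↔ ∀ y : Subalgebra.center O Γ, (y : Γ) * f₀ = 0 → z * y = 0 := by
  constructor
  · intro h y hy
    apply Subtype.ext
    apply hθ.injective
    obtain ⟨h₁, h₂⟩ := (hθ.mul_f₀_eq_zero_iff y).1 hy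
    rw [Subalgebra.coe_mul, map_mul, Subalgebra.coe_zero, map_zero]
    refine Prod.ext (by simp [h₁]) (Prod.ext ?_ (by simp [h]))
    ext1 s
    simp only [Prod.snd_mul, Prod.fst_mul, Pi.mul_apply]
    rw [hθ.map_mem_center y.2 s, h₂ s]
    simp
  · intro h
    obtain ⟨N, y, hy⟩ := hθ.exists_center (0 : Fin 2 → K) 0 1
    have h' := h y (by rw [hθ.mul_f₀_eq_zero_iff]; simp [hy])
    have h'' := congrArg (fun x : Subalgebra.center O Γ => (θ x).2.2) h'
    simpa [hy, two_ne_zero_of_isFractionRing O K] using h''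

theorem map_mul_center (hθ : IsLatticeEmbedding O f₀ f₁ θ) (z w : Subalgebra.center O Γ)
    (s : Fin 2) : (θ ((z * w : Subalgebra.center O Γ) : Γ)).2.1 s 1 1 =
      (θ z).2.1 s 1 1 * (θ w).2.1 s 1 1 := by
  rw [Subalgebra.coe_mul, map_mul, Prod.snd_mul, Prod.fst_mul, Pi.mul_apply,
    hθ.map_mem_center z.2 s]
  simp

theorem map_sub_smul_one (hθ : IsLatticeEmbedding O f₀ f₁ θ) (z : Subalgebra.center O Γ)
    (r : O) (s : Fin 2) : (θ ((z - r • 1 : Subalgebra.center O Γ) : Γ)).2.1 s 1 1 =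
      (θ z).2.1 s 1 1 - algebraMap O K r := by
  simp only [AddSubgroupClass.coe_sub, Subalgebra.coe_smul, map_sub, hθ.map_smul, Subalgebra.coe_one,
    map_one]
  simp [-algebraMap_smul]

end IsLatticeEmbedding

variable {Γ' : Type*} [Ring Γ'] [Algebra O Γ'] {θ' : Γ' →+* CoordinateAlgebra K F} {f₀' f₁' : Γ'}
  {m : ℕ}

theorem IsLatticeEmbedding.forall_map_eq_zero_iff (hθ : IsLatticeEmbedding O f₀ f₁ θ)
    (hθ' : IsLatticeEmbedding O f₀' f₁' θ')
    (g : Subalgebra.center O Γ ≃ₐ[O] Subalgebra.center O Γ')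
    (hg₀ : ∀ z : Subalgebra.center O Γ, (z : Γ) * f₀ = 0 ↔ (g z : Γ') * f₀' = 0)
    (hg₁ : ∀ z : Subalgebra.center O Γ, (z : Γ) * f₁ = 0 ↔ (g z : Γ') * f₁' = 0) (z : Subalgebra.center O Γ) :
    (∀ s, (θ z).2.1 s 1 1 = 0) ↔ ∀ s, (θ' (g z)).2.1 s 1 1 = 0 := by
  rw [hθ.forall_eq_zero_iff, hθ'.forall_eq_zero_iff]
  constructor
  · rintro ⟨N, x, y, hx, hy, h⟩
    exact ⟨N, g x, g y, (hg₀ x).1 hx, (hg₁ y).1 hy, by rw [← _root_.map_smul, h, map_add]⟩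
  · rintro ⟨N, x, y, hx, hy, h⟩
    refine ⟨N, g.symm x, g.symm y, (hg₀ _).2 (by simpa using hx), (hg₁ _).2 (by simpa using hy),
      g.injective ?_⟩
    rw [_root_.map_smul, h, map_add, g.apply_symm_apply, g.apply_symm_apply]

theorem IsLatticeEmbedding.snd_snd_map_eq_zero_iff (hθ : IsLatticeEmbedding O f₀ f₁ θ)
    (hθ' : IsLatticeEmbedding O f₀' f₁' θ')
    (g : Subalgebra.center O Γ ≃ₐ[O] Subalgebra.center O Γ')
    (hg₀ : ∀ z : Subalgebra.center O Γ, (z : Γ) * f₀ = 0 ↔ (g z : Γ') * f₀' = 0) (z : Subalgebra.center O Γ) :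
    (θ z).2.2 = 0 ↔ (θ' (g z)).2.2 = 0 := by
  rw [hθ.snd_snd_eq_zero_iff, hθ'.snd_snd_eq_zero_iff]
  refine ⟨fun h y hy => ?_, fun h y hy => ?_⟩
  · have := h (g.symm y) ((hg₀ _).2 (by simpa using hy))
    simpa using congrArg g this
  · apply g.injective
    rw [map_mul, map_zero]
    exact h _ ((hg₀ y).1 hy)

namespace IsStandardEmbedding

theorem exists_map_center (hθ : IsStandardEmbedding O m f₀ f₁ θ) (z : Subalgebra.center O Γ) :
    ∃ y : Fin 2 → O, ∀ s, (θ z).2.1 s 1 1 = algebraMap O K (y s) := by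
  obtain ⟨y₀, y₁, h, -⟩ := hθ.integral₁₁ _ _ _ (hθ.map_mul_f₁ z)
  refine ⟨![y₀, y₁], fun s => (congrFun h s).trans ?_⟩
  fin_cases s <;> rfl

/-- An isomorphism of centers that respects the annihilators of the idempotents is the identity
on the coordinates in the components `M₂(K)`, up to the order. -/
theorem exists_perm (hθ : IsStandardEmbedding O m f₀ f₁ θ)
    (hθ' : IsLatticeEmbedding O f₀' f₁' θ')
    (g : Subalgebra.center O Γ ≃ₐ[O] Subalgebra.center O Γ')
    (hg₀ : ∀ z : Subalgebra.center O Γ, (z : Γ) * f₀ = 0 ↔ (g z : Γ') * f₀' = 0)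
    (hg₁ : ∀ z : Subalgebra.center O Γ, (z : Γ) * f₁ = 0 ↔ (g z : Γ') * f₁' = 0) :
    ∃ τ : Equiv.Perm (Fin 2), ∀ (z : Subalgebra.center O Γ) s, (θ' (g z)).2.1 (τ s) 1 1 = (θ z).2.1 s 1 1 := by
  have hθ₀ := hθ.toIsLatticeEmbedding
  have hiff := hθ₀.forall_map_eq_zero_iff hθ' g hg₀ hg₁
  obtain ⟨N, z₀, hz₀⟩ := hθ₀.exists_center (0 : Fin 2 → K) ![1, 0] 0
  have h2 : (2 : K) ^ N ≠ 0 := pow_ne_zero N (two_ne_zero_of_isFractionRing O K)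
  have hmap : ∀ (z : Subalgebra.center O Γ) (r : O), g (z - r • 1) = g z - r • 1 := fun z r => by
    simp
  have h0 : (θ z₀).2.1 0 1 1 = 2 ^ N := by simp [hz₀]
  have h1 : (θ z₀).2.1 1 1 1 = 0 := by simp [hz₀]
  have hc : algebraMap O K (2 ^ N) = 2 ^ N := by rw [map_pow, map_ofNat]
  -- On the matrix components z₀ is 2^N times the idempotent of the first one. The equation z₀(z₀ -
  -- 2^N) = 0 there carries over to g z₀, whose coordinates are therefore 0 or 2^N; both values
  -- occur.
  have hmul : ∀ s, (θ' (g z₀)).2.1 s 1 1 * ((θ' (g z₀)).2.1 s 1 1 - 2 ^ N) = 0 := by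
    intro s
    have h := (hiff (z₀ * (z₀ - (2 ^ N : O) • 1))).1 (fun s => by
      rw [hθ₀.map_mul_center, hθ₀.map_sub_smul_one, hc]
      fin_cases s <;> simp [h0, h1]) s
    rwa [map_mul, hθ'.map_mul_center, hmap, hθ'.map_sub_smul_one, hc] at h
  have hne : ¬ ∀ s, (θ' (g z₀)).2.1 s 1 1 = 0 := fun h => h2 (h0 ▸ (hiff z₀).2 h 0)
  have hne' : ¬ ∀ s, (θ' (g z₀)).2.1 s 1 1 = 2 ^ N := fun h => by
    have := (hiff (z₀ - (2 ^ N : O) • 1)).2 (fun s => by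
      rw [hmap, hθ'.map_sub_smul_one, hc, h s, sub_self]) 1
    rw [hθ₀.map_sub_smul_one, hc, h1, zero_sub, neg_eq_zero] at this
    exact h2 this
  obtain ⟨τ, e0, e1⟩ : ∃ τ : Equiv.Perm (Fin 2), (θ' (g z₀)).2.1 (τ 0) 1 1 = 2 ^ N ∧
      (θ' (g z₀)).2.1 (τ 1) 1 1 = 0 := by
    simp only [mul_eq_zero, sub_eq_zero, Fin.forall_fin_two] at hmul hne hne'
    obtain ⟨h | h, h' | h'⟩ := hmul
    · exact absurd ⟨h, h'⟩ hne
    · exact ⟨Equiv.swap 0 1, by simpa using h', by simpa using h⟩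
    · exact ⟨1, by simpa using h, by simpa using h'⟩
    · exact absurd ⟨h, h'⟩ hne'
  refine ⟨τ, fun z => ?_⟩
  obtain ⟨y, hy⟩ := hθ.exists_map_center z
  rw [Fin.forall_fin_two]
  constructor
  -- Integrality of the coordinates allows the subtraction of y 0 inside the center. The product
  -- vanishes on the matrix components, and so does its image, while g z₀ is nonzero at τ 0.
  · have h := (hiff ((z - y 0 • 1) * z₀)).1 (fun s => by
      rw [hθ₀.map_mul_center, hθ₀.map_sub_smul_one]
      fin_cases s <;> simp [h1, hy]) (τ 0)
    rw [map_mul, hθ'.map_mul_center, hmap, hθ'.map_sub_smul_one, e0] at h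
    rw [hy, ← sub_eq_zero]
    exact (mul_eq_zero.1 h).resolve_right h2
  · have h := (hiff ((z - y 1 • 1) * (z₀ - (2 ^ N : O) • 1))).1 (fun s => by
      rw [hθ₀.map_mul_center, hθ₀.map_sub_smul_one, hθ₀.map_sub_smul_one, hc]
      fin_cases s <;> simp [h0, hy]) (τ 1)
    rw [map_mul, hθ'.map_mul_center, hmap, hmap, hθ'.map_sub_smul_one, hθ'.map_sub_smul_one, e1,
      hc, zero_sub] at h
    rw [hy, ← sub_eq_zero]
    exact (mul_eq_zero.1 h).resolve_right (neg_ne_zero.2 h2)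

/-- The congruences attach each component K to one component M₂(K), so both pairs are swapped
together. The missing condition 2^(m+1) ∣ x₃ - x₁ follows from the one for x₂ - x₀ and the last
congruence. -/
theorem permute_swap (hθ : IsStandardEmbedding O m f₀ f₁ θ) :
    IsStandardEmbedding O m f₀ f₁
      ((permute (Equiv.swap 0 1) (Equiv.swap 0 1)).toRingHom.comp θ) := by
  have hcons : ∀ x y : K, ![x, y] ∘ ⇑(Equiv.swap (0 : Fin 2) 1) = ![y, x] := fun x y => by
    ext i; fin_cases i <;> simp
  have hiff : ∀ (P : CoordinateAlgebra K F),
      (∃ x, ((permute (Equiv.swap 0 1) (Equiv.swap 0 1)).toRingHom.comp θ) x = P) ↔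
        ∃ x, θ x = permute (Equiv.swap 0 1) (Equiv.swap 0 1) P := by
    intro P
    refine exists_congr fun x => ?_
    have h : ∀ P : CoordinateAlgebra K F, permute (Equiv.swap 0 1) (Equiv.swap 0 1)
        (permute (Equiv.swap 0 1) (Equiv.swap 0 1) P) = P := fun P => by
      simp only [permute, RingEquiv.coe_mk, Equiv.coe_fn_mk, Function.comp_assoc]
      simp [← Equiv.coe_trans, Equiv.swap_swap]
    constructor
    · rintro rfl
      exact (h _).symm
    · intro hx
      exact (congrArg (permute (Equiv.swap 0 1) (Equiv.swap 0 1)) hx).trans (h P)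
  have hcomp : ∀ (a b : Fin 2 → K), a ∘ ⇑(Equiv.swap (0 : Fin 2) 1) = b ↔
      a = b ∘ ⇑(Equiv.swap (0 : Fin 2) 1) := fun a b =>
    ⟨fun h => by rw [← h, Function.comp_assoc, ← Equiv.coe_trans]; simp,
      fun h => by rw [h, Function.comp_assoc, ← Equiv.coe_trans]; simp⟩
  refine ⟨hθ.comp _ (permute_smul _ _) rfl, ?_, ?_, ?_, ?_⟩
  · intro a p
    rw [hiff, permute_corner₀₀, hθ.mem₀₀]
    constructor
    · rintro ⟨x₀, x₁, x₂, x₃, ha, hp, ⟨y, hy⟩, ⟨z, hz⟩, ⟨k, hk⟩⟩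
      rw [hcomp, hcons] at ha hp
      exact ⟨x₁, x₀, x₃, x₂, ha, hp, ⟨-y, by linear_combination -hy⟩,
        ⟨z + 2 * k, by linear_combination hz + hk⟩, ⟨-k, by linear_combination -hk⟩⟩
    · rintro ⟨x₀, x₁, x₂, x₃, rfl, rfl, ⟨y, hy⟩, ⟨z, hz⟩, ⟨k, hk⟩⟩
      rw [hcons, hcons]
      exact ⟨x₁, x₀, x₃, x₂, rfl, rfl, ⟨-y, by linear_combination -hy⟩,
        ⟨z + 2 * k, by linear_combination hz + hk⟩, ⟨-k, by linear_combination -hk⟩⟩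
  · intro a
    rw [hiff, permute_corner₀₁, hθ.mem₀₁]
    constructor
    · rintro ⟨y₀, y₁, ha, h⟩
      rw [hcomp, hcons] at ha
      exact ⟨y₁, y₀, ha, (dvd_sub_comm).1 h⟩
    · rintro ⟨y₀, y₁, rfl, h⟩
      exact ⟨y₁, y₀, hcons _ _, (dvd_sub_comm).1 h⟩
  · intro a
    rw [hiff, permute_corner₁₀, hθ.mem₁₀]
    constructor
    · rintro ⟨y₀, y₁, ha, h⟩
      rw [hcomp, hcons] at ha
      exact ⟨y₁, y₀, ha, (dvd_sub_comm).1 h⟩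
    · rintro ⟨y₀, y₁, rfl, h⟩
      exact ⟨y₁, y₀, hcons _ _, (dvd_sub_comm).1 h⟩
  · intro x h d hx
    obtain ⟨x', hx'⟩ := (hiff _).1 ⟨x, hx⟩
    obtain ⟨y₀, y₁, hh, hd⟩ := hθ.integral₁₁ _ _ _ (hx'.trans (permute_corner₁₁ _ _ _ _))
    rw [hcomp, hcons] at hh
    exact ⟨y₁, y₀, hh, (dvd_sub_comm).1 hd⟩

/-- The matrix coordinates (h₀, h₁) of x are congruent modulo 2, so the standard form of f₀Γf₀
contains the element with coordinates (h; h). Adding it to x makes every matrix component scalar,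
hence gives a central element. Therefore f₁Γf₁ = Z(Γ)f₁, and this corner carries no information
beyond the center. -/
theorem exists_center_mul_f₁ (hθ : IsStandardEmbedding O m f₀ f₁ θ) {x : Γ} {h : Fin 2 → K}
    {d : ∀ r, F r} (hx : θ x = corner₁₁ h d) : ∃ z : Subalgebra.center O Γ, (z : Γ) * f₁ = x := by
  obtain ⟨y₀, y₁, hh, hd⟩ := hθ.integral₁₁ _ _ _ hx
  obtain ⟨y, hy⟩ := (hθ.mem₀₀ h h).2 ⟨y₀, y₁, y₀, y₁, hh, hh, hd, by simp, by simp⟩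
  have hxy : ∀ s, (θ (y + x)).2.1 s = h s • 1 := by
    intro s
    rw [map_add, hx, hy]
    ext i j
    fin_cases i <;> fin_cases j <;> simp [corner₀₀, corner₁₁]
  refine ⟨⟨y + x, hθ.mem_center hxy⟩, hθ.injective ?_⟩
  rw [hθ.map_mul_f₁, hx]
  congr 1
  · ext s
    rw [hxy s]
    simp
  · rw [map_add, hx, hy]
    simp [corner₀₀, corner₁₁]

end IsStandardEmbedding

/-- The pairs of elements of two orders with the same coordinates in the components `K` and `M₂(K)`
and with coordinates in the other components that are related by an isomorphism of centers. -/
def matchingSubalgebra (hθ : IsLatticeEmbedding O f₀ f₁ θ) (hθ' : IsLatticeEmbedding O f₀' f₁' θ')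
    (g : Subalgebra.center O Γ ≃ₐ[O] Subalgebra.center O Γ') : Subalgebra O (Γ × Γ') where
  carrier := {x | (θ x.1).1 = (θ' x.2).1 ∧ (θ x.1).2.1 = (θ' x.2).2.1 ∧
    ∃ z : Subalgebra.center O Γ, (θ z).2.2 = (θ x.1).2.2 ∧ (θ' (g z)).2.2 = (θ' x.2).2.2}
  mul_mem' := by
    rintro x y ⟨h₁, h₂, z, h₃, h₄⟩ ⟨h₁', h₂', z', h₃', h₄'⟩
    exact ⟨by simp [h₁, h₁'], by simp [h₂, h₂'], z * z', by simp [h₃, h₃'], by simp [h₄, h₄']⟩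
  add_mem' := by
    rintro x y ⟨h₁, h₂, z, h₃, h₄⟩ ⟨h₁', h₂', z', h₃', h₄'⟩
    exact ⟨by simp [h₁, h₁'], by simp [h₂, h₂'], z + z', by simp [h₃, h₃'], by simp [h₄, h₄']⟩
  algebraMap_mem' r := by
    refine ⟨?_, ?_, algebraMap O _ r, rfl, by rw [AlgEquiv.commutes]; rfl⟩
    · simp [Algebra.algebraMap_eq_smul_one, hθ.map_smul, hθ'.map_smul]
    · simp [Algebra.algebraMap_eq_smul_one, hθ.map_smul, hθ'.map_smul]

theorem IsLatticeEmbedding.injective_matching (hθ : IsLatticeEmbedding O f₀ f₁ θ)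
    (hθ' : IsLatticeEmbedding O f₀' f₁' θ')
    (g : Subalgebra.center O Γ ≃ₐ[O] Subalgebra.center O Γ')
    (hg₀ : ∀ z : Subalgebra.center O Γ, (z : Γ) * f₀ = 0 ↔ (g z : Γ') * f₀' = 0) {x : Γ × Γ'}
    (hx : x ∈ matchingSubalgebra hθ hθ' g) : x.1 = 0 ↔ x.2 = 0 := by
  obtain ⟨h₁, h₂, z, h₃, h₄⟩ := hx
  rw [← map_eq_zero_iff θ hθ.injective, ← map_eq_zero_iff θ' hθ'.injective, Prod.ext_iff,
    Prod.ext_iff, Prod.ext_iff, Prod.ext_iff, h₁, h₂, ← h₃, ← h₄]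
  simp only [Prod.snd_zero, hθ.snd_snd_map_eq_zero_iff hθ' g hg₀]

/-- Partners are found corner by corner: in three corners the two images are literally the same
lattice, and in f₁Γf₁ the partner of zf₁ is g(z)f₁'. -/
theorem IsStandardEmbedding.exists_matching (hθ : IsStandardEmbedding O m f₀ f₁ θ)
    (hθ' : IsStandardEmbedding O m f₀' f₁' θ')
    (g : Subalgebra.center O Γ ≃ₐ[O] Subalgebra.center O Γ')
    (hg : ∀ (z : Subalgebra.center O Γ) s, (θ' (g z)).2.1 s 1 1 = (θ z).2.1 s 1 1) :
    (∀ x, ∃ x', (x, x') ∈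
      matchingSubalgebra hθ.toIsLatticeEmbedding hθ'.toIsLatticeEmbedding g) := by
  intro x
  have hdec : x = f₀ * x * f₀ + f₀ * x * f₁ + f₁ * x * f₀ + f₁ * x * f₁ := by
    have h : f₀ + f₁ = 1 := hθ.injective (by
      rw [map_add, hθ.map_f₀, hθ.map_f₁, corner₀₀_add_corner₁₁, map_one])
    calc x = (f₀ + f₁) * x * (f₀ + f₁) := by rw [h, one_mul, mul_one]
      _ = _ := by noncomm_ring
  have h₀₀ := hθ.map_f₀_mul_mul_f₀ x
  have h₀₁ := hθ.map_f₀_mul_mul_f₁ x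
  have h₁₀ := hθ.map_f₁_mul_mul_f₀ x
  have h₁₁ := hθ.map_f₁_mul_mul_f₁ x
  obtain ⟨x₀₀, hx₀₀⟩ := (hθ'.mem₀₀ _ _).2 ((hθ.mem₀₀ _ _).1 ⟨_, h₀₀⟩)
  obtain ⟨x₀₁, hx₀₁⟩ := (hθ'.mem₀₁ _).2 ((hθ.mem₀₁ _).1 ⟨_, h₀₁⟩)
  obtain ⟨x₁₀, hx₁₀⟩ := (hθ'.mem₁₀ _).2 ((hθ.mem₁₀ _).1 ⟨_, h₁₀⟩)
  obtain ⟨z, hz⟩ := hθ.exists_center_mul_f₁ h₁₁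
  set R := matchingSubalgebra hθ.toIsLatticeEmbedding hθ'.toIsLatticeEmbedding g
  have m₀₀ : (f₀ * x * f₀, x₀₀) ∈ R :=
    ⟨by rw [h₀₀, hx₀₀], by rw [h₀₀, hx₀₀], 0, by rw [h₀₀]; simp [corner₀₀],
      by rw [hx₀₀]; simp [corner₀₀]⟩
  have m₀₁ : (f₀ * x * f₁, x₀₁) ∈ R :=
    ⟨by rw [h₀₁, hx₀₁], by rw [h₀₁, hx₀₁], 0, by rw [h₀₁]; simp [corner₀₁],
      by rw [hx₀₁]; simp [corner₀₁]⟩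
  have m₁₀ : (f₁ * x * f₀, x₁₀) ∈ R :=
    ⟨by rw [h₁₀, hx₁₀], by rw [h₁₀, hx₁₀], 0, by rw [h₁₀]; simp [corner₁₀],
      by rw [hx₁₀]; simp [corner₁₀]⟩
  have m₁₁ : (f₁ * x * f₁, (g z : Γ') * f₁') ∈ R := by
    rw [← hz]
    refine ⟨?_, ?_, z, ?_, ?_⟩
    · rw [hθ.map_mul_f₁, hθ'.map_mul_f₁]; rfl
    · rw [hθ.map_mul_f₁, hθ'.map_mul_f₁]; simp only [hg]; rfl
    · rw [hθ.map_mul_f₁]; rfl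
    · rw [hθ'.map_mul_f₁]; rfl
  refine ⟨x₀₀ + x₀₁ + x₁₀ + g z * f₁', ?_⟩
  rw [hdec]
  exact add_mem (add_mem (add_mem m₀₀ m₀₁) m₁₀) m₁₁

/-- The matching pairs form a subalgebra of Γ × Γ' whose two projections are bijective. Working with
this graph avoids extending g to an isomorphism of the field components. -/
theorem IsStandardEmbedding.nonempty_algEquiv (hθ : IsStandardEmbedding O m f₀ f₁ θ)
    (hθ' : IsStandardEmbedding O m f₀' f₁' θ')
    (g : Subalgebra.center O Γ ≃ₐ[O] Subalgebra.center O Γ')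
    (hg₀ : ∀ z : Subalgebra.center O Γ, (z : Γ) * f₀ = 0 ↔ (g z : Γ') * f₀' = 0)
    (hg₁ : ∀ z : Subalgebra.center O Γ, (z : Γ) * f₁ = 0 ↔ (g z : Γ') * f₁' = 0) : Nonempty (Γ ≃ₐ[O] Γ') := by
  obtain ⟨θ', hθ', hg⟩ : ∃ θ' : Γ' →+* CoordinateAlgebra K F, IsStandardEmbedding O m f₀' f₁' θ' ∧
      ∀ (z : Subalgebra.center O Γ) s, (θ' (g z)).2.1 s 1 1 = (θ z).2.1 s 1 1 := by
    obtain ⟨τ, hτ⟩ := hθ.exists_perm hθ'.toIsLatticeEmbedding g hg₀ hg₁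
    have hcases : τ = 1 ∨ τ = Equiv.swap 0 1 := by
      clear hτ; revert τ; decide
    rcases hcases with rfl | rfl
    · exact ⟨θ', hθ', hτ⟩
    · exact ⟨_, hθ'.permute_swap, hτ⟩
  set R := matchingSubalgebra hθ.toIsLatticeEmbedding hθ'.toIsLatticeEmbedding g
  have hinj : ∀ {x}, x ∈ R → (x.1 = 0 ↔ x.2 = 0) :=
    hθ.toIsLatticeEmbedding.injective_matching hθ'.toIsLatticeEmbedding g hg₀
  have h₁ : Function.Bijective ((AlgHom.fst O Γ Γ').comp R.val) := by
    refine ⟨(injective_iff_map_eq_zero _).2 fun x hx => Subtype.ext (Prod.ext hx ?_), fun x => ?_⟩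
    · exact (hinj x.2).1 hx
    · obtain ⟨x', hx'⟩ := hθ.exists_matching hθ' g hg x
      exact ⟨⟨_, hx'⟩, rfl⟩
  have h₂ : Function.Bijective ((AlgHom.snd O Γ Γ').comp R.val) := by
    refine ⟨(injective_iff_map_eq_zero _).2 fun x hx => Subtype.ext (Prod.ext ?_ hx), fun x => ?_⟩
    · exact (hinj x.2).2 hx
    · obtain ⟨x', h₁, h₂, z, h₃, h₄⟩ := hθ'.exists_matching hθ g.symm
        (fun z s => by rw [← hg (g.symm z), g.apply_symm_apply]) x
      exact ⟨⟨(x', x), h₁.symm, h₂.symm, g.symm z, h₄, by rw [g.apply_symm_apply, h₃]⟩, rfl⟩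
  exact ⟨(AlgEquiv.ofBijective _ h₁).symm.trans (AlgEquiv.ofBijective _ h₂)⟩

end Center

end

section

/-! ### Right ideals generated by idempotents -/

/-- Idempotents that generate isomorphic right ideals. -/
def AreEquivalentIdempotents {R : Type*} [Mul R] (f e : R) : Prop :=
  ∃ x y, x * y = f ∧ y * x = e

section Idempotents

variable {R : Type u} [Ring R] {e f h : R}

theorem AreEquivalentIdempotents.symm (hfe : AreEquivalentIdempotents f e) :
    AreEquivalentIdempotents e f := by
  obtain ⟨x, y, hx, hy⟩ := hfe
  exact ⟨y, x, hy, hx⟩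

theorem AreEquivalentIdempotents.trans (hf : IsIdempotentElem f) (hh : IsIdempotentElem h)
    (hfe : AreEquivalentIdempotents f e) (heh : AreEquivalentIdempotents e h) :
    AreEquivalentIdempotents f h := by
  obtain ⟨x, y, rfl, rfl⟩ := hfe
  obtain ⟨z, w, hz, rfl⟩ := heh
  refine ⟨x * z, w * y, ?_, ?_⟩
  · rw [← mul_assoc, mul_assoc x z w, hz, mul_assoc, mul_assoc, ← mul_assoc]
    exact hf
  · rw [← mul_assoc, mul_assoc w y x, ← hz, mul_assoc, mul_assoc, ← mul_assoc]
    exact hh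

theorem AreEquivalentIdempotents.map {S : Type*} [Ring S] (φ : R →+* S)
    (hfe : AreEquivalentIdempotents f e) : AreEquivalentIdempotents (φ f) (φ e) := by
  obtain ⟨x, y, rfl, rfl⟩ := hfe
  exact ⟨φ x, φ y, (map_mul _ _ _).symm, (map_mul _ _ _).symm⟩

theorem mem_principalRightIdeal_iff {x y : R} : y ∈ principalRightIdeal x ↔ ∃ r, x * r = y := by
  rw [principalRightIdeal, Submodule.mem_span_singleton]
  exact ⟨fun ⟨r, hr⟩ => ⟨r.unop, hr⟩, fun ⟨r, hr⟩ => ⟨.op r, hr⟩⟩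

theorem mul_eq_of_mem_principalRightIdeal (hf : IsIdempotentElem f) {y : R}
    (hy : y ∈ principalRightIdeal f) : f * y = y := by
  obtain ⟨r, rfl⟩ := mem_principalRightIdeal_iff.1 hy
  rw [← mul_assoc, hf.eq]

theorem projective_principalRightIdeal (hf : IsIdempotentElem f) :
    Module.Projective Rᵐᵒᵖ (principalRightIdeal f) := by
  refine Module.Projective.of_split
    ({ toFun := fun x => .op (x : R), map_add' := fun _ _ => rfl, map_smul' := fun _ _ => rfl } :
      principalRightIdeal f →ₗ[Rᵐᵒᵖ] Rᵐᵒᵖ)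
    { toFun := fun x => ⟨f * x.unop, mem_principalRightIdeal_iff.2 ⟨_, rfl⟩⟩
      map_add' := fun x y => Subtype.ext (mul_add _ _ _)
      map_smul' := fun r x => Subtype.ext (mul_assoc _ _ _).symm } ?_
  ext x
  exact mul_eq_of_mem_principalRightIdeal hf x.2

/-- A decomposition of fR splits f as n₁ + n₂, and uniqueness of the components makes n₁ an
idempotent of the corner fRf. If it is 0 or f, one summand contains f and is everything. -/
theorem isIndecomposableModule_principalRightIdeal (hf : IsIdempotentElem f) (hf₀ : f ≠ 0)
    (h : ∀ p, p * p = p → f * p = p → p * f = p → p = 0 ∨ p = f) :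
    IsIndecomposableModule Rᵐᵒᵖ (principalRightIdeal f) := by
  have hmem : f ∈ principalRightIdeal f := Submodule.mem_span_singleton_self f
  refine ⟨⟨⟨f, hmem⟩, 0, fun h => hf₀ (congrArg Subtype.val h)⟩, fun N₁ N₂ hN => ?_⟩
  obtain ⟨n₁, hn₁, n₂, hn₂, hsum⟩ := Submodule.mem_sup.1
    (hN.sup_eq_top ▸ Submodule.mem_top : (⟨f, hmem⟩ : principalRightIdeal f) ∈ N₁ ⊔ N₂)
  have key : ∀ r : R, f * r = r → r ∈ principalRightIdeal f := fun r hr =>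
    mem_principalRightIdeal_iff.2 ⟨r, hr⟩
  have huniq : ∀ m₁ ∈ N₁, ∀ m₂ ∈ N₂, ∀ m₁' ∈ N₁, ∀ m₂' ∈ N₂, m₁ + m₂ = m₁' + m₂' → m₁ = m₁' := by
    intro m₁ h₁ m₂ h₂ m₁' h₁' m₂' h₂' he
    have h0 : m₁ - m₁' ∈ N₁ ⊓ N₂ := by
      refine ⟨N₁.sub_mem h₁ h₁', ?_⟩
      have : m₁ - m₁' = m₂' - m₂ := by rw [sub_eq_sub_iff_add_eq_add, he, add_comm]
      rw [this]
      exact N₂.sub_mem h₂' h₂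
    rw [hN.inf_eq_bot, Submodule.mem_bot, sub_eq_zero] at h0
    exact h0
  have hfn : ∀ n : principalRightIdeal f, f * (n : R) = n := fun n =>
    mul_eq_of_mem_principalRightIdeal hf n.2
  have hs : (n₁ : R) + n₂ = f := congrArg Subtype.val hsum
  have e₁ : (n₁ : R) * f = n₁ := congrArg Subtype.val <|
    huniq (MulOpposite.op f • n₁) (N₁.smul_mem _ hn₁) (MulOpposite.op f • n₂) (N₂.smul_mem _ hn₂)
      n₁ hn₁ n₂ hn₂ (by
        rw [← smul_add, hsum]
        exact Subtype.ext hf)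
  have e₂ : (n₁ : R) * n₁ = n₁ := congrArg Subtype.val <|
    huniq (MulOpposite.op (n₁ : R) • n₁) (N₁.smul_mem _ hn₁) (MulOpposite.op (n₁ : R) • n₂)
      (N₂.smul_mem _ hn₂) n₁ hn₁ 0 N₂.zero_mem (by
        rw [← smul_add, hsum, add_zero]
        exact Subtype.ext (hfn n₁))
  have hspan : ∀ (N : Submodule Rᵐᵒᵖ (principalRightIdeal f)) n, n ∈ N → (n : R) = f → N = ⊤ := by
    intro N n hn hnf
    refine (Submodule.eq_top_iff'.2 fun x => ?_)
    have : x = MulOpposite.op (x : R) • n := Subtype.ext (by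
      change (x : R) = n * x
      rw [hnf, hfn])
    rw [this]
    exact N.smul_mem _ hn
  rcases h _ e₂ (hfn n₁) e₁ with h0 | h1
  · left
    have hN₂ := hspan N₂ n₂ hn₂ (by simpa [h0] using hs)
    simpa [hN₂] using hN.inf_eq_bot
  · right
    have hN₁ := hspan N₁ n₁ hn₁ h1
    simpa [hN₁] using hN.inf_eq_bot

theorem areEquivalentIdempotents_of_linearEquiv (hf : IsIdempotentElem f) (he : IsIdempotentElem e)
    (φ : principalRightIdeal f ≃ₗ[Rᵐᵒᵖ] principalRightIdeal e) : AreEquivalentIdempotents f e := by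
  have hmem : ∀ f : R, f ∈ principalRightIdeal f := Submodule.mem_span_singleton_self
  have key : ∀ {f e : R}, IsIdempotentElem f →
      ∀ (φ : principalRightIdeal f →ₗ[Rᵐᵒᵖ] principalRightIdeal e) x,
        (φ ⟨f, hmem f⟩ : R) * x = φ x := by
    intro f e hf φ x
    have : x = MulOpposite.op (x : R) • ⟨f, hmem f⟩ := Subtype.ext
      (mul_eq_of_mem_principalRightIdeal hf x.2).symm
    conv_rhs => rw [this, map_smul]
    rfl
  refine ⟨φ.symm ⟨e, hmem e⟩, φ ⟨f, hmem f⟩, ?_, ?_⟩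
  · rw [← LinearEquiv.coe_coe φ.symm, key he, LinearEquiv.coe_coe, φ.symm_apply_apply]
  · rw [← LinearEquiv.coe_coe φ, key hf, LinearEquiv.coe_coe, φ.apply_symm_apply]

/-- Left multiplications by y and x are mutually inverse; they respect the factor ε because it is
central. -/
theorem nonempty_linearEquiv_principalRightIdeal (hf : IsIdempotentElem f)
    (he : IsIdempotentElem e) (hfe : AreEquivalentIdempotents f e) {ε : R}
    (hε : ∀ a, ε * a = a * ε) :
    Nonempty (principalRightIdeal (ε * f) ≃ₗ[Rᵐᵒᵖ] principalRightIdeal (ε * e)) := by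
  obtain ⟨x, y, rfl, rfl⟩ := hfe
  have hf' : x * (y * (x * y)) = x * y := by rw [← mul_assoc, hf.eq]
  have he' : y * (x * (y * x)) = y * x := by rw [← mul_assoc, he.eq]
  have key : ∀ x y : R, x * (y * (x * y)) = x * y → ∀ a ∈ principalRightIdeal (ε * (x * y)),
      y * a ∈ principalRightIdeal (ε * (y * x)) ∧ x * (y * a) = a := by
    intro x y h a ha
    obtain ⟨r, rfl⟩ := mem_principalRightIdeal_iff.1 ha
    constructor
    · refine mem_principalRightIdeal_iff.2 ⟨y * r, ?_⟩
      simp only [← mul_assoc]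
      rw [hε y]
    · calc x * (y * (ε * (x * y) * r)) = x * (y * ε) * (x * y) * r := by simp only [mul_assoc]
        _ = ε * (x * (y * (x * y))) * r := by
          rw [← hε y, ← mul_assoc x, ← hε x]; simp only [mul_assoc]
        _ = ε * (x * y) * r := by rw [h]
  exact ⟨{
    toFun := fun a => ⟨y * a, (key x y hf' a a.2).1⟩
    invFun := fun a => ⟨x * a, (key y x he' a a.2).1⟩
    left_inv := fun a => Subtype.ext (key x y hf' a a.2).2
    right_inv := fun a => Subtype.ext (key y x he' a a.2).2
    map_add' := fun a b => Subtype.ext (mul_add _ _ _)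
    map_smul' := fun r a => Subtype.ext (mul_assoc _ _ _).symm }⟩

theorem eq_of_length_principalRightIdeal_eq_one {q : R}
    (h : Module.length Rᵐᵒᵖ (principalRightIdeal f) = 1) (hq : q * q = q) (hfq : f * q = q)
    (hqf : q * f = q) : q = 0 ∨ q = f := by
  have hs := Module.length_eq_one_iff.1 h
  have hmem : f ∈ principalRightIdeal f := Submodule.mem_span_singleton_self f
  have hqm : q ∈ principalRightIdeal f := mem_principalRightIdeal_iff.2 ⟨q, hfq⟩
  rcases eq_bot_or_eq_top (Submodule.span Rᵐᵒᵖ {(⟨q, hqm⟩ : principalRightIdeal f)}) with h | h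
  · left
    rw [Submodule.span_singleton_eq_bot] at h
    exact congrArg Subtype.val h
  · right
    obtain ⟨r, hr⟩ := Submodule.mem_span_singleton.1
      (h ▸ Submodule.mem_top : (⟨f, hmem⟩ : principalRightIdeal f) ∈ _)
    have hr' : q * r.unop = f := congrArg Subtype.val hr
    rw [← hqf, ← hr', ← mul_assoc, hq]

theorem IsProjIndecSystem.exists_areEquivalentIdempotents {m : ℕ} {e : Fin m → R}
    (he : IsProjIndecSystem e) (hf : IsIdempotentElem f)
    (hfi : IsIndecomposableModule Rᵐᵒᵖ (principalRightIdeal f)) :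
    ∃ j, AreEquivalentIdempotents f (e j) := by
  have := projective_principalRightIdeal hf
  have : Module.Finite Rᵐᵒᵖ (principalRightIdeal f) := .span_singleton _ _
  obtain ⟨j, ⟨φ⟩⟩ := he.complete _ this ‹_› hfi
  exact ⟨j, areEquivalentIdempotents_of_linearEquiv hf (he.idempotent j) φ⟩

theorem IsProjIndecSystem.eq_of_areEquivalentIdempotents {m : ℕ} {e : Fin m → R}
    (he : IsProjIndecSystem e) {i j : Fin m} (h : AreEquivalentIdempotents (e i) (e j)) : i = j := by
  by_contra hij
  obtain ⟨l⟩ := nonempty_linearEquiv_principalRightIdeal (he.idempotent i) (he.idempotent j) h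
    (ε := 1) (by simp)
  rw [one_mul, one_mul] at l
  exact (he.pairwise_not_iso i j hij).false l

end Idempotents

section DecompositionNumber

variable {O : Type u} {K : Type v} {Γ : Type w} [CommRing O] [Field K] [Algebra O K] [Ring Γ]
  [Algebra O Γ] {ε : K ⊗[O] Γ} {e f : Γ}

theorem decompositionNumber_eq (hf : IsIdempotentElem f) (he : IsIdempotentElem e)
    (hfe : AreEquivalentIdempotents f e) (hε : ∀ a, ε * a = a * ε) :
    decompositionNumber K ε f = decompositionNumber K ε e := by
  let φ : Γ →+* K ⊗[O] Γ := (Algebra.TensorProduct.includeRight : Γ →ₐ[O] K ⊗[O] Γ)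
  obtain ⟨l⟩ := nonempty_linearEquiv_principalRightIdeal (hf.map φ) (he.map φ) (hfe.map φ) hε
  exact l.length_eq

theorem decompositionNumber_eq_zero_iff :
    decompositionNumber K ε e = 0 ↔ ε * (1 : K) ⊗ₜ[O] e = 0 := by
  rw [decompositionNumber, Module.length_eq_zero_iff, Submodule.subsingleton_iff_eq_bot,
    Submodule.span_singleton_eq_bot]

end DecompositionNumber

/-! ### The vertex idempotents as projective indecomposables -/

namespace LiftedQuiver

variable {O : Type u} [CommRing O] {κ : ℕ} {c : O} {Γ : Type w} [Ring Γ] [Algebra O Γ]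
  (q : LiftedQuiver O κ c Γ)

/-- The idempotents belonging to the vertices. -/
def vertex : Fin 2 → Γ := ![q.f₀, q.f₁]

theorem f₁_eq : q.f₁ = 1 - q.f₀ := eq_sub_of_add_eq' q.f₀_add_f₁

theorem isIdempotentElem_f₀ : IsIdempotentElem q.f₀ := q.f₀_mul_self

theorem isIdempotentElem_f₁ : IsIdempotentElem q.f₁ := q.f₁_eq ▸ q.isIdempotentElem_f₀.one_sub

theorem isIdempotentElem_vertex (j : Fin 2) : IsIdempotentElem (q.vertex j) := by
  fin_cases j
  · exact q.isIdempotentElem_f₀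
  · exact q.isIdempotentElem_f₁

theorem isIndecomposableModule_vertex (j : Fin 2) :
    IsIndecomposableModule Γᵐᵒᵖ (principalRightIdeal (q.vertex j)) := by
  fin_cases j
  · exact isIndecomposableModule_principalRightIdeal q.isIdempotentElem_f₀ q.f₀_ne_zero
      q.eq_zero_or_eq_f₀
  · exact isIndecomposableModule_principalRightIdeal q.isIdempotentElem_f₁ q.f₁_ne_zero
      q.eq_zero_or_eq_f₁

theorem eq_of_areEquivalentIdempotents {i j : Fin 2}
    (h : AreEquivalentIdempotents (q.vertex i) (q.vertex j)) : i = j := by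
  have key : ¬ AreEquivalentIdempotents q.f₀ q.f₁ := by
    rintro ⟨x, y, hx, hy⟩
    apply q.mul_f₁_mul_ne_f₀ x y
    calc q.f₀ * x * q.f₁ * y * q.f₀ = q.f₀ * (x * y * (x * y)) * q.f₀ := by
          rw [← hy]; simp only [mul_assoc]
      _ = q.f₀ := by rw [hx, q.f₀_mul_self, q.f₀_mul_self, q.f₀_mul_self]
  fin_cases i <;> fin_cases j
  · rfl
  · exact absurd h key
  · exact absurd h.symm key
  · rfl

/-- The vertices are primitive and inequivalent, so every system of projective indecomposables
contains them. This permits replacing the idempotents chosen in the hypotheses by f₀ and f₁. -/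
theorem exists_injective_equiv {m : ℕ} {e : Fin m → Γ} (he : IsProjIndecSystem e) :
    ∃ σ : Fin 2 → Fin m, Function.Injective σ ∧
      ∀ j, AreEquivalentIdempotents (q.vertex j) (e (σ j)) := by
  choose σ hσ using fun j => he.exists_areEquivalentIdempotents (q.isIdempotentElem_vertex j)
    (q.isIndecomposableModule_vertex j)
  refine ⟨σ, fun i j hij => q.eq_of_areEquivalentIdempotents ?_, hσ⟩
  exact (hσ i).trans (q.isIdempotentElem_vertex i) (q.isIdempotentElem_vertex j)
    (hij ▸ (hσ j).symm)

end LiftedQuiver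

end

section

open CoordinateAlgebra

/-! ### Matrix rings and primitive idempotents -/

namespace Matrix

variable {F : Type*} [Field F] {n : Type*} [Fintype n] [DecidableEq n]

/-- A column v of P and the suitably normalized row w through a nonzero entry form a rank-one
idempotent vw below P, which equals P by primitivity. -/
theorem exists_eq_vecMulVec {P : Matrix n n F} (hP : P * P = P) (hP₀ : P ≠ 0)
    (h : ∀ Q, Q * Q = Q → P * Q = Q → Q * P = Q → Q = 0 ∨ Q = P) :
    ∃ v w : n → F, P = vecMulVec v w ∧ w ⬝ᵥ v = 1 := by
  obtain ⟨a, b, hab⟩ : ∃ a b, P a b ≠ 0 := by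
    by_contra! h0
    exact hP₀ (Matrix.ext h0)
  have hwv : ((P a b)⁻¹ • P a) ⬝ᵥ (fun x => P x b) = 1 := by
    rw [smul_dotProduct, smul_eq_mul]
    have : P a ⬝ᵥ (fun x => P x b) = P a b := congrFun (congrFun hP a) b
    rw [this, inv_mul_cancel₀ hab]
  refine ⟨fun x => P x b, (P a b)⁻¹ • P a, ?_, hwv⟩
  have hv : P *ᵥ (fun x => P x b) = fun x => P x b := by
    ext x
    exact congrFun (congrFun hP x) b
  have hw : ((P a b)⁻¹ • P a) ᵥ* P = (P a b)⁻¹ • P a := by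
    rw [smul_vecMul]
    congr 1
    exact congrFun hP a
  refine ((h _ ?_ ?_ ?_).resolve_left ?_).symm
  · rw [vecMulVec_mul_vecMulVec, hwv, one_smul]
  · rw [mul_vecMulVec, hv]
  · rw [vecMulVec_mul, hw]
  · intro h0
    have h1 := congrFun (congrFun h0 a) b
    simp [vecMulVec_apply, hab] at h1

/-- The isomorphism of matrix rings given by a pair of mutually inverse matrices. -/
def compress (K : Type*) [CommSemiring K] [Algebra K F] {J : Type*} [Fintype J] [DecidableEq J]
    (V : Matrix n J F) (W : Matrix J n F) (hWV : W * V = 1) (hVW : V * W = 1) :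
    Matrix n n F ≃ₐ[K] Matrix J J F :=
  AlgEquiv.ofLinearEquiv
    { toFun := fun X => W * X * V
      invFun := fun Y => V * Y * W
      left_inv := fun X => by
        simp only [Matrix.mul_assoc, hVW, Matrix.mul_one]
        rw [← Matrix.mul_assoc, hVW, Matrix.one_mul]
      right_inv := fun X => by
        simp only [Matrix.mul_assoc, hWV, Matrix.mul_one]
        rw [← Matrix.mul_assoc, hWV, Matrix.one_mul]
      map_add' := fun X Y => by simp only [Matrix.mul_add, Matrix.add_mul]
      map_smul' := fun r X => by simp }
    (by simp [hWV])
    (fun X Y => by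
      change W * (X * Y) * V = W * X * V * (W * Y * V)
      simp only [Matrix.mul_assoc]
      rw [← Matrix.mul_assoc V W, hVW, Matrix.one_mul])

theorem compress_apply (K : Type*) [CommSemiring K] [Algebra K F] {J : Type*} [Fintype J]
    [DecidableEq J] (V : Matrix n J F) (W : Matrix J n F) (hWV : W * V = 1) (hVW : V * W = 1)
    (X : Matrix n n F) : compress K V W hWV hVW X = W * X * V := rfl

theorem trace_compress (K : Type*) [CommSemiring K] [Algebra K F] {J : Type*} [Fintype J]
    [DecidableEq J] (V : Matrix n J F) (W : Matrix J n F) (hWV : W * V = 1) (hVW : V * W = 1)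
    (X : Matrix n n F) : (compress K V W hWV hVW X).trace = X.trace := by
  rw [compress_apply, Matrix.trace_mul_comm, ← Matrix.mul_assoc, hVW, Matrix.one_mul]

/-- If the identity has rank one, every matrix is its trace times the identity. The trace then gives
the isomorphism without identifying the index type. -/
theorem exists_algEquiv_of_one_eq_vecMulVec (K : Type*) [CommSemiring K] [Algebra K F] {v w : n → F}
    (h : (1 : Matrix n n F) = vecMulVec v w) (hwv : w ⬝ᵥ v = 1) :
    ∃ ψ : Matrix n n F ≃ₐ[K] F, ∀ X, ψ X = X.trace := by
  have hX : ∀ X : Matrix n n F, X.trace • (1 : Matrix n n F) = X := by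
    intro X
    have e₁ : X.trace = w ᵥ* X ⬝ᵥ v := by
      rw [← Matrix.one_mul X, h, vecMulVec_mul, trace_vecMulVec, dotProduct_comm, ← vecMulVec_mul,
        ← h, Matrix.one_mul]
    conv_rhs => rw [← Matrix.one_mul X, ← Matrix.mul_one (1 * X), h, vecMulVec_mul,
      vecMulVec_mul_vecMulVec]
    rw [e₁, h, vecMulVec_smul]
  have h1 : (1 : Matrix n n F).trace = 1 := by rw [h, trace_vecMulVec, dotProduct_comm, hwv]
  refine ⟨AlgEquiv.ofLinearEquiv
    { toFun := fun X => X.trace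
      invFun := fun x => x • 1
      left_inv := hX
      right_inv := fun x => by simp [h1, -trace_one]
      map_add' := trace_add
      map_smul' := fun r X => trace_smul r X } h1 (fun X Y => ?_), fun X => rfl⟩
  change (X * Y).trace = X.trace * Y.trace
  conv_lhs => rw [← hX X, smul_mul_assoc, Matrix.one_mul, trace_smul, smul_eq_mul]

/-- The vectors v, v' form a basis with dual basis w, w', because the two rank-one idempotents are
orthogonal. The isomorphism is the change to this basis. -/
theorem exists_algEquiv_of_one_eq_add (K : Type*) [CommSemiring K] [Algebra K F]
    {v w v' w' : n → F} (h : 1 = vecMulVec v w + vecMulVec v' w') (hwv : w ⬝ᵥ v = 1)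
    (hwv' : w' ⬝ᵥ v' = 1) (h₀ : vecMulVec v w * vecMulVec v' w' = 0)
    (h₁ : vecMulVec v' w' * vecMulVec v w = 0) :
    ∃ ψ : Matrix n n F ≃ₐ[K] Matrix (Fin 2) (Fin 2) F, (∀ X, (ψ X).trace = X.trace) ∧
      ψ (vecMulVec v w) = !![1, 0; 0, 0] ∧ ψ (vecMulVec v' w') = !![0, 0; 0, 1] := by
  have key : ∀ {v w v' w' : n → F}, w ⬝ᵥ v = 1 → w' ⬝ᵥ v' = 1 →
      vecMulVec v w * vecMulVec v' w' = 0 → w ⬝ᵥ v' = 0 := by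
    intro v w v' w' h h' h0
    have e : w ᵥ* (vecMulVec v w * vecMulVec v' w') ⬝ᵥ v' = 0 := by rw [h0]; simp
    rw [vecMulVec_mul_vecMulVec, vecMul_vecMulVec, h] at e
    simpa [h'] using e
  have e₀ := key hwv hwv' h₀
  have e₁ := key hwv' hwv h₁
  have hWV : (Matrix.of ![w, w'] : Matrix (Fin 2) n F) * (Matrix.of ![v, v'])ᵀ = 1 := by
    ext i j
    rw [Matrix.mul_apply']
    fin_cases i <;> fin_cases j
    exacts [hwv, e₀, e₁, hwv']
  have hVW : (Matrix.of ![v, v'])ᵀ * (Matrix.of ![w, w'] : Matrix (Fin 2) n F) = 1 := by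
    rw [h]
    ext i j
    simp [Matrix.mul_apply, vecMulVec_apply]
  have hmul : ∀ x, (Matrix.of ![w, w'] : Matrix (Fin 2) n F) *ᵥ x = ![w ⬝ᵥ x, w' ⬝ᵥ x] := by
    intro x; ext i; fin_cases i <;> rfl
  have hmul' : ∀ x, x ᵥ* (Matrix.of ![v, v'])ᵀ = ![x ⬝ᵥ v, x ⬝ᵥ v'] := by
    intro x; ext i; fin_cases i <;> rfl
  refine ⟨compress K _ _ hWV hVW, trace_compress K _ _ hWV hVW, ?_, ?_⟩
  · rw [compress_apply, mul_vecMulVec, vecMulVec_mul, hmul, hmul', hwv, e₀, e₁]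
    ext i j
    fin_cases i <;> fin_cases j <;> simp [vecMulVec_apply]
  · rw [compress_apply, mul_vecMulVec, vecMulVec_mul, hmul, hmul', hwv', e₀, e₁]
    ext i j
    fin_cases i <;> fin_cases j <;> simp [vecMulVec_apply]

end Matrix

/-! ### The coordinates of an order that satisfies the rational conditions -/

section Assemble

variable {K : Type*} [Field K] {ι : Type*} {F : Fin 4 ⊕ ι → Type*} [∀ i, Field (F i)]
  [∀ i, Algebra K (F i)] {d : Fin 4 ⊕ ι → ℕ}

/-- An isomorphism to the coordinate algebra, assembled from isomorphisms of the components. -/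
def CoordinateAlgebra.assemble (φ : ∀ i : Fin 2, Matrix (Fin (d (Sum.inl (Fin.castAdd 2 i))))
      (Fin (d (Sum.inl (Fin.castAdd 2 i)))) (F (Sum.inl (Fin.castAdd 2 i))) ≃ₐ[K] K)
    (ψ : ∀ i : Fin 2, Matrix (Fin (d (Sum.inl (Fin.natAdd 2 i))))
      (Fin (d (Sum.inl (Fin.natAdd 2 i)))) (F (Sum.inl (Fin.natAdd 2 i))) ≃ₐ[K]
        Matrix (Fin 2) (Fin 2) K)
    (χ : ∀ r, Matrix (Fin (d (Sum.inr r))) (Fin (d (Sum.inr r))) (F (Sum.inr r)) ≃ₐ[K]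
      F (Sum.inr r)) :
    (∀ i, Matrix (Fin (d i)) (Fin (d i)) (F i)) ≃ₐ[K]
      CoordinateAlgebra K fun r => F (Sum.inr r) where
  toFun X := (fun i => φ i (X _), fun i => ψ i (X _), fun r => χ r (X _))
  invFun Y
    | .inl 0 => (φ 0).symm (Y.1 0)
    | .inl 1 => (φ 1).symm (Y.1 1)
    | .inl 2 => (ψ 0).symm (Y.2.1 0)
    | .inl 3 => (ψ 1).symm (Y.2.1 1)
    | .inr r => (χ r).symm (Y.2.2 r)
  left_inv X := by
    ext1 i
    rcases i with i | r
    · fin_cases i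
      · exact (φ 0).symm_apply_apply _
      · exact (φ 1).symm_apply_apply _
      · exact (ψ 0).symm_apply_apply _
      · exact (ψ 1).symm_apply_apply _
    · exact (χ r).symm_apply_apply _
  right_inv Y := by
    refine Prod.ext (funext fun i => ?_) (Prod.ext (funext fun i => ?_) (funext fun r => ?_))
    · fin_cases i
      · exact (φ 0).apply_symm_apply _
      · exact (φ 1).apply_symm_apply _
    · fin_cases i
      · exact (ψ 0).apply_symm_apply _
      · exact (ψ 1).apply_symm_apply _
    · exact (χ r).apply_symm_apply _
  map_mul' X Y := Prod.ext (funext fun i => map_mul (φ i) _ _)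
    (Prod.ext (funext fun i => map_mul (ψ i) _ _) (funext fun r => map_mul (χ r) _ _))
  map_add' X Y := Prod.ext (funext fun i => map_add (φ i) _ _)
    (Prod.ext (funext fun i => map_add (ψ i) _ _) (funext fun r => map_add (χ r) _ _))
  commutes' k := Prod.ext (funext fun i => (φ i).commutes k)
    (Prod.ext (funext fun i => (ψ i).commutes k) (funext fun r => (χ r).commutes k))

end Assemble

end

/-! ### From decomposition numbers to coordinates on K ⊗ Γ -/

section

open CoordinateAlgebra

section Components

variable {O : Type u} {K : Type v} {Γ : Type w} [CommRing O] [Field K] [Algebra O K] [Ring Γ]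
  [Algebra O Γ] {ι : Type*} [DecidableEq ι] {F : ι → Type*} [∀ i, Field (F i)]
  [∀ i, Algebra K (F i)] {d : ι → ℕ}
  (Ψ : (K ⊗[O] Γ) ≃ₐ[K] (∀ i, Matrix (Fin (d i)) (Fin (d i)) (F i))) {f : Γ} {i : ι}

theorem symm_single_one_mul (a : K ⊗[O] Γ) :
    Ψ.symm (Pi.single i 1) * a = Ψ.symm (Pi.single i (Ψ a i)) := by
  apply Ψ.injective
  rw [map_mul, Ψ.apply_symm_apply, Ψ.apply_symm_apply, ← Pi.single_mul_left, one_mul]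

theorem symm_single_one_comm (a : K ⊗[O] Γ) :
    Ψ.symm (Pi.single i 1) * a = a * Ψ.symm (Pi.single i 1) := by
  apply Ψ.injective
  rw [map_mul, map_mul, Ψ.apply_symm_apply, ← Pi.single_mul_left, ← Pi.single_mul_right, one_mul,
    mul_one]

theorem apply_eq_zero_of_decompositionNumber
    (h : decompositionNumber K (Ψ.symm (Pi.single i 1)) f = 0) :
    Ψ ((1 : K) ⊗ₜ[O] f) i = 0 := by
  rw [decompositionNumber_eq_zero_iff, symm_single_one_mul, EmbeddingLike.map_eq_zero_iff,
    Pi.single_eq_zero_iff] at h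
  exact h

/-- Multiplicity one makes the right ideal simple, so the component of the idempotent f is primitive
and has rank one. -/
theorem exists_eq_vecMulVec_of_decompositionNumber (hf : IsIdempotentElem f)
    (h : decompositionNumber K (Ψ.symm (Pi.single i 1)) f = 1) :
    ∃ v w, Ψ ((1 : K) ⊗ₜ[O] f) i = Matrix.vecMulVec v w ∧ w ⬝ᵥ v = 1 := by
  have hinj : Function.Injective fun X => Ψ.symm (Pi.single i X) :=
    Ψ.symm.injective.comp (Pi.single_injective i)
  have hmul : ∀ X Y, Ψ.symm (Pi.single i X) * Ψ.symm (Pi.single i Y) =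
      Ψ.symm (Pi.single i (X * Y)) := fun X Y => by
    rw [← map_mul, Pi.single_mul]
  have h0 : Ψ.symm (Pi.single i (0 : Matrix (Fin (d i)) (Fin (d i)) (F i))) = 0 := by simp
  refine Matrix.exists_eq_vecMulVec ?_ (fun h0' => ?_) fun Q h₁ h₂ h₃ => ?_
  · rw [← Pi.mul_apply, ← map_mul, Algebra.TensorProduct.tmul_mul_tmul, one_mul, hf.eq]
  · have h' : decompositionNumber K (Ψ.symm (Pi.single i 1)) f = 0 := by
      rw [decompositionNumber_eq_zero_iff, symm_single_one_mul, h0', h0]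
    exact zero_ne_one (h'.symm.trans h)
  · rw [decompositionNumber, symm_single_one_mul] at h
    rcases eq_of_length_principalRightIdeal_eq_one h (q := Ψ.symm (Pi.single i Q))
      (by rw [hmul, h₁]) (by rw [hmul, h₂]) (by rw [hmul, h₃]) with h' | h'
    · exact Or.inl (hinj (h'.trans h0.symm))
    · exact Or.inr (hinj h')

end Components

section Rows

variable {K F : Type*} [Field K] [Field F] [Algebra K F] (b : F ≃ₐ[K] K) {d : ℕ}

theorem exists_algEquiv_of_row_one_zero {P Q : Matrix (Fin d) (Fin d) F} (hPQ : P + Q = 1)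
    (hP : ∃ v w, P = Matrix.vecMulVec v w ∧ w ⬝ᵥ v = 1) (hQ : Q = 0) :
    ∃ φ : Matrix (Fin d) (Fin d) F ≃ₐ[K] K, ∀ X, φ X = b X.trace := by
  obtain ⟨v, w, rfl, h⟩ := hP
  rw [hQ, add_zero] at hPQ
  obtain ⟨φ, hφ⟩ := Matrix.exists_algEquiv_of_one_eq_vecMulVec K hPQ.symm h
  exact ⟨φ.trans b, fun X => congrArg b (hφ X)⟩

theorem exists_algEquiv_of_row_one_one {P Q : Matrix (Fin d) (Fin d) F} (hPQ : P + Q = 1)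
    (hPQ₀ : P * Q = 0) (hQP₀ : Q * P = 0)
    (hP : ∃ v w, P = Matrix.vecMulVec v w ∧ w ⬝ᵥ v = 1)
    (hQ : ∃ v w, Q = Matrix.vecMulVec v w ∧ w ⬝ᵥ v = 1) :
    ∃ ψ : Matrix (Fin d) (Fin d) F ≃ₐ[K] Matrix (Fin 2) (Fin 2) K,
      (∀ X, (ψ X).trace = b X.trace) ∧ ψ P = !![1, 0; 0, 0] ∧ ψ Q = !![0, 0; 0, 1] := by
  obtain ⟨v, w, rfl, h⟩ := hP
  obtain ⟨v', w', rfl, h'⟩ := hQ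
  obtain ⟨ψ, hψ, h₀, h₁⟩ := Matrix.exists_algEquiv_of_one_eq_add K hPQ.symm h h' hPQ₀ hQP₀
  refine ⟨ψ.trans b.mapMatrix, fun X => ?_, ?_, ?_⟩
  · rw [← hψ]
    simp [Matrix.trace]
  · rw [AlgEquiv.trans_apply, h₀]
    ext i j
    fin_cases i <;> fin_cases j <;> simp
  · rw [AlgEquiv.trans_apply, h₁]
    ext i j
    fin_cases i <;> fin_cases j <;> simp

end Rows

section Representation

variable {O : Type u} {K : Type v} {Γ : Type w} [CommRing O] [Field K] [Algebra O K] [Ring Γ]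
  [Algebra O Γ] {ζ : ℕ → AlgebraicClosure K} {n : ℕ} {d : DTwoBRow n → ℕ}
  (Ψ : (K ⊗[O] Γ) ≃ₐ[K] (∀ i, Matrix (Fin (d i)) (Fin (d i)) (rowField ζ n i))) {f₀ f₁ : Γ}

/-- The fields in the last components of the coordinate algebra. -/
abbrev realCyclotomicRow (ζ : ℕ → AlgebraicClosure K) (n : ℕ) (r : Fin (n - 2)) : Type v :=
  rowField ζ n (Sum.inr r)

/-- Coordinates for the algebra `K ⊗ Γ` adapted to two orthogonal idempotents with the prescribed
decomposition numbers. -/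
theorem exists_coordinates (hf₀ : IsIdempotentElem f₀) (hf₁ : IsIdempotentElem f₁)
    (hsum : f₀ + f₁ = 1)
    (h₀ : ∀ i, decompositionNumber K (Ψ.symm (Pi.single i 1)) f₀ = rowDecomposition n i 0)
    (h₁ : ∀ i, decompositionNumber K (Ψ.symm (Pi.single i 1)) f₁ = rowDecomposition n i 1) :
    ∃ Φ : (K ⊗[O] Γ) ≃ₐ[K] CoordinateAlgebra K (realCyclotomicRow ζ n),
      Φ ((1 : K) ⊗ₜ f₀) = corner₀₀ 1 1 ∧ Φ ((1 : K) ⊗ₜ f₁) = corner₁₁ 1 1 ∧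
      ∀ (u₁ u₂ u₃ : K) a, form u₁ u₂ u₃ (Φ a) = ∑ i, Algebra.trace K (rowField ζ n i)
        (algebraMap K _ (rowSymmetrizing n u₁ u₂ u₃ i) * (Ψ a i).trace) := by
  obtain ⟨P, hP⟩ : ∃ P, P = Ψ ((1 : K) ⊗ₜ[O] f₀) := ⟨_, rfl⟩
  obtain ⟨Q, hQ⟩ : ∃ Q, Q = Ψ ((1 : K) ⊗ₜ[O] f₁) := ⟨_, rfl⟩
  have hf₁' : f₁ = 1 - f₀ := eq_sub_of_add_eq' hsum
  have hPQ : ∀ i, P i + Q i = 1 := fun i => by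
    rw [hP, hQ, ← Pi.add_apply, ← map_add, ← TensorProduct.tmul_add, hsum,
      ← Algebra.TensorProduct.one_def, map_one, Pi.one_apply]
  have hPQ₀ : ∀ i, P i * Q i = 0 := fun i => by
    rw [hP, hQ, ← Pi.mul_apply, ← map_mul, Algebra.TensorProduct.tmul_mul_tmul, hf₁', mul_sub,
      mul_one, mul_one, hf₀.eq, sub_self, TensorProduct.tmul_zero, map_zero, Pi.zero_apply]
  have hQP₀ : ∀ i, Q i * P i = 0 := fun i => by
    rw [hP, hQ, ← Pi.mul_apply, ← map_mul, Algebra.TensorProduct.tmul_mul_tmul, hf₁', sub_mul,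
      one_mul, one_mul, hf₀.eq, sub_self, TensorProduct.tmul_zero, map_zero, Pi.zero_apply]
  have hP1 : ∀ i, rowDecomposition n i 0 = 1 → ∃ v w, P i = Matrix.vecMulVec v w ∧ w ⬝ᵥ v = 1 :=
    fun i hi => hP ▸ exists_eq_vecMulVec_of_decompositionNumber Ψ hf₀ (by rw [h₀, hi, Nat.cast_one])
  have hQ1 : ∀ i, rowDecomposition n i 1 = 1 → ∃ v w, Q i = Matrix.vecMulVec v w ∧ w ⬝ᵥ v = 1 :=
    fun i hi => hQ ▸ exists_eq_vecMulVec_of_decompositionNumber Ψ hf₁ (by rw [h₁, hi, Nat.cast_one])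
  have hP0 : ∀ i, rowDecomposition n i 0 = 0 → P i = 0 :=
    fun i hi => hP ▸ apply_eq_zero_of_decompositionNumber Ψ (by rw [h₀, hi, Nat.cast_zero])
  have hQ0 : ∀ i, rowDecomposition n i 1 = 0 → Q i = 0 :=
    fun i hi => hQ ▸ apply_eq_zero_of_decompositionNumber Ψ (by rw [h₁, hi, Nat.cast_zero])
  let b : ∀ i : Fin 4, rowField ζ n (Sum.inl i) ≃ₐ[K] K := fun i =>
    IntermediateField.botEquiv K (AlgebraicClosure K)
  have htr : ∀ (i : Fin 4) x, Algebra.trace K (rowField ζ n (Sum.inl i)) x = b i x := fun i x => by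
    rw [← Algebra.trace_eq_of_algEquiv (b i) x, Algebra.trace_self_apply]
  choose φ hφ using fun i : Fin 2 => exists_algEquiv_of_row_one_zero
    (b (Fin.castAdd 2 i)) (hPQ _) (hP1 _ (by fin_cases i <;> rfl)) (hQ0 _ (by fin_cases i <;> rfl))
  choose ψ hψ hψ₀ hψ₁ using fun i : Fin 2 => exists_algEquiv_of_row_one_one
    (b (Fin.natAdd 2 i)) (hPQ _) (hPQ₀ _) (hQP₀ _) (hP1 _ (by fin_cases i <;> rfl))
      (hQ1 _ (by fin_cases i <;> rfl))
  -- In a row (0, 1) the roles of f₀ and f₁ are exchanged. The isomorphism is taken over the field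
  -- of the row, so that the matrix trace keeps its values in that field.
  choose χ hχ using fun r : Fin (n - 2) => exists_algEquiv_of_row_one_zero
    (AlgEquiv.refl : rowField ζ n (Sum.inr r) ≃ₐ[rowField ζ n (Sum.inr r)] _)
    ((add_comm _ _).trans (hPQ _)) (hQ1 _ rfl) (hP0 _ rfl)
  let Φ := Ψ.trans (assemble φ ψ fun r => (χ r).restrictScalars K)
  have hΦ : ∀ a, Φ a = (fun i => φ i (Ψ a _), fun i => ψ i (Ψ a _), fun r => χ r (Ψ a _)) :=
    fun a => rfl
  refine ⟨Φ, ?_, ?_, fun u₁ u₂ u₃ a => ?_⟩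
  · rw [hΦ, ← hP]
    refine Prod.ext (funext fun i => ?_) (Prod.ext (funext fun i => hψ₀ i) (funext fun r => ?_))
    · have h := hPQ (Sum.inl (Fin.castAdd 2 i))
      rw [hQ0 _ (by fin_cases i <;> rfl), add_zero] at h
      exact (congrArg (φ i) h).trans (map_one _)
    · exact (congrArg (χ r) (hP0 _ rfl)).trans (map_zero _)
  · rw [hΦ, ← hQ]
    refine Prod.ext (funext fun i => ?_) (Prod.ext (funext fun i => hψ₁ i) (funext fun r => ?_))
    · exact (congrArg (φ i) (hQ0 _ (by fin_cases i <;> rfl))).trans (map_zero _)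
    · have h := hPQ (Sum.inr r)
      rw [hP0 _ rfl, zero_add] at h
      exact (congrArg (χ r) h).trans (map_one _)
  · rw [hΦ, Fintype.sum_sum_type, Fin.sum_univ_four]
    simp only [form, hφ, hψ, hχ, htr, map_mul, AlgEquiv.commutes]
    refine congrArg₂ (· + ·) ?_ rfl
    have h : ∀ s t x y z w : K, s * (x + y) + t * (z + w) = s * x + s * y + t * z + t * w := by
      intros; ring
    exact h _ _ _ _ _ _

/-- Every element of `K ⊗ Γ` is a quotient of an element of `Γ` by a power of two. -/
theorem exists_one_tmul_eq_smul (hK : ∀ k : K, ∃ (N : ℕ) (r : O), algebraMap O K r = 2 ^ N * k)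
    (a : K ⊗[O] Γ) : ∃ (N : ℕ) (x : Γ), (1 : K) ⊗ₜ x = (2 : K) ^ N • a := by
  induction a using TensorProduct.induction_on with
  | zero => exact ⟨0, 0, by simp⟩
  | tmul k x =>
    obtain ⟨N, r, hr⟩ := hK k
    refine ⟨N, r • x, ?_⟩
    rw [← TensorProduct.smul_tmul, TensorProduct.smul_tmul', smul_eq_mul, ← hr,
      Algebra.smul_def, mul_one]
  | add a b ha hb =>
    obtain ⟨N, x, hx⟩ := ha
    obtain ⟨M, y, hy⟩ := hb
    have h : ∀ (N : ℕ) (x : Γ), (1 : K) ⊗ₜ[O] ((2 : O) ^ N • x) = (2 : K) ^ N • (1 : K) ⊗ₜ[O] x := by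
      intro N x
      rw [← TensorProduct.smul_tmul, TensorProduct.smul_tmul', smul_eq_mul, Algebra.smul_def,
        map_pow, map_ofNat]
    refine ⟨N + M, (2 : O) ^ M • x + (2 : O) ^ N • y, ?_⟩
    rw [TensorProduct.tmul_add, h, h, hx, hy, smul_smul, smul_smul, smul_add]
    congr 2 <;> ring

variable {Φ : (K ⊗[O] Γ) ≃ₐ[K] CoordinateAlgebra K (realCyclotomicRow ζ n)}

/-- The coordinates of the elements of an order. -/
def coordinateHom (Φ : (K ⊗[O] Γ) ≃ₐ[K] CoordinateAlgebra K (realCyclotomicRow ζ n)) :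
    Γ →+* CoordinateAlgebra K (realCyclotomicRow ζ n) :=
  (Φ : (K ⊗[O] Γ) →+* _).comp (Algebra.TensorProduct.includeRight : Γ →ₐ[O] K ⊗[O] Γ).toRingHom

theorem coordinateHom_apply (x : Γ) : coordinateHom Φ x = Φ ((1 : K) ⊗ₜ[O] x) := rfl

theorem one_tmul_injective [IsDomain O] [IsFractionRing O K] [Module.Free O Γ] :
    Function.Injective fun x : Γ => (1 : K) ⊗ₜ[O] x :=
  Algebra.TensorProduct.includeRight_injective (A := K) (B := Γ) (IsFractionRing.injective O K)

theorem isSelfDualEmbedding_coordinateHom [IsDomain O] [IsFractionRing O K] [Module.Free O Γ]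
    (hK : ∀ k : K, ∃ (N : ℕ) (r : O), algebraMap O K r = 2 ^ N * k) {u₁ u₂ u₃ : K}
    (hf₀ : Φ ((1 : K) ⊗ₜ f₀) = corner₀₀ 1 1) (hf₁ : Φ ((1 : K) ⊗ₜ f₁) = corner₁₁ 1 1)
    (hΦ : ∀ a, form u₁ u₂ u₃ (Φ a) = ∑ i, Algebra.trace K (rowField ζ n i)
        (algebraMap K _ (rowSymmetrizing n u₁ u₂ u₃ i) * (Ψ a i).trace))
    (hdual : (wedderburnForm (rowField ζ n) d Ψ
        (fun i => algebraMap K _ (rowSymmetrizing n u₁ u₂ u₃ i))).dualSubmodule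
          (orderLattice (O := O) K Γ) = orderLattice (O := O) K Γ) :
    IsSelfDualEmbedding O u₁ u₂ u₃ f₀ f₁ (coordinateHom Φ) := by
  have hform : ∀ a b, wedderburnForm (rowField ζ n) d Ψ
      (fun i => algebraMap K _ (rowSymmetrizing n u₁ u₂ u₃ i)) a b = form u₁ u₂ u₃ (Φ (a * b)) := by
    intro a b
    rw [hΦ]
    simp [wedderburnForm]
  have hmem : ∀ a, a ∈ orderLattice (O := O) K Γ ↔ ∃ x : Γ, (1 : K) ⊗ₜ x = a := fun a => Iff.rfl
  have hone : ∀ k : K, k ∈ (1 : Submodule O K) ↔ ∃ r : O, algebraMap O K r = k := fun k =>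
    Submodule.mem_one
  refine ⟨⟨fun r x => ?_, Φ.injective.comp one_tmul_injective, fun y => ?_, hf₀, hf₁⟩,
    fun x => ?_, fun y hy => ?_⟩
  · rw [coordinateHom_apply, coordinateHom_apply, ← map_smul, TensorProduct.smul_tmul', smul_eq_mul,
      mul_one, ← TensorProduct.smul_tmul, Algebra.smul_def, mul_one]
  · obtain ⟨N, x, hx⟩ := exists_one_tmul_eq_smul hK (Φ.symm y)
    exact ⟨N, x, by rw [coordinateHom_apply, hx, map_smul, Φ.apply_symm_apply]⟩
  · have hx : (1 : K) ⊗ₜ[O] x ∈ orderLattice (O := O) K Γ := ⟨x, rfl⟩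
    rw [← hdual, LinearMap.BilinForm.mem_dualSubmodule] at hx
    -- Since 1 ∈ Γ, integrality of the pairing gives integrality of the linear form itself.
    have := hx ((1 : K) ⊗ₜ 1) ⟨1, rfl⟩
    rwa [hform, hone, Algebra.TensorProduct.tmul_mul_tmul, one_mul, mul_one] at this
  · have hy' : Φ.symm y ∈ orderLattice (O := O) K Γ := by
      rw [← hdual, LinearMap.BilinForm.mem_dualSubmodule]
      rintro _ ⟨x, rfl⟩
      rw [hform, hone, map_mul, Φ.apply_symm_apply]
      exact hy x
    obtain ⟨x, hx⟩ := (hmem _).1 hy'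
    exact ⟨x, by rw [coordinateHom_apply, hx, Φ.apply_symm_apply]⟩

end Representation

end

section

set_option linter.unusedSectionVars false

open CoordinateAlgebra

/-! ### Ranks of corners -/

section Ranks

variable {O K Γ ι : Type*} [CommRing O] [CharZero O] [Field K]
  [Algebra O K] [IsFractionRing O K] [Ring Γ] [Algebra O Γ] [Fintype ι] {F : ι → Type*}
  [∀ r, Field (F r)] [∀ r, Algebra K (F r)] {θ : Γ →+* CoordinateAlgebra K F} {f₀ f₁ : Γ}

/-- The coordinates of the corner belonging to the first idempotent. -/
def cornerProj₀ : CoordinateAlgebra K F →ₗ[K] (Fin 2 → K) × (Fin 2 → K) where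
  toFun x := (x.1, fun s => x.2.1 s 0 0)
  map_add' _ _ := rfl
  map_smul' _ _ := rfl

/-- The coordinates of the corner belonging to the second idempotent. -/
def cornerProj₁ : CoordinateAlgebra K F →ₗ[K] (Fin 2 → K) × (∀ r, F r) where
  toFun x := (fun s => x.2.1 s 1 1, x.2.2)
  map_add' _ _ := rfl
  map_smul' _ _ := rfl

namespace IsLatticeEmbedding

/-- Generators of the projection of the lattice over O span the projected space over K, because the
lattice is full. -/
theorem finrank_le (hθ : IsLatticeEmbedding O f₀ f₁ θ) {V : Type*} [AddCommGroup V] [Module K V]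
    (π : CoordinateAlgebra K F →ₗ[K] V) (hπ : Function.Surjective π) {k : ℕ} (w : Fin k → Γ)
    (h : ∀ x, ∃ c : Fin k → O, π (θ x) = π (θ (∑ i, c i • w i))) : Module.finrank K V ≤ k := by
  have hspan : Submodule.span K (Set.range fun i => π (θ (w i))) = ⊤ := by
    rw [Submodule.eq_top_iff']
    intro v
    obtain ⟨y, rfl⟩ := hπ v
    obtain ⟨N, x, hx⟩ := hθ.dense y
    obtain ⟨c, hc⟩ := h x
    have h2 : (2 : K) ^ N ≠ 0 := pow_ne_zero N (two_ne_zero_of_isFractionRing O K)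
    rw [← Submodule.smul_mem_iff _ h2, ← _root_.map_smul, ← hx, hc, map_sum, map_sum]
    refine Submodule.sum_mem _ fun i _ => ?_
    rw [hθ.map_smul, _root_.map_smul]
    exact Submodule.smul_mem _ _ (Submodule.subset_span ⟨i, rfl⟩)
  have := finrank_range_le_card (R := K) (fun i => π (θ (w i)))
  rwa [Set.finrank, hspan, finrank_top, Fintype.card_fin] at this

theorem four_le (hθ : IsLatticeEmbedding O f₀ f₁ θ) {k : ℕ} (w : Fin k → Γ)
    (h : ∀ x, ∃ c : Fin k → O, f₀ * x * f₀ = ∑ i, c i • w i) : 4 ≤ k := by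
  have h' := hθ.finrank_le cornerProj₀ (fun v => ⟨corner₀₀ v.1 v.2, rfl⟩) w fun x => by
    obtain ⟨c, hc⟩ := h x
    refine ⟨c, ?_⟩
    rw [← hc, hθ.map_f₀_mul_mul_f₀]
    rfl
  simpa using h'

theorem sum_finrank_le [∀ r, FiniteDimensional K (F r)] (hθ : IsLatticeEmbedding O f₀ f₁ θ) {k : ℕ}
    (w : Fin k → Γ) (h : ∀ x, ∃ c : Fin k → O, f₁ * x * f₁ = ∑ i, c i • w i) :
    2 + ∑ r, Module.finrank K (F r) ≤ k := by
  have h' := hθ.finrank_le cornerProj₁ (fun v => ⟨corner₁₁ v.1 v.2, rfl⟩) w fun x => by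
    obtain ⟨c, hc⟩ := h x
    refine ⟨c, ?_⟩
    rw [← hc, hθ.map_f₁_mul_mul_f₁]
    rfl
  simpa [Module.finrank_pi_fintype] using h'

end IsLatticeEmbedding

namespace LiftedQuiver

variable {κ : ℕ} {c : O} (q : LiftedQuiver O κ c Γ)

theorem exists_corner₀₀_eq_sum : ∃ w : Fin 4 → Γ, ∀ x, ∃ r : Fin 4 → O,
    q.f₀ * x * q.f₀ = ∑ i, r i • w i := by
  refine ⟨![q.f₀, q.α, q.β * q.γ, q.α * q.β * q.γ], fun x => ?_⟩
  obtain ⟨r₀, r₁, r₂, r₃, h⟩ := q.corner₀₀ x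
  exact ⟨![r₀, r₁, r₂, r₃], by rw [h, Fin.sum_univ_four]; rfl⟩

theorem exists_corner₁₁_eq_sum : ∃ w : Fin (κ + 1) → Γ, ∀ x, ∃ r : Fin (κ + 1) → O,
    q.f₁ * x * q.f₁ = ∑ i, r i • w i := by
  refine ⟨fun i => q.η ^ (i : ℕ) * q.f₁, fun x => ?_⟩
  obtain ⟨P, hP, h⟩ := q.corner₁₁ x
  refine ⟨fun i => P.coeff i, ?_⟩
  rw [h, Polynomial.aeval_eq_sum_range' (Nat.lt_succ_of_le hP), Finset.sum_mul, Finset.sum_range]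
  simp only [smul_mul_assoc]

end LiftedQuiver

/-- Choose elements of Z whose images under φ₁ form a K-basis up to powers of 2. An O-linear
relation between their φ₂-images also holds under φ₁ by the inclusion of kernels, so it is trivial;
independence over O implies independence over K. -/
theorem finrank_le_of_ker_le [IsDomain O] {Z V₁ V₂ : Type*} [AddCommGroup Z] [Module O Z]
    [AddCommGroup V₁] [Module K V₁] [AddCommGroup V₂] [Module K V₂] [FiniteDimensional K V₁]
    [FiniteDimensional K V₂] (φ₁ : Z →+ V₁) (φ₂ : Z →+ V₂)
    (h₁ : ∀ (r : O) z, φ₁ (r • z) = algebraMap O K r • φ₁ z)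
    (h₂ : ∀ (r : O) z, φ₂ (r • z) = algebraMap O K r • φ₂ z)
    (hspan : ∀ v, ∃ (N : ℕ) (z : Z), φ₁ z = (2 : K) ^ N • v) (hker : ∀ z, φ₂ z = 0 → φ₁ z = 0) :
    Module.finrank K V₁ ≤ Module.finrank K V₂ := by
  let := Module.compHom V₁ (algebraMap O K)
  let := Module.compHom V₂ (algebraMap O K)
  have : IsScalarTower O K V₁ := IsScalarTower.of_algebraMap_smul fun _ _ => rfl
  have : IsScalarTower O K V₂ := IsScalarTower.of_algebraMap_smul fun _ _ => rfl
  let b := Module.finBasis K V₁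
  choose N z hz using fun i => hspan (b i)
  have h2 : (2 : K) ≠ 0 := two_ne_zero_of_isFractionRing O K
  have hli : LinearIndependent K fun i => φ₁ (z i) := by
    simp only [hz]
    exact b.linearIndependent.units_smul fun i => Units.mk0 _ (pow_ne_zero (N i) h2)
  rw [← LinearIndependent.iff_fractionRing O, Fintype.linearIndependent_iff] at hli
  have hli₂ : LinearIndependent K fun i => φ₂ (z i) := by
    rw [← LinearIndependent.iff_fractionRing O, Fintype.linearIndependent_iff]
    intro g hg
    apply hli
    have e₁ : ∑ i, g i • φ₁ (z i) = φ₁ (∑ i, g i • z i) := by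
      rw [map_sum]
      exact Finset.sum_congr rfl fun i _ => (h₁ _ _).symm
    have e₂ : ∑ i, g i • φ₂ (z i) = φ₂ (∑ i, g i • z i) := by
      rw [map_sum]
      exact Finset.sum_congr rfl fun i _ => (h₂ _ _).symm
    rw [e₁]
    exact hker _ (e₂.symm.trans hg)
  simpa using hli₂.fintype_card_le_finrank

namespace IsLatticeEmbedding

variable {Γ' : Type*} [Ring Γ'] [Algebra O Γ'] {θ' : Γ' →+* CoordinateAlgebra K F} {f₀' f₁' : Γ'}

/-- If an isomorphism of centers exchanges the annihilators of the idempotents, then the two corners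
have the same rank. -/
theorem sum_finrank_eq [IsDomain O] [∀ r, FiniteDimensional K (F r)]
    (hθ : IsLatticeEmbedding O f₀ f₁ θ) (hθ' : IsLatticeEmbedding O f₀' f₁' θ')
    (g : Subalgebra.center O Γ ≃ₐ[O] Subalgebra.center O Γ')
    (hg : ∀ z : Subalgebra.center O Γ, (z : Γ) * f₀ = 0 ↔ (g z : Γ') * f₁' = 0) :
    2 + ∑ r, Module.finrank K (F r) = 4 := by
  let φ₁ : Subalgebra.center O Γ →+ (Fin 2 → K) × (Fin 2 → K) :=
    { toFun := fun z => ((θ z).1, fun s => (θ z).2.1 s 1 1)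
      map_zero' := by simp; rfl
      map_add' := fun x y => by simp; rfl }
  let φ₂ : Subalgebra.center O Γ →+ (Fin 2 → K) × (∀ r, F r) :=
    { toFun := fun z => (fun s => (θ' (g z)).2.1 s 1 1, (θ' (g z)).2.2)
      map_zero' := by simp; rfl
      map_add' := fun x y => by simp; rfl }
  have h₁ : ∀ (r : O) z, φ₁ (r • z) = algebraMap O K r • φ₁ z := fun r z => by
    simp only [φ₁, AddMonoidHom.coe_mk, ZeroHom.coe_mk, Subalgebra.coe_smul, hθ.map_smul]
    rfl
  have h₂ : ∀ (r : O) z, φ₂ (r • z) = algebraMap O K r • φ₂ z := fun r z => by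
    simp only [φ₂, AddMonoidHom.coe_mk, ZeroHom.coe_mk, _root_.map_smul, Subalgebra.coe_smul,
      hθ'.map_smul]
    rfl
  have s₁ : ∀ v, ∃ (N : ℕ) (z : _), φ₁ z = (2 : K) ^ N • v := fun v => by
    obtain ⟨N, z, hz⟩ := hθ.exists_center v.1 v.2 0
    refine ⟨N, z, ?_⟩
    simp only [φ₁, AddMonoidHom.coe_mk, ZeroHom.coe_mk, hz]
    ext <;> simp
  have s₂ : ∀ v, ∃ (N : ℕ) (z : _), φ₂ z = (2 : K) ^ N • v := fun v => by
    obtain ⟨N, z, hz⟩ := hθ'.exists_center 0 v.1 v.2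
    refine ⟨N, g.symm z, ?_⟩
    simp only [φ₂, AddMonoidHom.coe_mk, ZeroHom.coe_mk, g.apply_symm_apply, hz]
    ext <;> simp
  have hker : ∀ z, φ₁ z = 0 ↔ φ₂ z = 0 := fun z => by
    have e₁ : φ₁ z = 0 ↔ (z : Γ) * f₀ = 0 := by
      rw [hθ.mul_f₀_eq_zero_iff, Prod.ext_iff, ← funext_iff]
      rfl
    have e₂ : φ₂ z = 0 ↔ (g z : Γ') * f₁' = 0 := by
      rw [hθ'.mul_f₁_eq_zero_iff, Prod.ext_iff, ← funext_iff]
      rfl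
    rw [e₁, e₂, hg]
  have l₁ := finrank_le_of_ker_le φ₁ φ₂ h₁ h₂ s₁ fun z => (hker z).2
  have l₂ := finrank_le_of_ker_le φ₂ φ₁ h₂ h₁ s₂ fun z => (hker z).1
  simp [Module.finrank_pi_fintype] at l₁ l₂
  omega

end IsLatticeEmbedding

end Ranks

section RealCyclotomic

variable {O : Type u} {K : Type v} [CommRing O] [IsDomain O] [IsIntegrallyClosed O] [CharZero O]
  [Field K] [Algebra O K] [IsFractionRing O K] {ζ : ℕ → AlgebraicClosure K} {n : ℕ}

instance (r : Fin (n - 2)) : FiniteDimensional K (realCyclotomicRow ζ n r) :=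
  IntermediateField.adjoin.finiteDimensional (Algebra.IsIntegral.isIntegral _)

/-- Since ξ⁴ = -1, the square of ξ + ξ⁻¹ is 2. A square root of 2 in K would lie in O, contradicting
that 2 is prime there. -/
theorem finrank_realCyclotomic_ne_one (h2 : Prime (2 : O)) {ξ : AlgebraicClosure K}
    (hξ : IsPrimitiveRoot ξ 8) : Module.finrank K (realCyclotomic ξ) ≠ 1 := by
  intro h
  rw [IntermediateField.finrank_eq_one_iff] at h
  have hmem : ξ + ξ⁻¹ ∈ realCyclotomic ξ := IntermediateField.mem_adjoin_simple_self _ _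
  rw [h, IntermediateField.mem_bot] at hmem
  obtain ⟨x, hx⟩ := hmem
  have h0 : ξ ≠ 0 := hξ.ne_zero (by norm_num)
  have h4 : ξ ^ 4 = -1 := by
    have h8 := hξ.pow_eq_one
    have h4' : ξ ^ 4 ≠ 1 := hξ.pow_ne_one_of_pos_of_lt (by norm_num) (by norm_num)
    have : (ξ ^ 4 - 1) * (ξ ^ 4 + 1) = 0 := by linear_combination h8
    rcases mul_eq_zero.1 this with h | h
    · exact absurd (sub_eq_zero.1 h) h4'
    · exact eq_neg_of_add_eq_zero_left h
  have hx2 : x ^ 2 = algebraMap O K 2 := by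
    apply (algebraMap K (AlgebraicClosure K)).injective
    rw [map_pow, hx, map_ofNat, map_ofNat]
    field_simp
    linear_combination h4
  obtain ⟨y, rfl⟩ := IsIntegrallyClosed.exists_algebraMap_eq_of_isIntegral_pow (R := O) (x := x)
    (n := 2) (by norm_num) (hx2 ▸ isIntegral_algebraMap)
  rw [← map_pow] at hx2
  have hy := IsFractionRing.injective O K hx2
  obtain ⟨s, rfl⟩ := h2.dvd_of_dvd_pow (dvd_of_eq hy.symm)
  refine h2.not_isUnit (.of_mul_eq_one (s ^ 2) ?_)
  apply mul_left_cancel₀ h2.ne_zero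
  linear_combination hy

/-- For n ≥ 4 the field K₃ occurs and contributes at least 2, besides the positive contribution of
K₂. -/
theorem three_le_sum_finrank (h2 : Prime (2 : O)) (hζ : IsPrimitiveRoot (ζ 3) 8) (hn : 4 ≤ n) :
    3 ≤ ∑ r, Module.finrank K (realCyclotomicRow ζ n r) := by
  have hpos : ∀ r : Fin (n - 2), 0 < Module.finrank K (realCyclotomicRow ζ n r) := fun r =>
    Module.finrank_pos
  let r₀ : Fin (n - 2) := ⟨0, by omega⟩
  let r₁ : Fin (n - 2) := ⟨1, by omega⟩
  have hne : r₀ ≠ r₁ := by simp [r₀, r₁]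
  have h1 : Module.finrank K (realCyclotomicRow ζ n r₁) ≠ 1 := finrank_realCyclotomic_ne_one h2 hζ
  have hle := Finset.sum_le_univ_sum_of_nonneg (s := {r₀, r₁})
    (f := fun r => Module.finrank K (realCyclotomicRow ζ n r)) fun _ => Nat.zero_le _
  rw [Finset.sum_pair hne] at hle
  have e₀ := hpos r₀
  have e₁ := hpos r₁
  omega

end RealCyclotomic

end

section

/-! ### Isomorphisms of centers and annihilators of idempotents -/

theorem IsPrimitiveIdempotent.map {R S : Type*} [CommRing R] [CommRing S] (φ : R ≃+* S) {ε : R}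
    (h : IsPrimitiveIdempotent ε) : IsPrimitiveIdempotent (φ ε) := by
  obtain ⟨h₁, h₂, h₃⟩ := h
  refine ⟨h₁.map φ, by simpa using h₂, fun f g hf hg hfg hs => ?_⟩
  have := h₃ (φ.symm f) (φ.symm g) (hf.map φ.symm) (hg.map φ.symm)
    (by rw [← map_mul, hfg, map_zero]) (by rw [← map_add, hs, φ.symm_apply_apply])
  simpa using this

section Center

variable {O : Type u} {K : Type v} {Γ : Type w} [CommRing O] [IsDomain O] [Field K] [Algebra O K]
  [IsFractionRing O K] [Ring Γ] [Algebra O Γ]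

theorem centerEmbedding_injective : Function.Injective (centerEmbedding (O := O) K Γ) := by
  have : Module.Flat O K := IsLocalization.flat K (nonZeroDivisors O)
  exact Module.Flat.lTensor_preserves_injective_linearMap (M := K)
    (Subalgebra.center O Γ).val.toLinearMap Subtype.val_injective

theorem centerEmbedding_comm (c : K ⊗[O] Subalgebra.center O Γ) (a : K ⊗[O] Γ) :
    centerEmbedding K Γ c * a = a * centerEmbedding K Γ c := by
  induction c using TensorProduct.induction_on with
  | zero => simp
  | add x y hx hy => rw [map_add, add_mul, mul_add, hx, hy]
  | tmul k z =>
    induction a using TensorProduct.induction_on with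
    | zero => simp
    | add x y hx hy => rw [mul_add, add_mul, hx, hy]
    | tmul l x =>
      simp only [centerEmbedding, Algebra.TensorProduct.map_tmul, AlgHom.coe_id, id_eq,
        Subalgebra.coe_val, Algebra.TensorProduct.tmul_mul_tmul]
      rw [mul_comm, Subalgebra.mem_center_iff.1 z.2 x]

theorem centerEmbedding_one_tmul (z : Subalgebra.center O Γ) :
    centerEmbedding K Γ ((1 : K) ⊗ₜ z) = (1 : K) ⊗ₜ[O] (z : Γ) := rfl

variable [Module.Free O Γ] {ι : Type*} [DecidableEq ι] {F : ι → Type*} [∀ i, Field (F i)]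
  [∀ i, Algebra K (F i)] {d : ι → ℕ}
  (Ψ : (K ⊗[O] Γ) ≃ₐ[K] (∀ i, Matrix (Fin (d i)) (Fin (d i)) (F i)))

theorem exists_eq_scalar (c : K ⊗[O] Subalgebra.center O Γ) (i : ι) :
    ∃ a : F i, Ψ (centerEmbedding K Γ c) i = Matrix.scalar _ a := by
  have h : Ψ (centerEmbedding K Γ c) i ∈ Set.range (Matrix.scalar (Fin (d i))) := by
    refine Matrix.mem_range_scalar_of_commute_single fun x y _ => ?_
    have h := congrFun (congrArg Ψ (centerEmbedding_comm c
      (Ψ.symm (Pi.single i (Matrix.single x y 1))))) i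
    rw [map_mul, map_mul, Ψ.apply_symm_apply, Pi.mul_apply, Pi.mul_apply, Pi.single_eq_same] at h
    exact h.symm
  obtain ⟨a, ha⟩ := h
  exact ⟨a, ha.symm⟩

theorem exists_centerEmbedding_eq (hK : ∀ k : K, ∃ (N : ℕ) (r : O), algebraMap O K r = 2 ^ N * k)
    (h2 : (2 : K) ≠ 0) {a : K ⊗[O] Γ} (ha : ∀ b, a * b = b * a) : ∃ c, centerEmbedding K Γ c = a := by
  obtain ⟨N, x, hx⟩ := exists_one_tmul_eq_smul hK a
  have hxc : x ∈ Subalgebra.center O Γ := by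
    refine Subalgebra.mem_center_iff.2 fun y => one_tmul_injective (O := O) (K := K) ?_
    have h : (1 : K) ⊗ₜ[O] y * (1 : K) ⊗ₜ[O] x = (1 : K) ⊗ₜ[O] x * (1 : K) ⊗ₜ[O] y := by
      rw [hx, smul_mul_assoc, mul_smul_comm, ha]
    simpa using h
  refine ⟨((2 : K) ^ N)⁻¹ • ((1 : K) ⊗ₜ ⟨x, hxc⟩), ?_⟩
  rw [map_smul, centerEmbedding_one_tmul, hx, smul_smul, inv_mul_cancel₀ (pow_ne_zero N h2),
    one_smul]

/-- The center of a matrix component is the field F i, whose only idempotents are 0 and 1. -/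
theorem isPrimitiveIdempotent_of_centerEmbedding_eq {i : ι} (hd : 0 < d i)
    {ε : K ⊗[O] Subalgebra.center O Γ} (hε : centerEmbedding K Γ ε = Ψ.symm (Pi.single i 1)) :
    IsPrimitiveIdempotent ε := by
  have hinj := centerEmbedding_injective (O := O) (K := K) (Γ := Γ)
  have : Nonempty (Fin (d i)) := ⟨⟨0, hd⟩⟩
  have hidem : IsIdempotentElem ε := hinj (by
    rw [map_mul, hε, ← map_mul, ← Pi.single_mul, one_mul])
  refine ⟨hidem, fun h => ?_, fun f g hf hg hfg hs => ?_⟩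
  · rw [h, map_zero, eq_comm, EmbeddingLike.map_eq_zero_iff, Pi.single_eq_zero_iff] at hε
    exact one_ne_zero hε
  · have hεf : ε * f = f := by rw [← hs, add_mul, hf.eq, mul_comm g f, hfg, add_zero]
    obtain ⟨a, ha⟩ := exists_eq_scalar Ψ f i
    have hf' : centerEmbedding K Γ f = Ψ.symm (Pi.single i (Matrix.scalar _ a)) := by
      rw [← ha, ← symm_single_one_mul, ← hε, ← map_mul, hεf]
    have haa : IsIdempotentElem a := by
      have h := congrArg (centerEmbedding K Γ) hf.eq
      rw [map_mul, hf', ← map_mul, ← Pi.single_mul, ← map_mul] at h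
      exact (Matrix.scalar_inj (n := Fin (d i))).1 (Pi.single_injective i (Ψ.symm.injective h))
    rcases IsIdempotentElem.iff_eq_zero_or_one.1 haa with rfl | rfl
    · left
      exact hinj (by rw [hf', map_zero, Pi.single_zero, map_zero, map_zero])
    · right
      have hfε : f = ε := hinj (by rw [hf', hε, map_one])
      rw [hfε] at hs
      exact left_eq_add.1 hs.symm

variable {Γ' : Type w} [Ring Γ'] [Algebra O Γ'] [Module.Free O Γ']

/-- The central element z is a scalar in each component. If zf = 0, then in each component z
vanishes or f does; the latter is the vanishing of a decomposition number, which passes to f'.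
Summing over the components gives the claim. -/
theorem map_mul_eq_zero_of_decompositionNumber [Fintype ι]
    (Ψ : (K ⊗[O] Γ) ≃ₐ[K] (∀ i, Matrix (Fin (d i)) (Fin (d i)) (F i)))
    (hK : ∀ k : K, ∃ (N : ℕ) (r : O), algebraMap O K r = 2 ^ N * k) (h2 : (2 : K) ≠ 0)
    (hd : ∀ i, 0 < d i) (g : Subalgebra.center O Γ ≃ₐ[O] Subalgebra.center O Γ') {f : Γ} {f' : Γ'}
    (h : ∀ ε : K ⊗[O] Subalgebra.center O Γ, IsPrimitiveIdempotent ε →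
      decompositionNumber K (centerEmbedding K Γ ε) f = 0 →
      decompositionNumber K (centerEmbedding K Γ'
        (Algebra.TensorProduct.map (AlgHom.id K K) (g : _ →ₐ[O] _) ε)) f' = 0)
    {z : Subalgebra.center O Γ} (hz : (z : Γ) * f = 0) : (g z : Γ') * f' = 0 := by
  set G := Algebra.TensorProduct.map (AlgHom.id K K) 
    (g : Subalgebra.center O Γ →ₐ[O] Subalgebra.center O Γ')
  have hinj := centerEmbedding_injective (O := O) (K := K) (Γ := Γ)
  choose ε hε using fun i => exists_centerEmbedding_eq hK h2
    (a := Ψ.symm (Pi.single i 1)) (symm_single_one_comm Ψ)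
  have hsum : ∑ i, ε i = 1 := hinj (by
    rw [map_sum, map_one]
    simp only [hε]
    rw [← map_sum, Finset.univ_sum_single]
    exact map_one Ψ.symm)
  have key : ∀ i, centerEmbedding K Γ' (G (ε i)) *
      (centerEmbedding K Γ' (G ((1 : K) ⊗ₜ z)) * (1 : K) ⊗ₜ[O] f') = 0 := by
    intro i
    obtain ⟨a, ha⟩ := exists_eq_scalar Ψ ((1 : K) ⊗ₜ z) i
    by_cases ha0 : a = 0
    · have h0 : ε i * (1 : K) ⊗ₜ z = 0 := hinj (by
        rw [map_mul, hε, symm_single_one_mul, ha, ha0, map_zero, map_zero, Pi.single_zero, map_zero])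
      rw [← mul_assoc, ← map_mul, ← map_mul, h0, map_zero, map_zero, zero_mul]
    · have h0 : decompositionNumber K (centerEmbedding K Γ (ε i)) f = 0 := by
        rw [decompositionNumber_eq_zero_iff, hε, symm_single_one_mul]
        have h1 : centerEmbedding K Γ ((1 : K) ⊗ₜ z) * (1 : K) ⊗ₜ[O] f = 0 := by
          rw [centerEmbedding_one_tmul, Algebra.TensorProduct.tmul_mul_tmul, hz,
            TensorProduct.tmul_zero]
        have h3 := congrFun (congrArg Ψ h1) i
        rw [map_mul, Pi.mul_apply, ha, map_zero, Pi.zero_apply, Matrix.scalar_apply,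
          ← Matrix.smul_eq_diagonal_mul, smul_eq_zero] at h3
        rw [h3.resolve_left ha0, Pi.single_zero, map_zero]
      have h1 := decompositionNumber_eq_zero_iff.1
        (h _ (isPrimitiveIdempotent_of_centerEmbedding_eq Ψ (hd i) (hε i)) h0)
      rw [← mul_assoc, centerEmbedding_comm, mul_assoc, h1, mul_zero]
  apply one_tmul_injective (O := O) (K := K)
  have hfin : centerEmbedding K Γ' (G ((1 : K) ⊗ₜ z)) * (1 : K) ⊗ₜ[O] f' = 0 := by
    have h1 : ∑ i, centerEmbedding K Γ' (G (ε i)) = 1 := by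
      rw [← map_sum, ← map_sum, hsum, map_one, map_one]
    rw [← one_mul (_ * _), ← h1, Finset.sum_mul]
    exact Finset.sum_eq_zero fun i _ => key i
  simpa [G, centerEmbedding] using hfin

end Center

end

section

/-! ### Lifts that satisfy the rational conditions -/

theorem injective_fin_two {σ : Fin 2 → Fin 2} (hσ : Function.Injective σ) :
    σ = id ∨ σ = Equiv.swap 0 1 := by
  revert σ; decide

section Rational

variable {O : Type u} [CommRing O] [IsDomain O] [IsIntegrallyClosed O] [CharZero O]
  {K : Type v} [Field K] [Algebra O K] [IsFractionRing O K] {ζ : ℕ → AlgebraicClosure K} {n : ℕ}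
  {Γ : Type w} [Ring Γ] [Algebra O Γ] [Module.Free O Γ] {c : O}

theorem HasTwoValuation.pow_mul_eq {x : K} (h : HasTwoValuation O x (-n)) :
    ∃ a : Oˣ, (2 : K) ^ n * x = algebraMap O K a := by
  obtain ⟨a, rfl⟩ := h
  refine ⟨a, ?_⟩
  rw [zpow_neg, zpow_natCast, mul_left_comm,
    mul_inv_cancel₀ (pow_ne_zero n (two_ne_zero_of_isFractionRing O K)), mul_one]

/-- A lift that satisfies the rational conditions has a self-dual embedding for which the vertices
`0` and `1` belong to the first and the second column of the decomposition matrix. -/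
theorem SatisfiesRationalConditions.exists_isSelfDualEmbedding (h2 : Prime (2 : O))
    (hK : ∀ k : K, ∃ (N : ℕ) (r : O), algebraMap O K r = 2 ^ N * k)
    (hζ : IsPrimitiveRoot (ζ 3) 8) (hn : 3 ≤ n) (hΓ : SatisfiesRationalConditions O ζ n Γ)
    (q : LiftedQuiver O (2 ^ (n - 2)) c Γ) :
    ∃ (u₁ u₂ u₃ : K) (θ : Γ →+* CoordinateAlgebra K (realCyclotomicRow ζ n)),
      HasTwoValuation O u₁ (-n) ∧ HasTwoValuation O u₂ (-n) ∧
        IsSelfDualEmbedding O u₁ u₂ u₃ q.f₀ q.f₁ θ := by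
  obtain ⟨-, d, Ψ, hd, ⟨e, he, hdec⟩, u₁, u₂, u₃, hu₁, hu₂, -, hdual⟩ := hΓ
  obtain ⟨σ, hσ, hσe⟩ := q.exists_injective_equiv he
  have hvert : ∀ j i, decompositionNumber K (Ψ.symm (Pi.single i 1)) (q.vertex j) =
      rowDecomposition n i (σ j) := fun j i => by
    rw [← hdec, decompositionNumber_eq (q.isIdempotentElem_vertex j) (he.idempotent _) (hσe j)
      (symm_single_one_comm Ψ)]
  rcases injective_fin_two hσ with rfl | rfl
  · obtain ⟨Φ, h₀, h₁, hΦ⟩ := exists_coordinates Ψ q.isIdempotentElem_f₀ q.isIdempotentElem_f₁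
      q.f₀_add_f₁ (hvert 0) (hvert 1)
    exact ⟨u₁, u₂, u₃, _, hu₁, hu₂,
      isSelfDualEmbedding_coordinateHom Ψ hK h₀ h₁ (hΦ u₁ u₂ u₃) hdual⟩
  -- With the columns interchanged, f₁Γf₁ would have rational rank 4, impossible for n = 3 where κ +
  -- 1 = 3 elements span it. For n ≥ 4 the corner f₀Γf₀, spanned by four elements, would have
  -- rational rank at least 5.
  · exfalso
    obtain ⟨Φ, h₁, h₀, hΦ⟩ := exists_coordinates Ψ q.isIdempotentElem_f₁ q.isIdempotentElem_f₀
      ((add_comm _ _).trans q.f₀_add_f₁) (hvert 1) (hvert 0)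
    have hθ := (isSelfDualEmbedding_coordinateHom Ψ hK h₁ h₀ (hΦ u₁ u₂ u₃)
      hdual).toIsLatticeEmbedding
    obtain ⟨w₀, hw₀⟩ := q.exists_corner₀₀_eq_sum
    obtain ⟨w₁, hw₁⟩ := q.exists_corner₁₁_eq_sum
    have e₁ := hθ.four_le w₁ hw₁
    have e₀ := hθ.sum_finrank_le w₀ hw₀
    rcases hn.eq_or_lt with rfl | hn
    · norm_num at e₁
    · have := three_le_sum_finrank (n := n) h2 hζ hn
      omega

variable {Γ' : Type w} [Ring Γ'] [Algebra O Γ'] [Module.Free O Γ']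

/-- The systems in the definition of equal centers have unspecified size. That Γ' has only two
projective indecomposables ensures that the members matched with the vertices of Γ are equivalent to
vertices of Γ'. -/
theorem HaveEqualCenters.exists_forall_decompositionNumber_eq
    (hΓ' : SatisfiesRationalConditions O ζ n Γ')
    (q : LiftedQuiver O (2 ^ (n - 2)) c Γ) (q' : LiftedQuiver O (2 ^ (n - 2)) c Γ')
    (h : HaveEqualCenters O K Γ Γ') :
    ∃ (g : Subalgebra.center O Γ ≃ₐ[O] Subalgebra.center O Γ') (ρ : Fin 2 → Fin 2),
      Function.Injective ρ ∧
      ∀ ε : K ⊗[O] Subalgebra.center O Γ, IsPrimitiveIdempotent ε → ∀ j,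
        decompositionNumber K (centerEmbedding K Γ ε) (q.vertex j) =
          decompositionNumber K (centerEmbedding K Γ'
            (Algebra.TensorProduct.map (AlgHom.id K K) (g : _ →ₐ[O] _) ε)) (q'.vertex (ρ j)) := by
  obtain ⟨g, m, e, e', he, he', hg⟩ := h
  obtain ⟨-, d, Ψ, -, ⟨f, hf, -⟩, -⟩ := hΓ'
  obtain ⟨σ, hσ, hσe⟩ := q.exists_injective_equiv he
  obtain ⟨τ, hτ, hτf⟩ := q'.exists_injective_equiv hf
  have hex : ∀ j, ∃ i, AreEquivalentIdempotents (e' (σ j)) (q'.vertex i) := fun j => by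
    obtain ⟨s, hs⟩ := hf.exists_areEquivalentIdempotents (he'.idempotent (σ j))
      (he'.indecomposable (σ j))
    obtain ⟨i, rfl⟩ := (Finite.injective_iff_surjective.1 hτ) s
    exact ⟨i, hs.trans (he'.idempotent _) (q'.isIdempotentElem_vertex i) (hτf i).symm⟩
  choose ρ hρ using hex
  refine ⟨g, ρ, fun i j hij => hσ (he'.eq_of_areEquivalentIdempotents ?_), fun ε hε j => ?_⟩
  · exact (hρ i).trans (he'.idempotent _) (he'.idempotent _) (hij ▸ (hρ j).symm)
  · rw [decompositionNumber_eq (q.isIdempotentElem_vertex j) (he.idempotent _) (hσe j)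
      (centerEmbedding_comm ε), hg ε hε,
      decompositionNumber_eq (he'.idempotent _) (q'.isIdempotentElem_vertex _) (hρ j)
      (centerEmbedding_comm _)]

theorem HaveEqualCenters.exists_forall_mul_eq_zero_iff
    (hK : ∀ k : K, ∃ (N : ℕ) (r : O), algebraMap O K r = 2 ^ N * k)
    (hΓ : SatisfiesRationalConditions O ζ n Γ) (hΓ' : SatisfiesRationalConditions O ζ n Γ')
    (q : LiftedQuiver O (2 ^ (n - 2)) c Γ) (q' : LiftedQuiver O (2 ^ (n - 2)) c Γ')
    (h : HaveEqualCenters O K Γ Γ') :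
    ∃ (g : Subalgebra.center O Γ ≃ₐ[O] Subalgebra.center O Γ') (ρ : Fin 2 → Fin 2),
      Function.Injective ρ ∧ ∀ j (z : Subalgebra.center O Γ),
        (z : Γ) * q.vertex j = 0 ↔ (g z : Γ') * q'.vertex (ρ j) = 0 := by
  obtain ⟨g, ρ, hρ, hg⟩ := h.exists_forall_decompositionNumber_eq hΓ' q q'
  have h2 : (2 : K) ≠ 0 := two_ne_zero_of_isFractionRing O K
  obtain ⟨-, d, Ψ, hd, -⟩ := hΓ
  obtain ⟨-, d', Ψ', hd', -⟩ := hΓ'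
  refine ⟨g, ρ, hρ, fun j z => ⟨fun hz => ?_, fun hz => ?_⟩⟩
  · exact map_mul_eq_zero_of_decompositionNumber Ψ hK h2 hd g
      (fun ε hε h0 => (hg ε hε j).symm.trans h0) hz
  · have key := map_mul_eq_zero_of_decompositionNumber Ψ' hK h2 hd' g.symm (f' := q.vertex j)
      (fun ε hε h0 => by
        have hε' := hε.map (Algebra.TensorProduct.congr (AlgEquiv.refl : K ≃ₐ[K] K)
          g.symm).toRingEquiv
        refine (hg _ hε' j).trans (Eq.trans ?_ h0)
        congr 2
        exact (Algebra.TensorProduct.congr (AlgEquiv.refl : K ≃ₐ[K] K) g).apply_symm_apply ε) hz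
    simpa using key

theorem HaveEqualCenters.exists_annihilators (h2 : Prime (2 : O))
    (hK : ∀ k : K, ∃ (N : ℕ) (r : O), algebraMap O K r = 2 ^ N * k)
    (hζ : IsPrimitiveRoot (ζ 3) 8) (hn : 3 ≤ n)
    (hΓ : SatisfiesRationalConditions O ζ n Γ) (hΓ' : SatisfiesRationalConditions O ζ n Γ')
    (q : LiftedQuiver O (2 ^ (n - 2)) c Γ) (q' : LiftedQuiver O (2 ^ (n - 2)) c Γ')
    (h : HaveEqualCenters O K Γ Γ') :
    ∃ g : Subalgebra.center O Γ ≃ₐ[O] Subalgebra.center O Γ',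
      (∀ z : Subalgebra.center O Γ, (z : Γ) * q.f₀ = 0 ↔ (g z : Γ') * q'.f₀ = 0) ∧
      ∀ z : Subalgebra.center O Γ, (z : Γ) * q.f₁ = 0 ↔ (g z : Γ') * q'.f₁ = 0 := by
  obtain ⟨g, ρ, hρ, hg⟩ := h.exists_forall_mul_eq_zero_iff hK hΓ hΓ' q q'
  rcases injective_fin_two hρ with rfl | rfl
  · exact ⟨g, hg 0, hg 1⟩
  -- A g exchanging the annihilators of f₀ and f₁ would force the rational corners f₀ and f₁ to have
  -- equal rank 4, which contradicts the generators of f₁Γf₁ for n = 3 and the presence of K₃ for n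
  -- ≥ 4.
  · exfalso
    obtain ⟨_, _, _, θ, -, -, hθ⟩ := hΓ.exists_isSelfDualEmbedding h2 hK hζ hn q
    obtain ⟨_, _, _, θ', -, -, hθ'⟩ := hΓ'.exists_isSelfDualEmbedding h2 hK hζ hn q'
    have e := hθ.sum_finrank_eq hθ'.toIsLatticeEmbedding g (hg 0)
    obtain ⟨w₁, hw₁⟩ := q.exists_corner₁₁_eq_sum
    have e₁ := hθ.sum_finrank_le w₁ hw₁
    rcases hn.eq_or_lt with rfl | hn
    · norm_num at e₁
      omega
    · have := three_le_sum_finrank (n := n) h2 hζ hn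
      omega

end Rational

section Main

variable {O : Type u} [CommRing O] [IsDomain O] [IsDiscreteValuationRing O] [CharZero O]

theorem exists_algebraMap_eq_two_pow_mul (hO : maximalIdeal O = Ideal.span {(2 : O)})
    {K : Type v} [Field K] [Algebra O K] [IsFractionRing O K] (k : K) :
    ∃ (N : ℕ) (r : O), algebraMap O K r = 2 ^ N * k := by
  obtain ⟨a, b, hb, rfl⟩ := IsFractionRing.div_surjective (A := O) k
  have hb0 : b ≠ 0 := nonZeroDivisors.ne_zero hb
  obtain ⟨N, u, hu⟩ := IsDiscreteValuationRing.eq_unit_mul_pow_irreducible hb0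
    ((IsDiscreteValuationRing.irreducible_iff_uniformizer 2).2 hO)
  have hbK : algebraMap O K b ≠ 0 := by simpa using hb0
  refine ⟨N, a * ↑u⁻¹, ?_⟩
  rw [mul_div_assoc', eq_div_iff hbK, ← map_mul, hu, ← map_ofNat (algebraMap O K) 2, ← map_pow,
    ← map_mul]
  congr 1
  linear_combination a * 2 ^ N * u.inv_mul

theorem SatisfiesRationalConditions.exists_isStandardEmbedding
    (hO : maximalIdeal O = Ideal.span {(2 : O)}) {K : Type v} [Field K] [Algebra O K]
    [IsFractionRing O K] {ζ : ℕ → AlgebraicClosure K} (hζ : IsPrimitiveRoot (ζ 3) 8) {n : ℕ}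
    (hn : 3 ≤ n) {c : O} {Γ : Type w} [Ring Γ] [Algebra O Γ] [Module.Free O Γ] [Module.Finite O Γ]
    (hΓ : SatisfiesRationalConditions O ζ n Γ) (q : LiftedQuiver O (2 ^ (n - 2)) c Γ) :
    2 ∣ c ∧ ∃ θ : Γ →+* CoordinateAlgebra K (realCyclotomicRow ζ n),
      IsStandardEmbedding O (n - 2) q.f₀ q.f₁ θ := by
  have h2 : Prime (2 : O) :=
    ((IsDiscreteValuationRing.irreducible_iff_uniformizer 2).2 hO).prime
  have hunit : ∀ x : O, ¬ 2 ∣ x → IsUnit x := fun x hx => by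
    rw [← Ideal.mem_span_singleton, ← hO, IsLocalRing.mem_maximalIdeal, mem_nonunits_iff,
      not_not] at hx
    exact hx
  obtain ⟨u₁, u₂, u₃, θ, hu₁, hu₂, hθ⟩ := hΓ.exists_isSelfDualEmbedding h2
    (exists_algebraMap_eq_two_pow_mul hO) hζ hn q
  obtain ⟨ε₁, hε₁⟩ := hu₁.pow_mul_eq
  obtain ⟨ε₂, hε₂⟩ := hu₂.pow_mul_eq
  have hm : n - 2 + 2 = n := by omega
  exact hθ.exists_isStandardEmbedding h2 hunit (Fintype.card_fin _) (by rw [hm, hε₁])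
    (by rw [hm, hε₂]) ε₂.isUnit

end Main

end

end

theorem mainTheorem2
    {O : Type u} [CommRing O] [IsDomain O] [IsDiscreteValuationRing O] [CharZero O]
    [IsAdicComplete (maximalIdeal O) O] (hO : maximalIdeal O = Ideal.span {(2 : O)})
    [IsAlgClosed (ResidueField O)]
    {K : Type v} [Field K] [Algebra O K] [IsFractionRing O K]
    (ζ : ℕ → AlgebraicClosure K) (hζ : ∀ i, 2 ≤ i → IsPrimitiveRoot (ζ i) (2 ^ i))
    (n : ℕ) (hn : 3 ≤ n) (c : ResidueField O) (hc : c = 0 ∨ c = 1) :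
    (∀ Γ Γ' : OrderLift.{u, u, w} O (DTwoB (ResidueField O) (2 ^ (n - 2)) c),
      SatisfiesRationalConditions O ζ n Γ.carrier →
      SatisfiesRationalConditions O ζ n Γ'.carrier →
      HaveEqualCenters O K Γ.carrier Γ'.carrier →
      Nonempty (Γ.carrier ≃ₐ[O] Γ'.carrier)) ∧
    ((∃ Γ : OrderLift.{u, u, w} O (DTwoB (ResidueField O) (2 ^ (n - 2)) c),
      SatisfiesRationalConditions O ζ n Γ.carrier) → c = 0) := by
  have : Fact (maximalIdeal O = Ideal.span {(2 : O)}) := ⟨hO⟩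
  -- Any lift c₀ of c to O will do, as the lifted relation for α² is only used modulo 2; the second
  -- claim amounts to 2 ∣ c₀.
  obtain ⟨c₀, hc₀⟩ := IsLocalRing.residue_surjective c
  have hκ : 2 ^ (n - 2) ≠ 0 := pow_ne_zero _ two_ne_zero
  have hζ₃ : IsPrimitiveRoot (ζ 3) 8 := hζ 3 (by norm_num)
  refine ⟨fun Γ Γ' hΓ hΓ' h => ?_, fun ⟨Γ, hΓ⟩ => ?_⟩
  · obtain ⟨q⟩ := Γ.nonempty_liftedQuiver hκ hc₀
    obtain ⟨q'⟩ := Γ'.nonempty_liftedQuiver hκ hc₀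
    obtain ⟨-, θ, hθ⟩ := hΓ.exists_isStandardEmbedding hO hζ₃ hn q
    obtain ⟨-, θ', hθ'⟩ := hΓ'.exists_isStandardEmbedding hO hζ₃ hn q'
    obtain ⟨g, hg₀, hg₁⟩ := h.exists_annihilators
      ((IsDiscreteValuationRing.irreducible_iff_uniformizer 2).2 hO).prime
      (exists_algebraMap_eq_two_pow_mul hO) hζ₃ hn hΓ hΓ' q q'
    exact hθ.nonempty_algEquiv hθ' g hg₀ hg₁
  · obtain ⟨q⟩ := Γ.nonempty_liftedQuiver hκ hc₀
    obtain ⟨⟨y, rfl⟩, -⟩ := hΓ.exists_isStandardEmbedding hO hζ₃ hn q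
    rw [← hc₀, IsLocalRing.residue_eq_zero_iff, hO]
    exact Ideal.mem_span_singleton.2 (dvd_mul_right 2 y)
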